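/- Let $k>2$ be an integer and let $\gamma_1,\dots,\gamma_{k-1}$ be real numbers, not all zero. Put $P(x,b)=\sum_{i=1}^{k-1}\gamma_i b^i x^{k-i}$ and let $S\subset\mathbb R^4$ be the hypersurface $y=a+P(x,b)$, with global coordinates $(x,b,a)$ and with the two direction fields $X=\partial_x$ and $Y=\partial_b-P_b(x,b)\,\partial_a$. A (local) multicontact automorphism of $S$ is a $C^\infty$ diffeomorphism $F$ between open subsets of $S$ such that $F_*X$ and $F_*Y$ are multiples of $X$ and $Y$ by nowhere vanishing functions. An infinitesimal multicontact automorphism is a smooth vector field on an open subset of $S$ whose flow consists of multicontact automorphisms. An exponential image is (near a point) the time-one map of the flow of an infinitesimal automorphism. Let $\mathrm{Aut}(S,0)$ be the group of germs at the origin of multicontact automorphisms fixing the origin, and let $E\subset \mathrm{Aut}(S,0)$ be the subgroup generated by those germs that are finite compositions of exponential images (the factors may move the origin). Then: (1) Every multicontact automorphism defined in a neighbourhood of the origin (possibly moving the origin) agrees near the origin with $\psi\circ\Phi$, where $\Phi$ is a multicontact automorphism fixing the origin and $\psi$ is a finite composition of exponential images. (2) $E$ is a normal subgroup of $\mathrm{Aut}(S,0)$.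 The quotient $\mathrm{Aut}(S,0)/E$ is called the group of discrete multicontact automorphisms of $S$. (3) The map $\sigma_1\colon (x,b,a,y)\mapsto(-x,-b,(-1)^k a,(-1)^k y)$ restricts to a multicontact automorphism of $S$. If the indices $i$ with $\gamma_i\ne0$ do not all have the same parity, then the group of discrete multicontact automorphisms is isomorphic to $\mathbb Z_2$, generated by the class of $\sigma_1$. (4) If all indices $i$ with $\gamma_i\neq 0$ have the same parity, then, for any such $i$, the map $\sigma_2\colon (x,b,a,y)\mapsto(x,-b,(-1)^i a,(-1)^i y)$ also restricts to a multicontact automorphism of $S$, and the group of discrete multicontact automorphisms is isomorphic to $\mathbb Z_2\times\mathbb Z_2$, where the classes of $\sigma_1$ and $\sigma_2$ correspond to $(1,0)$ and $(0,1)$. -/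

import Mathlib

open Filter Topology Set
open scoped ContDiff

namespace ParaCR

/-- Coordinates `(x, b, a)` on the hypersurface `S`. -/
abbrev Pt : Type := ℝ × ℝ × ℝ

/-- The ambient product space, with coordinates `(x, b, a, y)`. -/
abbrev Amb : Type := ℝ × ℝ × ℝ × ℝ

/-- `P(x, b) = ∑_{i=1}^{k-1} γ_i b^i x^(k-i)`. -/
def modelPoly (k : ℕ) (γ : ℕ → ℝ) (x b : ℝ) : ℝ :=
  ∑ i ∈ Finset.Icc 1 (k - 1), γ i * b ^ i * x ^ (k - i)

/-- The model hypersurface `S : y - a - P(x, b) = 0`. -/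
def modelSurface (k : ℕ) (γ : ℕ → ℝ) : Set Amb :=
  {q | q.2.2.2 - q.2.2.1 - modelPoly k γ q.1 q.2.1 = 0}

/-- The global parametrisation of `S` by the coordinates `(x, b, a)`. -/
def param (k : ℕ) (γ : ℕ → ℝ) (p : Pt) : Amb :=
  (p.1, p.2.1, p.2.2, p.2.2 + modelPoly k γ p.1 p.2.1)

/-- The direction field `X = ∂_x`. -/
def fieldX (_p : Pt) : Pt := (1, 0, 0)

/-- The direction field `Y = ∂_b - (∑ i γ_i b^(i-1) x^(k-i)) ∂_a`. -/
def fieldY (k : ℕ) (γ : ℕ → ℝ) (p : Pt) : Pt :=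
  (0, 1, -∑ i ∈ Finset.Icc 1 (k - 1), (i : ℝ) * γ i * p.2.1 ^ (i - 1) * p.1 ^ (k - i))

theorem param_injective (k : ℕ) (γ : ℕ → ℝ) : Function.Injective (param k γ) := by
  rintro ⟨x, b, a⟩ ⟨x', b', a'⟩ h
  simp only [param, Prod.mk.injEq] at h
  simp [h.1, h.2.1, h.2.2.1]

theorem range_param (k : ℕ) (γ : ℕ → ℝ) : range (param k γ) = modelSurface k γ := by
  ext ⟨x, b, a, y⟩
  simp only [mem_range, param, modelSurface, mem_ofPred_eq, Prod.mk.injEq]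
  constructor
  · rintro ⟨⟨x', b', a'⟩, rfl, rfl, rfl, rfl⟩
    simp
  · intro h
    exact ⟨(x, b, a), rfl, rfl, rfl, by simp only; linarith⟩

/-- On `S`, `X` is the direction field `TS ∩ Tℝ²_{xy}`: moving along `X` the coordinates
`b`, `a` do not change. -/
theorem param_along_X (k : ℕ) (γ : ℕ → ℝ) (p : Pt) (t : ℝ) :
    (param k γ (p + t • fieldX p)).2.1 = (param k γ p).2.1 ∧
      (param k γ (p + t • fieldX p)).2.2.1 = (param k γ p).2.2.1 := by
  simp [param, fieldX]

/-- On `S`, `Y` is the direction field `TS ∩ Tℝ²_{ab}`: along `Y` the coordinate `x` does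
not change, and the derivative of the coordinate `y` vanishes. -/
theorem param_along_Y (k : ℕ) (γ : ℕ → ℝ) (p : Pt) :
    (∀ t : ℝ, (param k γ (p + t • fieldY k γ p)).1 = (param k γ p).1) ∧
      HasDerivAt (fun t : ℝ => (param k γ (p + t • fieldY k γ p)).2.2.2) 0 0 := by
  obtain ⟨x, b, a⟩ := p
  refine ⟨fun t => by simp [param, fieldY], ?_⟩
  have hb : HasDerivAt (fun t : ℝ => b + t) 1 0 := by
    simpa using (hasDerivAt_id (0 : ℝ)).const_add b
  have hP : HasDerivAt (fun t : ℝ => modelPoly k γ x (b + t))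
      (∑ i ∈ Finset.Icc 1 (k - 1), (i : ℝ) * γ i * b ^ (i - 1) * x ^ (k - i)) 0 := by
    unfold modelPoly
    refine HasDerivAt.fun_sum fun i _ => ?_
    refine (((hb.fun_pow i).const_mul (γ i)).mul_const (x ^ (k - i))).congr_deriv ?_
    simp only [add_zero]
    ring
  set s := ∑ i ∈ Finset.Icc 1 (k - 1), (i : ℝ) * γ i * b ^ (i - 1) * x ^ (k - i) with hs
  have ha : HasDerivAt (fun t : ℝ => a + t * (-s)) (-s) 0 := by
    simpa using ((hasDerivAt_id (0 : ℝ)).mul_const (-s)).const_add a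
  refine ((ha.add hP).congr_deriv (by ring)).congr_of_eventuallyEq ?_
  refine Eventually.of_forall fun t => ?_
  simp [param, fieldY, ← hs]

/-- A local multicontact (para-CR) automorphism of `S`: a smooth diffeomorphism from an open
subset onto an open subset that maps `X` and `Y` to non-vanishing multiples of `X` and `Y`. -/
structure IsLocalAut (k : ℕ) (γ : ℕ → ℝ) (F : OpenPartialHomeomorph Pt Pt) : Prop where
  smooth : ContDiffOn ℝ ∞ F F.source
  smooth_symm : ContDiffOn ℝ ∞ F.symm F.target
  map_X : ∀ p ∈ F.source, ∃ c : ℝ, c ≠ 0 ∧ fderiv ℝ F p (fieldX p) = c • fieldX (F p)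
  map_Y : ∀ p ∈ F.source, ∃ c : ℝ, c ≠ 0 ∧ fderiv ℝ F p (fieldY k γ p) = c • fieldY k γ (F p)

theorem IsLocalAut.differentiableAt {k : ℕ} {γ : ℕ → ℝ} {F : OpenPartialHomeomorph Pt Pt}
    (hF : IsLocalAut k γ F) {p : Pt} (hp : p ∈ F.source) : DifferentiableAt ℝ F p :=
  (hF.smooth.contDiffAt (F.open_source.mem_nhds hp)).differentiableAt (by simp)

theorem isLocalAut_refl (k : ℕ) (γ : ℕ → ℝ) :
    IsLocalAut k γ (OpenPartialHomeomorph.refl Pt) where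
  smooth := contDiffOn_id
  smooth_symm := contDiffOn_id
  map_X p _ := ⟨1, one_ne_zero, by
    change fderiv ℝ (fun q : Pt => q) p (fieldX p) = _
    rw [fderiv_fun_id]; simp [fieldX]⟩
  map_Y p _ := ⟨1, one_ne_zero, by
    change fderiv ℝ (fun q : Pt => q) p (fieldY k γ p) = _
    rw [fderiv_fun_id]; simp⟩

theorem IsLocalAut.trans {k : ℕ} {γ : ℕ → ℝ} {F G : OpenPartialHomeomorph Pt Pt}
    (hF : IsLocalAut k γ F) (hG : IsLocalAut k γ G) : IsLocalAut k γ (F.trans G) := by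
  have key : ∀ V : Pt → Pt,
      (∀ p ∈ F.source, ∃ c : ℝ, c ≠ 0 ∧ fderiv ℝ F p (V p) = c • V (F p)) →
      (∀ p ∈ G.source, ∃ c : ℝ, c ≠ 0 ∧ fderiv ℝ G p (V p) = c • V (G p)) →
      ∀ p ∈ (F.trans G).source, ∃ c : ℝ, c ≠ 0 ∧
        fderiv ℝ (F.trans G) p (V p) = c • V (F.trans G p) := by
    intro V h1 h2 p hp
    rw [OpenPartialHomeomorph.trans_source] at hp
    obtain ⟨c, hc, hc'⟩ := h1 p hp.1
    obtain ⟨d, hd, hd'⟩ := h2 (F p) hp.2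
    refine ⟨c * d, mul_ne_zero hc hd, ?_⟩
    rw [OpenPartialHomeomorph.coe_trans,
      fderiv_comp p (hG.differentiableAt hp.2) (hF.differentiableAt hp.1)]
    simp [hc', hd', mul_smul]
  refine ⟨?_, ?_, key _ hF.map_X hG.map_X, key _ hF.map_Y hG.map_Y⟩
  · rw [OpenPartialHomeomorph.coe_trans, OpenPartialHomeomorph.trans_source]
    exact hG.smooth.comp (hF.smooth.mono inter_subset_left) fun p hp => hp.2
  · rw [OpenPartialHomeomorph.coe_trans_symm, OpenPartialHomeomorph.trans_target]
    exact hF.smooth_symm.comp (hG.smooth_symm.mono inter_subset_left) fun p hp => hp.2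

theorem IsLocalAut.symm {k : ℕ} {γ : ℕ → ℝ} {F : OpenPartialHomeomorph Pt Pt}
    (hF : IsLocalAut k γ F) : IsLocalAut k γ F.symm := by
  have key : ∀ V : Pt → Pt,
      (∀ p ∈ F.source, ∃ c : ℝ, c ≠ 0 ∧ fderiv ℝ F p (V p) = c • V (F p)) →
      ∀ p ∈ F.symm.source, ∃ c : ℝ, c ≠ 0 ∧
        fderiv ℝ F.symm p (V p) = c • V (F.symm p) := by
    intro V h p hp
    have hp' : p ∈ F.target := hp
    have hs := F.map_target hp'
    obtain ⟨c, hc, hc'⟩ := h _ hs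
    refine ⟨c⁻¹, inv_ne_zero hc, ?_⟩
    rw [F.right_inv hp'] at hc'
    have hd : DifferentiableAt ℝ F.symm p :=
      (hF.smooth_symm.contDiffAt (F.open_target.mem_nhds hp')).differentiableAt (by simp)
    have hd' : DifferentiableAt ℝ F.symm (F (F.symm p)) := by rwa [F.right_inv hp']
    have hcomp := fderiv_comp (F.symm p) hd' (hF.differentiableAt hs)
    have hid : (F.symm ∘ F) =ᶠ[𝓝 (F.symm p)] id := F.eventually_left_inverse hs
    rw [hid.fderiv_eq, fderiv_id, F.right_inv hp'] at hcomp
    have := congrArg (fun L => L (V (F.symm p))) hcomp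
    simp only [ContinuousLinearMap.coe_id', id_eq, ContinuousLinearMap.comp_apply, hc',
      map_smul] at this
    rw [this, smul_smul, inv_mul_cancel₀ hc, one_smul]
  exact ⟨hF.smooth_symm, by simpa using hF.smooth, key _ hF.map_X, key _ hF.map_Y⟩

/-- Local multicontact automorphisms of `S` that are defined near the origin and fix it. -/
def PtAut (k : ℕ) (γ : ℕ → ℝ) : Type :=
  {F : OpenPartialHomeomorph Pt Pt // IsLocalAut k γ F ∧ (0 : Pt) ∈ F.source ∧ F 0 = 0}

/-- Two of them define the same germ when they agree near the origin. -/
instance ptAutSetoid (k : ℕ) (γ : ℕ → ℝ) : Setoid (PtAut k γ) where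
  r F G := F.1 =ᶠ[𝓝 (0 : Pt)] G.1
  iseqv := ⟨fun _ => EventuallyEq.rfl, fun h => EventuallyEq.symm h,
    fun h h' => EventuallyEq.trans h h'⟩

/-- The germs at the origin of multicontact automorphisms of `S` that fix the origin. -/
def AutGerm (k : ℕ) (γ : ℕ → ℝ) : Type := Quotient (ptAutSetoid k γ)

namespace PtAut

variable {k : ℕ} {γ : ℕ → ℝ}

theorem tendsto (F : PtAut k γ) : Tendsto F.1 (𝓝 0) (𝓝 0) := by
  simpa only [F.2.2.2] using (F.1.continuousAt F.2.2.1).tendsto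

/-- The identity. -/
def one : PtAut k γ :=
  ⟨OpenPartialHomeomorph.refl Pt, isLocalAut_refl k γ, mem_univ _, rfl⟩

/-- The composition `F ∘ G`. -/
def mul (F G : PtAut k γ) : PtAut k γ :=
  ⟨G.1.trans F.1, G.2.1.trans F.2.1,
    by simp [G.2.2.1, G.2.2.2, F.2.2.1],
    by simp [G.2.2.2, F.2.2.2]⟩

/-- The inverse. -/
def inv (F : PtAut k γ) : PtAut k γ :=
  ⟨F.1.symm, F.2.1.symm,
    by simpa [F.2.2.2] using F.1.map_source F.2.2.1,
    by simpa [F.2.2.2] using F.1.left_inv F.2.2.1⟩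

theorem mul_congr {F F' G G' : PtAut k γ} (hF : F ≈ F') (hG : G ≈ G') :
    mul F G ≈ mul F' G' := by
  have h1 : ∀ᶠ p in 𝓝 (0 : Pt), F.1 (G.1 p) = F'.1 (G.1 p) := G.tendsto.eventually hF
  have h2 : G.1 =ᶠ[𝓝 (0 : Pt)] G'.1 := hG
  change (fun p => F.1 (G.1 p)) =ᶠ[𝓝 (0 : Pt)] fun p => F'.1 (G'.1 p)
  filter_upwards [h1, h2] with p h3 h4
  rw [h3, h4]

theorem inv_congr {F G : PtAut k γ} (h : F ≈ G) : inv F ≈ inv G := by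
  have h1 : ∀ᶠ p in 𝓝 (0 : Pt), F.1 (G.1.symm p) = G.1 (G.1.symm p) :=
    (inv G).tendsto.eventually h
  have h2 : ∀ᶠ p in 𝓝 (0 : Pt), G.1.symm p ∈ F.1.source :=
    (inv G).tendsto.eventually (F.1.open_source.mem_nhds F.2.2.1)
  have h3 : ∀ᶠ p in 𝓝 (0 : Pt), p ∈ G.1.target :=
    G.1.open_target.mem_nhds (inv G).2.2.1
  change F.1.symm =ᶠ[𝓝 (0 : Pt)] G.1.symm
  filter_upwards [h1, h2, h3] with p h4 h5 h6
  rw [G.1.right_inv h6] at h4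
  rw [← F.1.left_inv h5, h4]

end PtAut

/-- The germs form a group under composition. -/
instance autGermGroup (k : ℕ) (γ : ℕ → ℝ) : Group (AutGerm k γ) where
  one := Quotient.mk _ PtAut.one
  mul := Quotient.map₂ PtAut.mul fun _ _ hF _ _ hG => PtAut.mul_congr hF hG
  inv := Quotient.map PtAut.inv fun _ _ h => PtAut.inv_congr h
  mul_assoc := by
    rintro ⟨F⟩ ⟨G⟩ ⟨H⟩
    exact Quotient.sound (EventuallyEq.rfl : (fun p => F.1 (G.1 (H.1 p))) =ᶠ[𝓝 (0 : Pt)] _)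
  one_mul := by
    rintro ⟨F⟩
    exact Quotient.sound (EventuallyEq.rfl : (fun p => F.1 p) =ᶠ[𝓝 (0 : Pt)] _)
  mul_one := by
    rintro ⟨F⟩
    exact Quotient.sound (EventuallyEq.rfl : (fun p => F.1 p) =ᶠ[𝓝 (0 : Pt)] _)
  inv_mul_cancel := by
    rintro ⟨F⟩
    exact Quotient.sound (F.1.eventually_left_inverse F.2.2.1)

/-- `Θ` is the flow on `U`, for times in the open interval `J` around `0`, of the smooth vector
field `V` on `W`, and it consists of local multicontact automorphisms (so that `V` is an
infinitesimal multicontact automorphism near the trajectories of `U`). -/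
structure IsAutFlow (k : ℕ) (γ : ℕ → ℝ) (V : Pt → Pt) (W U : Set Pt) (J : Set ℝ)
    (Θ : ℝ → Pt → Pt) : Prop where
  isOpen_W : IsOpen W
  smooth_V : ContDiffOn ℝ ∞ V W
  isOpen_U : IsOpen U
  isOpen_J : IsOpen J
  ordConnected_J : J.OrdConnected
  zero_mem : (0 : ℝ) ∈ J
  smooth : ContDiffOn ℝ ∞ (fun z : ℝ × Pt => Θ z.1 z.2) (J ×ˢ U)
  initial : ∀ p ∈ U, Θ 0 p = p
  mem : ∀ t ∈ J, ∀ p ∈ U, Θ t p ∈ W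
  deriv : ∀ t ∈ J, ∀ p ∈ U, HasDerivAt (fun s => Θ s p) (V (Θ t p)) t
  isLocalAut : ∀ t ∈ J, ∃ F : OpenPartialHomeomorph Pt Pt,
    IsLocalAut k γ F ∧ F.source = U ∧ EqOn F (Θ t) U

/-- Near `p`, the map `g` is the exponential image (the time-one flow map) of an infinitesimal
multicontact automorphism of `S`. -/
def IsExpAt (k : ℕ) (γ : ℕ → ℝ) (p : Pt) (g : Pt → Pt) : Prop :=
  ∃ (V : Pt → Pt) (W U : Set Pt) (J : Set ℝ) (Θ : ℝ → Pt → Pt),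
    IsAutFlow k γ V W U J Θ ∧ p ∈ U ∧ (1 : ℝ) ∈ J ∧ g =ᶠ[𝓝 p] Θ 1

/-- Near `p`, the map is a finite composition of exponential images of infinitesimal multicontact
automorphisms of `S`. These may move `p`. -/
inductive IsExpComp (k : ℕ) (γ : ℕ → ℝ) (p : Pt) : (Pt → Pt) → Prop
  | id : IsExpComp k γ p (fun q => q)
  | comp {f g : Pt → Pt} : IsExpComp k γ p f → IsExpAt k γ (f p) g →
      IsExpComp k γ p (fun q => g (f q))

/-- The subgroup of the germs that come from exponential images. -/
def expSubgroup (k : ℕ) (γ : ℕ → ℝ) : Subgroup (AutGerm k γ) :=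
  Subgroup.closure {g | ∃ (F : PtAut k γ) (f : Pt → Pt), g = Quotient.mk _ F ∧
    IsExpComp k γ 0 f ∧ F.1 =ᶠ[𝓝 (0 : Pt)] f}

/-- The discrete multicontact automorphisms of `S`: multicontact automorphisms modulo the
exponential images of infinitesimal ones. -/
abbrev DiscreteAut (k : ℕ) (γ : ℕ → ℝ) : Type := AutGerm k γ ⧸ expSubgroup k γ

/-- The germ `g` is the restriction to `S` of the map `T` of the ambient space. -/
def InducedBy (k : ℕ) (γ : ℕ → ℝ) (g : AutGerm k γ) (T : Amb → Amb) : Prop :=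
  ∃ F : PtAut k γ, g = Quotient.mk _ F ∧
    ∀ᶠ p in 𝓝 (0 : Pt), param k γ (F.1 p) = T (param k γ p)

end ParaCR

/-!
# Discrete multicontact automorphisms of model hypersurfaces

The leaves of `X` are the lines on which `(b, a)` is constant, the leaves of `Y` are the curves on
which `(x, y)` is constant. An automorphism `F` near the origin is therefore given by functions
`A(x, y)`, `B(b, a)`, `C(b, a)` and `D(x, y)` (`LeafForm`) subject to a single functional equation
(`LeafForm.master`): if `y = a + P(x, b)`, then `D(x, y) = C(b, a) + P(A(x, y), B(b, a))`. The heart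
of the proof is `IsLocalAut.isDecomposable`: near the origin `F` is a change of signs of the
coordinates (`diag`) followed by finitely many exponential images.

Since `F` preserves `∂²P/∂x∂b` up to a nonvanishing factor (`IsLocalAut.modelPolyDxb_comp`), this
polynomial, which is homogeneous of degree `k - 2`, vanishes to order `k - 2` at every point of the
image of the `a`-axis. A homogeneous polynomial with this property is invariant under translations
in the direction of the point (`IsLocalAut.modelPolyDxb_translate`). Hence either the `a`-axis is
preserved, or `P` is one of three special polynomials: `γ₁ b x ^ (k - 1)`, `γ_(k-1) b ^ (k - 1) x`,
or `c ((x - ρ b) ^ k - x ^ k - (-ρ b) ^ k)`. In each special case the functional equation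
(`affine_of_pencil`, `const_of_translation_invariant`) shows that an explicit flow moves the image
of the axis back to the axis.

If the `a`-axis is preserved, then `A` is linear in `x` and `B` is linear in `b`
(`linear_of_axis`), and comparing coefficients along curves on which `y - a` is fixed gives
`h(y) - h(a) = (y - a) β(a) ^ i α(y) ^ (k - i)` for every `i` with `γ_i ≠ 0`
(`monomial_of_linear`), where `h(a) = C(0, a)`. With two different `i` the functions `α`, `β` are
constant and `F` is a weighted dilation up to translation and signs; with only one `i` the equation
has Möbius solutions (`moebius_of_sign`), which come from one more explicit flow.

Let `multX` and `multY` be the factors by which a germ fixing the origin multiplies `X` and `Y`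
there. Along a flow such factors are continuous, nonvanishing and equal to `1` at time `0`, so they
are positive on exponential images (`IsExpAt.isPositiveAt`). With the decomposition this shows that
`expSubgroup` is the common kernel of the two signs (`mem_expSubgroup_iff`), so that it is normal
and the quotient is detected by them. The two signs are independent if all `i` with `γ_i ≠ 0` have
the same parity, and they agree otherwise (`AdmissibleSigns.eq_of_mixed`).
-/

namespace ParaCR

/-! ### Partial derivatives of the model polynomial -/

section modelPoly

variable (k : ℕ) (γ : ℕ → ℝ)

/-- The partial derivative `∂P/∂x`. -/
def modelPolyDx (x b : ℝ) : ℝ :=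
  ∑ i ∈ Finset.Icc 1 (k - 1), ((k - i : ℕ) : ℝ) * γ i * b ^ i * x ^ (k - i - 1)

/-- The partial derivative `∂P/∂b`. -/
def modelPolyDb (x b : ℝ) : ℝ :=
  ∑ i ∈ Finset.Icc 1 (k - 1), (i : ℝ) * γ i * b ^ (i - 1) * x ^ (k - i)

/-- The mixed derivative `∂²P/∂x∂b`. Since `[X, Y] = -(∂²P/∂x∂b) ∂_a`, its zero set is where the
plane field spanned by `X` and `Y` fails to be a contact structure. -/
def modelPolyDxb (x b : ℝ) : ℝ :=
  ∑ i ∈ Finset.Icc 1 (k - 1), ((i : ℝ) * ((k - i : ℕ) : ℝ) * γ i) * b ^ (i - 1) * x ^ (k - i - 1)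

/-- The ambient coordinate `y` of a point of `S`. -/
def ycoord (p : Pt) : ℝ := p.2.2 + modelPoly k γ p.1 p.2.1

variable {k γ}

theorem fieldY_eq (p : Pt) : fieldY k γ p = (0, 1, -modelPolyDb k γ p.1 p.2.1) := rfl

theorem contDiff_ycoord : ContDiff ℝ ∞ (ycoord k γ) := by
  unfold ycoord modelPoly; fun_prop

theorem continuous_modelPolyDb : Continuous (fun z : ℝ × ℝ => modelPolyDb k γ z.1 z.2) := by
  unfold modelPolyDb; fun_prop

theorem modelPoly_zero_left (x : ℝ) : modelPoly k γ x 0 = 0 := by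
  refine Finset.sum_eq_zero fun i hi => ?_
  have := (Finset.mem_Icc.1 hi).1
  simp [show i ≠ 0 by omega]

theorem modelPoly_zero_right (b : ℝ) : modelPoly k γ 0 b = 0 := by
  refine Finset.sum_eq_zero fun i hi => ?_
  have := Finset.mem_Icc.1 hi
  simp [show k - i ≠ 0 by omega]

theorem modelPolyDb_zero_right (b : ℝ) : modelPolyDb k γ 0 b = 0 := by
  refine Finset.sum_eq_zero fun i hi => ?_
  have := Finset.mem_Icc.1 hi
  simp [show k - i ≠ 0 by omega]

theorem hasDerivAt_modelPoly {f g : ℝ → ℝ} {f' g' t : ℝ} (hf : HasDerivAt f f' t)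
    (hg : HasDerivAt g g' t) :
    HasDerivAt (fun s => modelPoly k γ (f s) (g s))
      (modelPolyDx k γ (f t) (g t) * f' + modelPolyDb k γ (f t) (g t) * g') t := by
  unfold modelPoly modelPolyDx modelPolyDb
  rw [Finset.sum_mul, Finset.sum_mul, ← Finset.sum_add_distrib]
  refine HasDerivAt.fun_sum fun i _ => ?_
  refine (((hg.fun_pow i).const_mul (γ i)).mul (hf.fun_pow (k - i))).congr_deriv ?_
  ring

theorem hasDerivAt_modelPolyDb {f : ℝ → ℝ} {f' t : ℝ} (b : ℝ) (hf : HasDerivAt f f' t) :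
    HasDerivAt (fun s => modelPolyDb k γ (f s) b) (modelPolyDxb k γ (f t) b * f') t := by
  unfold modelPolyDb modelPolyDxb
  rw [Finset.sum_mul]
  refine HasDerivAt.fun_sum fun i _ => ?_
  refine ((hf.fun_pow (k - i)).const_mul ((i : ℝ) * γ i * b ^ (i - 1))).congr_deriv ?_
  ring

/-- The leaf of the direction field `Y` through a point of `S` with coordinates `(x, y)`,
parametrised by `b`. -/
theorem hasDerivAt_leafY (x y b : ℝ) :
    HasDerivAt (fun s : ℝ => ((x, s, y - modelPoly k γ x s) : Pt))
      (fieldY k γ (x, b, y - modelPoly k γ x b)) b := by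
  have h := hasDerivAt_modelPoly (k := k) (γ := γ) (hasDerivAt_const b x) (hasDerivAt_id b)
  refine (hasDerivAt_const b x).prodMk ((hasDerivAt_id b).prodMk ((h.const_sub y).congr_deriv ?_))
  simp [modelPolyDb]

theorem hasDerivAt_leafX (p : Pt) (x : ℝ) :
    HasDerivAt (fun s : ℝ => ((s, p.2) : Pt)) (fieldX p) x :=
  (hasDerivAt_id x).prodMk (hasDerivAt_const x p.2)

theorem hasDerivAt_ycoord {g : ℝ → Pt} {v : Pt} {t : ℝ} (hg : HasDerivAt g v t) :
    HasDerivAt (fun s => ycoord k γ (g s))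
      (v.2.2 + (modelPolyDx k γ (g t).1 (g t).2.1 * v.1
        + modelPolyDb k γ (g t).1 (g t).2.1 * v.2.1)) t := by
  have h1 : HasDerivAt (fun s => (g s).1) v.1 t := hg.fst
  have h2 : HasDerivAt (fun s => (g s).2.1) v.2.1 t := hg.snd.fst
  have h3 : HasDerivAt (fun s => (g s).2.2) v.2.2 t := hg.snd.snd
  exact h3.add (hasDerivAt_modelPoly h1 h2)

end modelPoly

/-! ### Maps that preserve the two foliations -/

section leaves

variable {k : ℕ} {γ : ℕ → ℝ}

/-- A diffeomorphism that maps the leaves of `X` (on which `(b, a)` is constant) to leaves of `X`,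
and the leaves of `Y` (on which `(x, y)` is constant) to leaves of `Y`, is a multicontact
automorphism. -/
theorem isLocalAut_of_leaves {F : OpenPartialHomeomorph Pt Pt}
    (hs : ContDiffOn ℝ ∞ F F.source) (hs' : ContDiffOn ℝ ∞ F.symm F.target)
    (hX : ∀ p ∈ F.source, ∀ q ∈ F.source, p.2 = q.2 → (F p).2 = (F q).2)
    (hY : ∀ p ∈ F.source, ∀ q ∈ F.source, p.1 = q.1 → ycoord k γ p = ycoord k γ q →
      (F p).1 = (F q).1 ∧ ycoord k γ (F p) = ycoord k γ (F q)) :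
    IsLocalAut k γ F := by
  have hd : ∀ p ∈ F.source, DifferentiableAt ℝ F p := fun p hp =>
    (hs.contDiffAt (F.open_source.mem_nhds hp)).differentiableAt (by simp)
  have hinj : ∀ p ∈ F.source, ∀ v : Pt, fderiv ℝ F p v = 0 → v = 0 := by
    intro p hp v hv
    have hd' : DifferentiableAt ℝ F.symm (F p) :=
      (hs'.contDiffAt (F.open_target.mem_nhds (F.map_source hp))).differentiableAt (by simp)
    have hid : (F.symm ∘ F) =ᶠ[𝓝 p] id := F.eventually_left_inverse hp
    have hcomp := fderiv_comp p hd' (hd p hp)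
    rw [hid.fderiv_eq, fderiv_id] at hcomp
    have := congrArg (fun L => L v) hcomp
    simpa [hv] using this
  refine ⟨hs, hs', fun p hp => ?_, fun p hp => ?_⟩
  · have hg : HasDerivAt (fun s : ℝ => F (s, p.2)) (fderiv ℝ F p (fieldX p)) p.1 :=
      HasFDerivAt.comp_hasDerivAt p.1 (hd p hp).hasFDerivAt (hasDerivAt_leafX p p.1)
    have hmem : ∀ᶠ s in 𝓝 p.1, ((s, p.2) : Pt) ∈ F.source :=
      (hasDerivAt_leafX p p.1).continuousAt.eventually_mem (F.open_source.mem_nhds hp)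
    have hc : (fun s : ℝ => (F (s, p.2)).2) =ᶠ[𝓝 p.1] fun _ => (F p).2 :=
      hmem.mono fun s h => hX _ h _ hp rfl
    have h0 : (fderiv ℝ F p (fieldX p)).2 = 0 :=
      HasDerivAt.unique (f := fun s => (F (s, p.2)).2) hg.snd
        ((hasDerivAt_const p.1 (F p).2).congr_of_eventuallyEq hc)
    have he : fderiv ℝ F p (fieldX p) = (fderiv ℝ F p (fieldX p)).1 • fieldX (F p) := by
      refine Prod.ext (by simp [fieldX]) ?_
      rw [h0]; simp [fieldX, Prod.ext_iff]
    refine ⟨_, fun h => ?_, he⟩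
    rw [h, zero_smul] at he
    have := hinj p hp _ he
    simp [fieldX] at this
  · set y := ycoord k γ p with hy
    have hpe : p = (p.1, p.2.1, y - modelPoly k γ p.1 p.2.1) := by
      simp [hy, ycoord]
    have hl := hasDerivAt_leafY (k := k) (γ := γ) p.1 y p.2.1
    rw [← hpe] at hl
    have hg : HasDerivAt (fun s : ℝ => F (p.1, s, y - modelPoly k γ p.1 s))
        (fderiv ℝ F p (fieldY k γ p)) p.2.1 :=
      HasFDerivAt.comp_hasDerivAt_of_eq p.2.1 (hd p hp).hasFDerivAt hl hpe
    have hmem : ∀ᶠ s in 𝓝 p.2.1, ((p.1, s, y - modelPoly k γ p.1 s) : Pt) ∈ F.source :=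
      hl.continuousAt.eventually_mem (F.open_source.mem_nhds (by rwa [← hpe]))
    have hc := hmem.mono fun s h => hY _ h _ hp rfl (by simp [ycoord, hy])
    have h0 : (fderiv ℝ F p (fieldY k γ p)).1 = 0 :=
      HasDerivAt.unique (f := fun s => (F (p.1, s, y - modelPoly k γ p.1 s)).1) hg.fst
        ((hasDerivAt_const p.2.1 (F p).1).congr_of_eventuallyEq
        (hc.mono fun s h => h.1))
    have h1 := (hasDerivAt_ycoord hg).unique
      ((hasDerivAt_const p.2.1 (ycoord k γ (F p))).congr_of_eventuallyEq
        (hc.mono fun s h => h.2))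
    rw [h0, ← hpe] at h1
    have he : fderiv ℝ F p (fieldY k γ p)
        = (fderiv ℝ F p (fieldY k γ p)).2.1 • fieldY k γ (F p) := by
      refine Prod.ext (by rw [h0]; simp [fieldY]) (Prod.ext (by simp [fieldY]) ?_)
      simp only [fieldY_eq, Prod.smul_snd, smul_eq_mul]
      simp only [fieldY_eq] at h1
      linarith
    refine ⟨_, fun h => ?_, he⟩
    rw [h, zero_smul] at he
    have := hinj p hp _ he
    simp [fieldY] at this

end leaves

/-! ### Explicit flows of multicontact automorphisms -/

/-- A local one-parameter group `Θ` of smooth maps, with domain `O` in time and space, that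
preserves the two foliations of `S`. -/
structure LeafFlow (k : ℕ) (γ : ℕ → ℝ) (Θ : ℝ → Pt → Pt) (O : Set (ℝ × Pt)) : Prop where
  isOpen : IsOpen O
  zero_mem : ∀ p, ((0 : ℝ), p) ∈ O
  between : ∀ p s t u, (s, p) ∈ O → (u, p) ∈ O → s ≤ t → t ≤ u → (t, p) ∈ O
  smooth : ContDiffOn ℝ ∞ (fun z : ℝ × Pt => Θ z.1 z.2) O
  zero : ∀ p, Θ 0 p = p
  add : ∀ p s t, (t, p) ∈ O → (s + t, p) ∈ O → (s, Θ t p) ∈ O ∧ Θ s (Θ t p) = Θ (s + t) p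
  leaf_X : ∀ t p q, (t, p) ∈ O → (t, q) ∈ O → p.2 = q.2 → (Θ t p).2 = (Θ t q).2
  leaf_Y : ∀ t p q, (t, p) ∈ O → (t, q) ∈ O → p.1 = q.1 → ycoord k γ p = ycoord k γ q →
    (Θ t p).1 = (Θ t q).1 ∧ ycoord k γ (Θ t p) = ycoord k γ (Θ t q)

namespace LeafFlow

variable {k : ℕ} {γ : ℕ → ℝ} {Θ : ℝ → Pt → Pt} {O : Set (ℝ × Pt)}

theorem neg_mem (h : LeafFlow k γ Θ O) {t : ℝ} {p : Pt} (hp : (t, p) ∈ O) :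
    (-t, Θ t p) ∈ O ∧ Θ (-t) (Θ t p) = p := by
  have := h.add p (-t) t hp (by simpa using h.zero_mem p)
  rwa [neg_add_cancel, h.zero] at this

theorem smooth_time (h : LeafFlow k γ Θ O) (t : ℝ) :
    ContDiffOn ℝ ∞ (Θ t) {p | (t, p) ∈ O} :=
  h.smooth.comp (f := fun p : Pt => (t, p)) (by fun_prop) fun _ hp => hp

theorem isOpen_time (h : LeafFlow k γ Θ O) (t : ℝ) : IsOpen {p | (t, p) ∈ O} :=
  h.isOpen.preimage (f := fun p : Pt => (t, p)) (by fun_prop)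

/-- The time `t` map of the flow on its whole domain. -/
noncomputable def toHomeo (h : LeafFlow k γ Θ O) (t : ℝ) : OpenPartialHomeomorph Pt Pt where
  toFun := Θ t
  invFun := Θ (-t)
  source := {p | (t, p) ∈ O}
  target := {p | (-t, p) ∈ O}
  map_source' _ hp := (h.neg_mem hp).1
  map_target' p hp := by simpa using (h.neg_mem (t := -t) (p := p) hp).1
  left_inv' _ hp := (h.neg_mem hp).2
  right_inv' p hp := by simpa using (h.neg_mem (t := -t) (p := p) hp).2
  open_source := h.isOpen_time t
  open_target := h.isOpen_time (-t)
  continuousOn_toFun := (h.smooth_time t).continuousOn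
  continuousOn_invFun := (h.smooth_time (-t)).continuousOn

theorem isLocalAut_toHomeo (h : LeafFlow k γ Θ O) (t : ℝ) : IsLocalAut k γ (h.toHomeo t) :=
  isLocalAut_of_leaves (h.smooth_time t) (h.smooth_time (-t))
    (fun p hp q hq => h.leaf_X t p q hp hq) (fun p hp q hq => h.leaf_Y t p q hp hq)

/-- The generating vector field of the flow. -/
noncomputable def field (Θ : ℝ → Pt → Pt) (p : Pt) : Pt :=
  fderiv ℝ (fun z : ℝ × Pt => Θ z.1 z.2) (0, p) (1, 0)

theorem differentiableAt (h : LeafFlow k γ Θ O) {z : ℝ × Pt} (hz : z ∈ O) :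
    DifferentiableAt ℝ (fun z : ℝ × Pt => Θ z.1 z.2) z :=
  (h.smooth.contDiffAt (h.isOpen.mem_nhds hz)).differentiableAt (by simp)

theorem hasDerivAt_zero (h : LeafFlow k γ Θ O) (p : Pt) :
    HasDerivAt (fun s => Θ s p) (field Θ p) 0 :=
  HasFDerivAt.comp_hasDerivAt (f := fun s : ℝ => (s, p)) (0 : ℝ)
    (h.differentiableAt (h.zero_mem p)).hasFDerivAt
    ((hasDerivAt_id (0 : ℝ)).prodMk (hasDerivAt_const (0 : ℝ) p))

theorem hasDerivAt (h : LeafFlow k γ Θ O) {t : ℝ} {p : Pt} (hp : (t, p) ∈ O) :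
    HasDerivAt (fun s => Θ s p) (field Θ (Θ t p)) t := by
  have h0 := h.hasDerivAt_zero (Θ t p)
  have h1 : HasDerivAt (fun s => Θ (s - t) (Θ t p)) (field Θ (Θ t p)) t := by
    have := HasDerivAt.scomp_of_eq t h0 ((hasDerivAt_id t).sub_const t) (by simp)
    rwa [one_smul] at this
  have hc : Continuous fun s : ℝ => (s, p) := by fun_prop
  refine h1.congr_of_eventuallyEq ?_
  filter_upwards [hc.continuousAt.eventually_mem (h.isOpen.mem_nhds hp)] with s hs
  have := (h.add p (s - t) t hp (by simpa using hs)).2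
  rw [this, sub_add_cancel]

theorem contDiff_field (h : LeafFlow k γ Θ O) : ContDiff ℝ ∞ (field Θ) := by
  rw [contDiff_iff_contDiffAt]
  intro p
  have h1 : ContDiffAt ℝ ∞ (fderiv ℝ (fun z : ℝ × Pt => Θ z.1 z.2)) (0, p) :=
    (h.smooth.contDiffAt (h.isOpen.mem_nhds (h.zero_mem p))).fderiv_right (by simp)
  have h2 : ContDiffAt ℝ ∞ (fun q : Pt => ((0 : ℝ), q)) p := by fun_prop
  exact (ContDiffAt.comp p h1 h2).clm_apply contDiffAt_const

/-- The domain has to contain times beyond `0` and `1`, since the time interval of `IsExpAt` is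
open. -/
theorem isExpAt (h : LeafFlow k γ Θ O) {p : Pt} (h1 : (-1, p) ∈ O) (h2 : (2, p) ∈ O) :
    IsExpAt k γ p (Θ 1) := by
  set U : Set Pt := {q | ((-1 : ℝ), q) ∈ O} ∩ {q | ((2 : ℝ), q) ∈ O} with hU
  have hm : ∀ t ∈ Ioo (-1 : ℝ) 2, ∀ q ∈ U, (t, q) ∈ O := fun t ht q hq =>
    h.between q _ t _ hq.1 hq.2 ht.1.le ht.2.le
  have hUo : IsOpen U := (h.isOpen_time _).inter (h.isOpen_time _)
  refine ⟨field Θ, univ, U, Ioo (-1) 2, Θ, ⟨isOpen_univ, h.contDiff_field.contDiffOn, hUo,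
    isOpen_Ioo, ordConnected_Ioo, by norm_num, h.smooth.mono fun z hz => hm _ hz.1 _ hz.2,
    fun q _ => h.zero q, fun _ _ _ _ => mem_univ _, fun t ht q hq => h.hasDerivAt (hm t ht q hq),
    fun t ht => ?_⟩, ⟨h1, h2⟩, by norm_num, EventuallyEq.rfl⟩
  have hsub : U ⊆ (h.toHomeo t).source := fun q hq => hm t ht q hq
  have hr : ((h.toHomeo t).restrOpen U hUo).source = U := by
    rw [OpenPartialHomeomorph.restrOpen_source]
    exact inter_eq_right.2 hsub
  have ha := h.isLocalAut_toHomeo t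
  refine ⟨(h.toHomeo t).restrOpen U hUo, ?_, hr, fun _ _ => rfl⟩
  refine isLocalAut_of_leaves ?_ ?_ ?_ ?_
  · rw [hr]; exact ha.smooth.mono hsub
  · exact ha.smooth_symm.mono inter_subset_left
  · rw [hr]; exact fun p hp q hq => h.leaf_X t p q (hsub hp) (hsub hq)
  · rw [hr]; exact fun p hp q hq => h.leaf_Y t p q (hsub hp) (hsub hq)

end LeafFlow

end ParaCR

namespace ParaCR

section flows

variable {k : ℕ} {γ : ℕ → ℝ}

theorem modelPoly_diag {s₁ s₂ s₃ : ℝ}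
    (h : ∀ i, 1 ≤ i → i ≤ k - 1 → γ i ≠ 0 → s₁ ^ (k - i) * s₂ ^ i = s₃) (x b : ℝ) :
    modelPoly k γ (s₁ * x) (s₂ * b) = s₃ * modelPoly k γ x b := by
  unfold modelPoly
  rw [Finset.mul_sum]
  refine Finset.sum_congr rfl fun i hi => ?_
  by_cases h0 : γ i = 0
  · simp [h0]
  · rw [← h i (Finset.mem_Icc.1 hi).1 (Finset.mem_Icc.1 hi).2 h0]
    ring

theorem modelPoly_monomial {i : ℕ} (h1 : 1 ≤ i) (h2 : i ≤ k - 1)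
    (h : ∀ j, 1 ≤ j → j ≤ k - 1 → j ≠ i → γ j = 0) (x b : ℝ) :
    modelPoly k γ x b = γ i * b ^ i * x ^ (k - i) := by
  refine Finset.sum_eq_single_of_mem i (Finset.mem_Icc.2 ⟨h1, h2⟩) fun j hj hji => ?_
  rw [h j (Finset.mem_Icc.1 hj).1 (Finset.mem_Icc.1 hj).2 hji]
  simp

/-- Translations along the `a`-axis. -/
theorem leafFlow_translation (c : ℝ) :
    LeafFlow k γ (fun t p => (p.1, p.2.1, p.2.2 + t * c)) univ where
  isOpen := isOpen_univ
  zero_mem _ := mem_univ _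
  between _ _ _ _ _ _ _ _ := mem_univ _
  smooth := by fun_prop
  zero p := by simp
  add p s t _ _ := ⟨mem_univ _, by simp; ring⟩
  leaf_X t p q _ _ h := by simp [h]
  leaf_Y t p q _ _ h h' := by
    simp only [ycoord] at h' ⊢
    exact ⟨h, by linarith⟩

/-- Weighted dilations. -/
theorem leafFlow_dilation {l m n : ℝ}
    (h : ∀ i, 1 ≤ i → i ≤ k - 1 → γ i ≠ 0 → ((k - i : ℕ) : ℝ) * l + i * m = n) :
    LeafFlow k γ
      (fun t p => (Real.exp (t * l) * p.1, Real.exp (t * m) * p.2.1, Real.exp (t * n) * p.2.2))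
      univ where
  isOpen := isOpen_univ
  zero_mem _ := mem_univ _
  between _ _ _ _ _ _ _ _ := mem_univ _
  smooth := by fun_prop
  zero p := by simp
  add p s t _ _ := ⟨mem_univ _, by simp [add_mul, Real.exp_add, mul_assoc]⟩
  leaf_X t p q _ _ h := by simp [h]
  leaf_Y t p q _ _ h1 h2 := by
    have hd : ∀ x b, modelPoly k γ (Real.exp (t * l) * x) (Real.exp (t * m) * b)
        = Real.exp (t * n) * modelPoly k γ x b := modelPoly_diag fun i hi hi' hi0 => by
      rw [← Real.exp_nat_mul, ← Real.exp_nat_mul, ← Real.exp_add, ← h i hi hi' hi0]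
      ring_nf
    simp only [ycoord] at h2 ⊢
    rw [hd, hd, ← mul_add, ← mul_add, h2, h1]
    exact ⟨rfl, rfl⟩

/-- If `P` is the mixed part of `c (x - ρ b) ^ k`, then `S` is the surface
`(y + c x ^ k) - (a - c (-ρ b) ^ k) = c (x - ρ b) ^ k`, which is invariant under translations
along the planes `x - ρ b = const`. -/
theorem leafFlow_shear {c ρ : ℝ} (s : ℝ)
    (h : ∀ x b, modelPoly k γ x b = c * ((x - ρ * b) ^ k - x ^ k - (-(ρ * b)) ^ k)) :
    LeafFlow k γ (fun t p => (p.1 + ρ * (t * s), p.2.1 + t * s,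
      p.2.2 + c * ((-(ρ * (p.2.1 + t * s))) ^ k - (-(ρ * p.2.1)) ^ k))) univ where
  isOpen := isOpen_univ
  zero_mem _ := mem_univ _
  between _ _ _ _ _ _ _ _ := mem_univ _
  smooth := by fun_prop
  zero p := by simp
  add p s t _ _ := ⟨mem_univ _, by
    ext
    · simp; ring
    · simp; ring
    · simp only
      ring_nf⟩
  leaf_X t p q _ _ h := by simp [h]
  leaf_Y t p q _ _ h1 h2 := by
    simp only [ycoord, h] at h2 ⊢
    rw [h1] at h2 ⊢
    refine ⟨rfl, ?_⟩
    have e : ∀ b : ℝ, q.1 + ρ * (t * s) - ρ * (b + t * s) = q.1 - ρ * b := fun b => by ring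
    rw [e, e]
    linarith

/-- The positive `m`-th root of `1 / z`, for `0 < z`. -/
noncomputable def invRoot (m : ℕ) (z : ℝ) : ℝ := Real.exp (-(Real.log z) / m)

theorem invRoot_pos (m : ℕ) (z : ℝ) : 0 < invRoot m z := Real.exp_pos _

theorem invRoot_one (m : ℕ) : invRoot m 1 = 1 := by simp [invRoot]

theorem invRoot_pow {m : ℕ} (hm : m ≠ 0) {z : ℝ} (hz : 0 < z) : invRoot m z ^ m = 1 / z := by
  have : (m : ℝ) ≠ 0 := by exact_mod_cast hm
  rw [invRoot, ← Real.exp_nat_mul, mul_div_cancel₀ _ this, Real.exp_neg, Real.exp_log hz, one_div]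

theorem invRoot_mul (m : ℕ) {z w : ℝ} (hz : 0 < z) (hw : 0 < w) :
    invRoot m z * invRoot m (w / z) = invRoot m w := by
  rw [invRoot, invRoot, invRoot, ← Real.exp_add, Real.log_div hw.ne' hz.ne']
  congr 1
  ring

theorem contDiffOn_invRoot {E : Type*} [NormedAddCommGroup E] [NormedSpace ℝ E] (m : ℕ)
    {f : E → ℝ} {s : Set E} (hf : ContDiffOn ℝ ∞ f s) (h : ∀ z ∈ s, 0 < f z) :
    ContDiffOn ℝ ∞ (fun z => invRoot m (f z)) s :=
  (((hf.log fun z hz => (h z hz).ne').neg).div_const _).exp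

/-- If `P = γ_i b ^ i x ^ (k - i)`, then `1 / y` and `1 / a` may be translated simultaneously. -/
theorem leafFlow_moebius {i : ℕ} (h1 : 1 ≤ i) (h2 : i ≤ k - 1)
    (h : ∀ j, 1 ≤ j → j ≤ k - 1 → j ≠ i → γ j = 0) (e : ℝ) :
    LeafFlow k γ
      (fun t p => (p.1 * invRoot (k - i) (1 - t * e * ycoord k γ p),
        p.2.1 * invRoot i (1 - t * e * p.2.2), p.2.2 / (1 - t * e * p.2.2)))
      {z | 0 < 1 - z.1 * e * ycoord k γ z.2 ∧ 0 < 1 - z.1 * e * z.2.2.2} := by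
  have hP := modelPoly_monomial h1 h2 h
  have hc : ContDiff ℝ ∞ fun z : ℝ × Pt => 1 - z.1 * e * ycoord k γ z.2 := by
    unfold ycoord modelPoly; fun_prop
  have hc' : ContDiff ℝ ∞ fun z : ℝ × Pt => 1 - z.1 * e * z.2.2.2 := by fun_prop
  have hy : ∀ (t : ℝ) (p : Pt), 0 < 1 - t * e * ycoord k γ p → 0 < 1 - t * e * p.2.2 →
      ycoord k γ (p.1 * invRoot (k - i) (1 - t * e * ycoord k γ p),
        p.2.1 * invRoot i (1 - t * e * p.2.2), p.2.2 / (1 - t * e * p.2.2))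
      = ycoord k γ p / (1 - t * e * ycoord k γ p) := by
    intro t p hp hp'
    conv_lhs => rw [ycoord]
    simp only
    rw [hP, mul_pow, mul_pow, invRoot_pow (by omega) hp', invRoot_pow (by omega) hp,
      eq_div_iff hp.ne']
    have hy : ycoord k γ p = p.2.2 + γ i * p.2.1 ^ i * p.1 ^ (k - i) := by rw [ycoord, hP]
    set y := ycoord k γ p
    have hu : γ i * p.2.1 ^ i * p.1 ^ (k - i) = y - p.2.2 := by linarith
    have : γ i * (p.2.1 ^ i * (1 / (1 - t * e * p.2.2)))
        * (p.1 ^ (k - i) * (1 / (1 - t * e * y)))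
        = (y - p.2.2) / ((1 - t * e * p.2.2) * (1 - t * e * y)) := by
      rw [← hu]; field_simp
    rw [this]
    obtain ⟨d, hd⟩ : ∃ d, d = 1 - t * e * y := ⟨_, rfl⟩
    obtain ⟨d', hd'⟩ : ∃ d', d' = 1 - t * e * p.2.2 := ⟨_, rfl⟩
    have n1 : d ≠ 0 := hd ▸ hp.ne'
    have n2 : d' ≠ 0 := hd' ▸ hp'.ne'
    rw [← hd, ← hd']
    field_simp
    rw [hd, hd']
    ring
  have hg : ∀ s t y : ℝ, 0 < 1 - t * e * y →
      1 - s * e * (y / (1 - t * e * y)) = (1 - (s + t) * e * y) / (1 - t * e * y) := by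
    intro s t y hy
    obtain ⟨d, hd⟩ : ∃ d, d = 1 - t * e * y := ⟨_, rfl⟩
    have n1 : d ≠ 0 := hd ▸ hy.ne'
    rw [← hd]
    field_simp
    rw [hd]
    ring
  have hb : ∀ s t u y : ℝ, 0 < 1 - s * e * y → 0 < 1 - u * e * y → s ≤ t → t ≤ u →
      0 < 1 - t * e * y := by
    intro s t u y hs hu h1 h2
    rcases le_total 0 (e * y) with h | h
    · nlinarith [mul_le_mul_of_nonneg_right h2 h]
    · nlinarith [mul_le_mul_of_nonpos_right h1 h]
  refine ⟨(isOpen_lt continuous_const hc.continuous).inter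
    (isOpen_lt continuous_const hc'.continuous), fun p => by simp,
    fun p s t u hs hu h1 h2 => ⟨hb s t u _ hs.1 hu.1 h1 h2, hb s t u _ hs.2 hu.2 h1 h2⟩,
    ?_, fun p => by simp [invRoot_one], fun p s t ht hst => ?_, fun t p q _ _ h => by simp [h],
    fun t p q hp hq h1 h2 => ?_⟩
  · refine ContDiffOn.prodMk ?_ (ContDiffOn.prodMk ?_ ?_)
    · exact ContDiffOn.mul (by fun_prop) (contDiffOn_invRoot _ hc.contDiffOn fun z hz => hz.1)
    · exact ContDiffOn.mul (by fun_prop) (contDiffOn_invRoot _ hc'.contDiffOn fun z hz => hz.2)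
    · exact ContDiffOn.div (by fun_prop) hc'.contDiffOn fun z hz => hz.2.ne'
  · simp only [mem_ofPred_eq] at ht hst ⊢
    rw [hy t p ht.1 ht.2, hg _ _ _ ht.1, hg _ _ _ ht.2]
    refine ⟨⟨div_pos hst.1 ht.1, div_pos hst.2 ht.2⟩, ?_⟩
    rw [mul_assoc p.1, invRoot_mul _ ht.1 hst.1, mul_assoc p.2.1, invRoot_mul _ ht.2 hst.2,
      div_div_div_cancel_right₀ ht.2.ne']
  · rw [hy t p hp.1 hp.2, hy t q hq.1 hq.2, h2]
    simp [h1]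

/-- If `P = γ_1 b x ^ (k - 1)`, the leaves of `X` are the lines `y = a + b u` in the plane with
coordinates `u = γ_1 x ^ (k - 1)` and `y`; changing their slope `b` by an affine function of `a` is
a projective transformation that preserves the line `u = 0`. -/
theorem leafFlow_slope (hk : 2 < k) (h : ∀ j, 1 ≤ j → j ≤ k - 1 → j ≠ 1 → γ j = 0) (q κ : ℝ) :
    LeafFlow k γ
      (fun t p => (p.1 * invRoot (k - 1) (1 - t * κ * (γ 1 * p.1 ^ (k - 1))),
        p.2.1 + t * (q + κ * p.2.2), p.2.2))
      {z | 0 < 1 - z.1 * κ * (γ 1 * z.2.1 ^ (k - 1))} := by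
  have hP := modelPoly_monomial le_rfl (by omega) h
  have hc : ContDiff ℝ ∞ fun z : ℝ × Pt => 1 - z.1 * κ * (γ 1 * z.2.1 ^ (k - 1)) := by fun_prop
  have hp : ∀ t x : ℝ, 0 < 1 - t * κ * (γ 1 * x ^ (k - 1)) →
      (x * invRoot (k - 1) (1 - t * κ * (γ 1 * x ^ (k - 1)))) ^ (k - 1)
        = x ^ (k - 1) / (1 - t * κ * (γ 1 * x ^ (k - 1))) := by
    intro t x hx
    rw [mul_pow, invRoot_pow (by omega) hx, mul_one_div]
  have hy : ∀ (t : ℝ) (p : Pt), 0 < 1 - t * κ * (γ 1 * p.1 ^ (k - 1)) →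
      ycoord k γ (p.1 * invRoot (k - 1) (1 - t * κ * (γ 1 * p.1 ^ (k - 1))),
        p.2.1 + t * (q + κ * p.2.2), p.2.2)
      = (ycoord k γ p + t * q * (γ 1 * p.1 ^ (k - 1))) / (1 - t * κ * (γ 1 * p.1 ^ (k - 1))) := by
    intro t p ht
    simp only [ycoord, hP, pow_one]
    rw [hp t _ ht]
    obtain ⟨d, hd⟩ : ∃ d, d = 1 - t * κ * (γ 1 * p.1 ^ (k - 1)) := ⟨_, rfl⟩
    have n1 : d ≠ 0 := hd ▸ ht.ne'
    rw [← hd]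
    field_simp
    rw [hd]
    ring
  refine ⟨isOpen_lt continuous_const hc.continuous, fun p => by simp,
    fun p s t u hs hu h1 h2 => ?_, ?_, fun p => by simp [invRoot_one], fun p s t ht hst => ?_,
    fun t p q _ _ h => by simp [h], fun t p q hp hq h1 h2 => ?_⟩
  · simp only [mem_ofPred_eq] at *
    rcases le_total 0 (κ * (γ 1 * p.1 ^ (k - 1))) with h | h
    · nlinarith [mul_le_mul_of_nonneg_right h2 h]
    · nlinarith [mul_le_mul_of_nonpos_right h1 h]
  · refine ContDiffOn.prodMk ?_ (by fun_prop)
    exact ContDiffOn.mul (by fun_prop) (contDiffOn_invRoot _ hc.contDiffOn fun z hz => hz)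
  · simp only [mem_ofPred_eq] at ht hst ⊢
    have e : 1 - s * κ * (γ 1 * (p.1 ^ (k - 1) / (1 - t * κ * (γ 1 * p.1 ^ (k - 1)))))
        = (1 - (s + t) * κ * (γ 1 * p.1 ^ (k - 1))) / (1 - t * κ * (γ 1 * p.1 ^ (k - 1))) := by
      obtain ⟨d, hd⟩ : ∃ d, d = 1 - t * κ * (γ 1 * p.1 ^ (k - 1)) := ⟨_, rfl⟩
      have n1 : d ≠ 0 := hd ▸ ht.ne'
      rw [← hd]
      field_simp
      rw [hd]
      ring
    rw [hp t _ ht, e]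
    refine ⟨div_pos hst ht, ?_⟩
    rw [mul_assoc, invRoot_mul _ ht hst]
    ext
    · rfl
    · simp only
      ring
    · rfl
  · rw [hy t p hp, hy t q hq, h2, h1]
    exact ⟨rfl, rfl⟩

/-- The flow dual to `leafFlow_slope`, for `P = γ_(k-1) b ^ (k - 1) x`: the roles of `(x, y)` and
`(b, a)` are exchanged. -/
theorem leafFlow_slope_dual (hk : 2 < k)
    (h : ∀ j, 1 ≤ j → j ≤ k - 1 → j ≠ k - 1 → γ j = 0) (q κ : ℝ) :
    LeafFlow k γ
      (fun t p => (p.1 + t * (q + κ * ycoord k γ p),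
        p.2.1 * invRoot (k - 1) (1 + t * κ * (γ (k - 1) * p.2.1 ^ (k - 1))),
        (p.2.2 - t * q * (γ (k - 1) * p.2.1 ^ (k - 1)))
          / (1 + t * κ * (γ (k - 1) * p.2.1 ^ (k - 1)))))
      {z | 0 < 1 + z.1 * κ * (γ (k - 1) * z.2.2.1 ^ (k - 1))} := by
  have hP := modelPoly_monomial (by omega) le_rfl h
  have hk1 : k - (k - 1) = 1 := by omega
  simp only [hk1, pow_one] at hP
  set g := γ (k - 1) with hg
  have hc : ContDiff ℝ ∞ fun z : ℝ × Pt => 1 + z.1 * κ * (g * z.2.2.1 ^ (k - 1)) := by fun_prop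
  have hp : ∀ t x : ℝ, 0 < 1 + t * κ * (g * x ^ (k - 1)) →
      (x * invRoot (k - 1) (1 + t * κ * (g * x ^ (k - 1)))) ^ (k - 1)
        = x ^ (k - 1) / (1 + t * κ * (g * x ^ (k - 1))) := by
    intro t x hx
    rw [mul_pow, invRoot_pow (by omega) hx, mul_one_div]
  have hy : ∀ (t : ℝ) (p : Pt), 0 < 1 + t * κ * (g * p.2.1 ^ (k - 1)) →
      ycoord k γ (p.1 + t * (q + κ * ycoord k γ p),
        p.2.1 * invRoot (k - 1) (1 + t * κ * (g * p.2.1 ^ (k - 1))),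
        (p.2.2 - t * q * (g * p.2.1 ^ (k - 1))) / (1 + t * κ * (g * p.2.1 ^ (k - 1))))
      = ycoord k γ p := by
    intro t p ht
    simp only [ycoord, hP]
    rw [hp t _ ht]
    obtain ⟨d, hd⟩ : ∃ d, d = 1 + t * κ * (g * p.2.1 ^ (k - 1)) := ⟨_, rfl⟩
    have n1 : d ≠ 0 := hd ▸ ht.ne'
    rw [← hd]
    field_simp
    rw [hd]
    ring
  refine ⟨isOpen_lt continuous_const hc.continuous, fun p => by simp,
    fun p s t u hs hu h1 h2 => ?_, ?_, fun p => by simp [invRoot_one], fun p s t ht hst => ?_,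
    fun t p q _ _ h => by simp [h], fun t p q hp hq h1 h2 => ?_⟩
  · simp only [mem_ofPred_eq] at *
    rcases le_total 0 (κ * (g * p.2.1 ^ (k - 1))) with h | h
    · nlinarith [mul_le_mul_of_nonneg_right h1 h]
    · nlinarith [mul_le_mul_of_nonpos_right h2 h]
  · refine ContDiffOn.prodMk ?_ (ContDiffOn.prodMk ?_ ?_)
    · unfold ycoord modelPoly; fun_prop
    · exact ContDiffOn.mul (by fun_prop) (contDiffOn_invRoot _ hc.contDiffOn fun z hz => hz)
    · exact ContDiffOn.div (by fun_prop) hc.contDiffOn fun z hz => (ne_of_gt hz)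
  · simp only [mem_ofPred_eq] at ht hst ⊢
    have e : 1 + s * κ * (g * (p.2.1 ^ (k - 1) / (1 + t * κ * (g * p.2.1 ^ (k - 1)))))
        = (1 + (s + t) * κ * (g * p.2.1 ^ (k - 1))) / (1 + t * κ * (g * p.2.1 ^ (k - 1))) := by
      obtain ⟨d, hd⟩ : ∃ d, d = 1 + t * κ * (g * p.2.1 ^ (k - 1)) := ⟨_, rfl⟩
      have n1 : d ≠ 0 := hd ▸ ht.ne'
      rw [← hd]
      field_simp
      rw [hd]
      ring
    rw [hp t _ ht, hy t _ ht, e]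
    refine ⟨div_pos hst ht, ?_⟩
    rw [mul_assoc _ (invRoot _ _), invRoot_mul _ ht hst]
    ext
    · simp only
      ring
    · rfl
    · simp only
      obtain ⟨d, hd⟩ : ∃ d, d = 1 + t * κ * (g * p.2.1 ^ (k - 1)) := ⟨_, rfl⟩
      obtain ⟨d', hd'⟩ : ∃ d', d' = 1 + (s + t) * κ * (g * p.2.1 ^ (k - 1)) := ⟨_, rfl⟩
      have n1 : d ≠ 0 := hd ▸ ht.ne'
      have n2 : d' ≠ 0 := hd' ▸ hst.ne'
      rw [← hd, ← hd']
      field_simp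
      ring
  · rw [hy t p hp, hy t q hq, h2, h1]
    exact ⟨rfl, rfl⟩

end flows

end ParaCR

namespace ParaCR

/-! ### Functional equations -/

section functional

variable {k : ℕ} {γ : ℕ → ℝ}

theorem coeff_eq_zero_of_eventually {n : ℕ} {e : ℕ → ℝ} {t₀ : ℝ}
    (h : ∀ᶠ t in 𝓝 t₀, ∑ i ∈ Finset.Icc 1 n, e i * t ^ i = 0) {i : ℕ} (h1 : 1 ≤ i)
    (h2 : i ≤ n) : e i = 0 := by
  set p : Polynomial ℝ := ∑ i ∈ Finset.Icc 1 n, Polynomial.monomial i (e i) with hp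
  have hinf : Set.Infinite {t | p.IsRoot t} := by
    refine infinite_of_mem_nhds t₀ (h.mono fun t ht => ?_)
    change p.eval t = 0
    rw [hp, Polynomial.eval_finsetSum]
    simpa using ht
  have h0 := Polynomial.eq_zero_of_infinite_isRoot p hinf
  have := congrArg (fun q => Polynomial.coeff q i) h0
  simpa [hp, Polynomial.finsetSum_coeff, Polynomial.coeff_monomial, h1, h2] using this

theorem exists_modelPoly_ne_zero (hγ : ∃ i, 1 ≤ i ∧ i ≤ k - 1 ∧ γ i ≠ 0) :
    ∃ t, modelPoly k γ 1 t ≠ 0 := by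
  obtain ⟨i, h1, h2, h3⟩ := hγ
  by_contra! h
  refine h3 (coeff_eq_zero_of_eventually (t₀ := 0) (Eventually.of_forall fun t => ?_) h1 h2)
  simpa [modelPoly] using h t

theorem modelPoly_homogeneous (x t α β : ℝ) :
    modelPoly k γ (x * α) (x * t * β)
      = x ^ k * ∑ i ∈ Finset.Icc 1 (k - 1), (γ i * β ^ i * α ^ (k - i)) * t ^ i := by
  rw [modelPoly, Finset.mul_sum]
  refine Finset.sum_congr rfl fun i hi => ?_
  have := Finset.mem_Icc.1 hi
  rw [show x ^ k = x ^ i * x ^ (k - i) by rw [← pow_add]; congr 1; omega]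
  ring

/-- Exchanging the roles of `(x, y)` and `(b, a)` replaces `P(x, b)` by `-P(b, x)`. -/
theorem modelPoly_dual (x b : ℝ) :
    modelPoly k (fun i => -γ (k - i)) b x = -modelPoly k γ x b := by
  rw [modelPoly, modelPoly, ← Finset.sum_neg_distrib]
  refine Finset.sum_nbij' (fun i => k - i) (fun i => k - i) ?_ ?_ ?_ ?_ ?_
  · intro i hi; simp only [Finset.mem_Icc] at *; omega
  · intro i hi; simp only [Finset.mem_Icc] at *; omega
  · intro i hi; simp only [Finset.mem_Icc] at *; omega
  · intro i hi; simp only [Finset.mem_Icc] at *; omega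
  · intro i hi
    have := Finset.mem_Icc.1 hi
    rw [show k - (k - i) = i by omega]
    ring

/-- `A` is smooth on the square `(-r, r) × (-r, r)` and `∂A/∂x` does not vanish there. -/
structure SmoothFamily (A : ℝ → ℝ → ℝ) (r : ℝ) : Prop where
  smooth : ContDiffOn ℝ ∞ (fun z : ℝ × ℝ => A z.1 z.2) (Ioo (-r) r ×ˢ Ioo (-r) r)
  deriv_ne : ∀ x ∈ Ioo (-r) r, ∀ y ∈ Ioo (-r) r, deriv (fun x => A x y) x ≠ 0

namespace SmoothFamily

variable {A : ℝ → ℝ → ℝ} {r : ℝ}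

theorem mono (h : SmoothFamily A r) {s : ℝ} (hs : s ≤ r) : SmoothFamily A s := by
  have : Ioo (-s) s ⊆ Ioo (-r) r := Ioo_subset_Ioo (by linarith) hs
  exact ⟨h.smooth.mono (prod_mono this this), fun x hx y hy => h.deriv_ne x (this hx) y (this hy)⟩

theorem contDiffAt (h : SmoothFamily A r) {x y : ℝ} (hx : x ∈ Ioo (-r) r) (hy : y ∈ Ioo (-r) r) :
    ContDiffAt ℝ ∞ (fun z : ℝ × ℝ => A z.1 z.2) (x, y) :=
  h.smooth.contDiffAt ((isOpen_Ioo.prod isOpen_Ioo).mem_nhds ⟨hx, hy⟩)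

theorem contDiffAt_left (h : SmoothFamily A r) {x y : ℝ} (hx : x ∈ Ioo (-r) r)
    (hy : y ∈ Ioo (-r) r) : ContDiffAt ℝ ∞ (fun x => A x y) x :=
  (h.contDiffAt hx hy).comp x (f := fun x : ℝ => (x, y)) (by fun_prop)

theorem contDiffAt_right (h : SmoothFamily A r) {x y : ℝ} (hx : x ∈ Ioo (-r) r)
    (hy : y ∈ Ioo (-r) r) : ContDiffAt ℝ ∞ (fun y => A x y) y :=
  (h.contDiffAt hx hy).comp y (f := fun y : ℝ => (x, y)) (by fun_prop)

theorem hasDerivAt (h : SmoothFamily A r) {x y : ℝ} (hx : x ∈ Ioo (-r) r) (hy : y ∈ Ioo (-r) r) :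
    HasDerivAt (fun x => A x y) (deriv (fun x => A x y) x) x :=
  ((h.contDiffAt_left hx hy).differentiableAt (by simp)).hasDerivAt

end SmoothFamily

theorem eq_of_pow_eq_of_mul_pos {u v : ℝ} {j : ℕ} (hj : j ≠ 0) (h : u ^ j = v ^ j)
    (hp : 0 < u * v) : u = v := by
  rcases (pow_eq_pow_iff_cases).1 h with h | h | h
  · exact absurd h hj
  · exact h
  · rw [h.1] at hp
    nlinarith [mul_self_nonneg v]

/-- A function of one variable without critical points is linear if one of its powers is
a monomial. -/
theorem eq_linear_of_pow_eq {f : ℝ → ℝ} {r κ : ℝ} {j : ℕ} (hj : j ≠ 0)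
    (hd : ∀ x ∈ Ioo (-r) r, HasDerivAt f (deriv f x) x) (hne : ∀ x ∈ Ioo (-r) r, deriv f x ≠ 0)
    (h0 : f 0 = 0) (h : ∀ x ∈ Ioo (-r) r, f x ^ j = κ * x ^ j) {x : ℝ} (hx : x ∈ Ioo (-r) r) :
    f x = x * deriv f 0 := by
  have hr0 : (0 : ℝ) ∈ Ioo (-r) r := by constructor <;> linarith [hx.1, hx.2]
  rcases eq_or_ne x 0 with rfl | hx0
  · simpa using h0
  have hκ : deriv f 0 ^ j = κ := by
    have h1 : Tendsto (fun x => (x⁻¹ * f x) ^ j) (𝓝[≠] 0) (𝓝 (deriv f 0 ^ j)) := by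
      have := (hasDerivAt_iff_tendsto_slope.1 (hd 0 hr0)).pow j
      refine this.congr fun x => ?_
      simp [slope, h0]
    have h2 : Tendsto (fun x => (x⁻¹ * f x) ^ j) (𝓝[≠] 0) (𝓝 κ) := by
      refine (tendsto_const_nhds (x := κ)).congr' ?_
      filter_upwards [self_mem_nhdsWithin, mem_nhdsWithin_of_mem_nhds (isOpen_Ioo.mem_nhds hr0)]
        with x hx hx'
      have hx : x ≠ 0 := hx
      rw [mul_pow, h x hx', inv_pow]
      field_simp
    exact tendsto_nhds_unique h1 h2
  have hpos : ∀ z ∈ Ioo (-r) r, 0 < deriv f z * deriv f 0 := by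
    rcases hasDerivWithinAt_forall_lt_or_forall_gt_of_forall_ne (convex_Ioo (-r) r)
      (fun z hz => (hd z hz).hasDerivWithinAt) hne with hs | hs
    · exact fun z hz => mul_pos_of_neg_of_neg (hs z hz) (hs 0 hr0)
    · exact fun z hz => mul_pos (hs z hz) (hs 0 hr0)
  have hm : StrictMonoOn (fun z => f z * deriv f 0) (Ioo (-r) r) := by
    refine strictMonoOn_of_deriv_pos (convex_Ioo _ _)
      (fun z hz => ((hd z hz).mul_const _).continuousAt.continuousWithinAt) fun z hz => ?_
    rw [interior_Ioo] at hz
    rw [((hd z hz).mul_const _).deriv]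
    exact hpos z hz
  have hsign : 0 < f x * (x * deriv f 0) := by
    rcases lt_or_gt_of_ne hx0 with hlt | hgt
    · have := hm hx hr0 hlt
      simp only [h0, zero_mul] at this
      nlinarith
    · have := hm hr0 hx hgt
      simp only [h0, zero_mul] at this
      nlinarith
  refine eq_of_pow_eq_of_mul_pos hj ?_ hsign
  rw [h x hx, mul_pow, hκ, mul_comm]

/-- If a diffeomorphism `(A(x, y), B(b, a))` preserves the surface `y = a + P(x, b)` and the
`a`-axis, then `A` is linear in `x`: compare the terms of lowest order in `b`. -/
theorem linear_of_axis {A B : ℝ → ℝ → ℝ} {h : ℝ → ℝ} {r : ℝ}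
    (hγ : ∃ i, 1 ≤ i ∧ i ≤ k - 1 ∧ γ i ≠ 0)
    (hA : SmoothFamily A r) (hB : SmoothFamily B r) (hA0 : ∀ y ∈ Ioo (-r) r, A 0 y = 0)
    (hB0 : ∀ a ∈ Ioo (-r) r, B 0 a = 0) (hh : ∀ a ∈ Ioo (-r) r, DifferentiableAt ℝ h a)
    (hrel : ∀ x ∈ Ioo (-r) r, ∀ b ∈ Ioo (-r) r, ∀ a ∈ Ioo (-r) r, ∀ y ∈ Ioo (-r) r,
      y = a + modelPoly k γ x b → h y - h a = modelPoly k γ (A x y) (B b a))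
    {x a : ℝ} (hx : x ∈ Ioo (-r) r) (ha : a ∈ Ioo (-r) r) :
    A x a = x * deriv (fun x => A x a) 0 := by
  classical
  have hr0 : (0 : ℝ) ∈ Ioo (-r) r := by constructor <;> linarith [hx.1, hx.2]
  set i := Nat.find hγ with hi
  obtain ⟨hi1, hi2, hi0⟩ := Nat.find_spec hγ
  rw [← hi] at hi1 hi2 hi0
  have hmin : ∀ m ∈ Finset.Icc 1 (k - 1), m < i → γ m = 0 := fun m hm hlt => by
    by_contra h0
    exact Nat.find_min hγ hlt ⟨(Finset.mem_Icc.1 hm).1, (Finset.mem_Icc.1 hm).2, h0⟩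
  set R : ℝ → ℝ → ℝ := fun x b => ∑ m ∈ Finset.Icc 1 (k - 1), γ m * b ^ (m - i) * x ^ (k - m)
    with hR
  have hRc : Continuous fun z : ℝ × ℝ => R z.1 z.2 := by simp only [hR]; fun_prop
  have hPR : ∀ x b, modelPoly k γ x b = b ^ i * R x b := fun x b => by
    rw [modelPoly, hR, Finset.mul_sum]
    refine Finset.sum_congr rfl fun m hm => ?_
    rcases lt_or_ge m i with hlt | hge
    · simp [hmin m hm hlt]
    · rw [show b ^ m = b ^ i * b ^ (m - i) by rw [← pow_add]; congr 1; omega]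
      ring
  have hR0 : ∀ x, R x 0 = γ i * x ^ (k - i) := fun x => by
    simp only [hR]
    rw [Finset.sum_eq_single_of_mem i (Finset.mem_Icc.2 ⟨hi1, hi2⟩)]
    · simp
    · intro m hm hne
      rcases lt_or_ge m i with hlt | hge
      · simp [hmin m hm hlt]
      · simp [show m - i ≠ 0 by omega]
  set β := deriv (fun b => B b a) 0 with hβ
  have hβ0 : β ≠ 0 := hB.deriv_ne 0 hr0 a ha
  have hBd := hB.hasDerivAt hr0 ha
  have key : ∀ x ∈ Ioo (-r) r, A x a ^ (k - i) = deriv h a / β ^ i * x ^ (k - i) := by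
    intro x hx
    have hPc : ContinuousAt (fun b => a + modelPoly k γ x b) 0 := by
      unfold modelPoly; fun_prop
    have hP0 : a + modelPoly k γ x 0 = a := by rw [modelPoly_zero_left, add_zero]
    have c1 : ContinuousAt (fun b => R x b * dslope h a (a + modelPoly k γ x b)) 0 := by
      refine ContinuousAt.mul (by simp only [hR]; fun_prop) ?_
      exact ContinuousAt.comp_of_eq (continuousAt_dslope_same.2 (hh a ha)) hPc hP0
    have c2 : ContinuousAt (fun b => dslope (fun b => B b a) 0 b ^ i
        * R (A x (a + modelPoly k γ x b)) (B b a)) 0 := by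
      refine ContinuousAt.mul ((continuousAt_dslope_same.2 hBd.differentiableAt).pow i) ?_
      have hA' : ContinuousAt (fun b => A x (a + modelPoly k γ x b)) 0 :=
        ContinuousAt.comp_of_eq (hA.contDiffAt_right hx ha).continuousAt hPc hP0
      exact hRc.continuousAt.comp (hA'.prodMk hBd.continuousAt)
    have heq : (fun b => R x b * dslope h a (a + modelPoly k γ x b)) =ᶠ[𝓝[≠] 0]
        (fun b => dslope (fun b => B b a) 0 b ^ i
          * R (A x (a + modelPoly k γ x b)) (B b a)) := by
      filter_upwards [self_mem_nhdsWithin, mem_nhdsWithin_of_mem_nhds (isOpen_Ioo.mem_nhds hr0),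
        mem_nhdsWithin_of_mem_nhds (hPc.preimage_mem_nhds
          (isOpen_Ioo.mem_nhds (by rwa [hP0] : a + modelPoly k γ x 0 ∈ Ioo (-r) r)))]
        with b hb hb' hy
      have hb : b ≠ 0 := hb
      have e1 := hrel x hx b hb' a ha _ hy rfl
      have e2 := sub_smul_dslope h a (a + modelPoly k γ x b)
      have e3 := sub_smul_dslope (fun b => B b a) 0 b
      simp only [smul_eq_mul, hB0 a ha, sub_zero] at e2 e3
      rw [add_sub_cancel_left] at e2
      have e4 : b ^ i * dslope (fun b => B b a) 0 b ^ i = B b a ^ i := by rw [← mul_pow, e3]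
      refine mul_left_cancel₀ (pow_ne_zero i hb) ?_
      rw [← mul_assoc, ← mul_assoc, ← hPR x b, e4, ← hPR _ (B b a)]
      exact e2.trans e1
    have h0 := tendsto_nhds_unique_of_eventuallyEq (c1.tendsto.mono_left nhdsWithin_le_nhds)
      (c2.tendsto.mono_left nhdsWithin_le_nhds) heq
    simp only [hP0, dslope_same, hB0 a ha, hR0] at h0
    rw [← hβ] at h0
    field_simp
    have : γ i * (A x a ^ (k - i) * β ^ i) = γ i * (x ^ (k - i) * deriv h a) := by linarith
    linarith [mul_left_cancel₀ hi0 this]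
  exact eq_linear_of_pow_eq (show k - i ≠ 0 by omega) (fun x hx => hA.hasDerivAt hx ha)
    (fun x hx => hA.deriv_ne x hx a ha) (hA0 a ha) key hx

/-- If `(x α(y), b β(a))` preserves the surface `y = a + P(x, b)`, then every monomial of `P`
satisfies the functional equation by itself: the curve `P(x, b) = y - a` is mapped to the curve
`P = h(y) - h(a)`, and a homogeneous polynomial is determined up to a factor by one of its
level curves. -/
theorem monomial_of_linear {α β h : ℝ → ℝ} {r : ℝ} (hr : 0 < r)
    (hγ : ∃ i, 1 ≤ i ∧ i ≤ k - 1 ∧ γ i ≠ 0)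
    (hrel : ∀ x ∈ Ioo (-r) r, ∀ b ∈ Ioo (-r) r, ∀ a ∈ Ioo (-r) r, ∀ y ∈ Ioo (-r) r,
      y = a + modelPoly k γ x b → h y - h a = modelPoly k γ (x * α y) (b * β a)) :
    ∃ s : ℝ, (s = 1 ∨ s = -1) ∧ ∃ η > 0, ∀ a ∈ Ioo (-η) η, ∀ y ∈ Ioo (-η) η, 0 < s * (y - a) →
      ∀ i, 1 ≤ i → i ≤ k - 1 → γ i ≠ 0 → h y - h a = (y - a) * β a ^ i * α y ^ (k - i) := by
  obtain ⟨t₀, ht₀⟩ := exists_modelPoly_ne_zero hγ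
  have hk : k ≠ 0 := by obtain ⟨i, h1, h2, -⟩ := hγ; omega
  set p₀ := modelPoly k γ 1 t₀ with hp₀
  obtain ⟨s, hs, hsp⟩ : ∃ s : ℝ, (s = 1 ∨ s = -1) ∧ 0 < s * p₀ := by
    rcases lt_or_gt_of_ne ht₀ with hlt | hgt
    · exact ⟨-1, Or.inr rfl, by linarith⟩
    · exact ⟨1, Or.inl rfl, by linarith⟩
  set δ := r / (1 + |t₀|) with hδ
  have ht1 : 0 < 1 + |t₀| := by positivity
  have hδ0 : 0 < δ := by positivity
  have hδr : δ ≤ r := div_le_self hr.le (by linarith [abs_nonneg t₀])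
  have hδt : |t₀| * δ < r := by
    rw [hδ, mul_div_assoc', div_lt_iff₀ ht1]
    nlinarith [abs_nonneg t₀]
  refine ⟨s, hs, min r (δ ^ k * (s * p₀) / 2), by positivity, ?_⟩
  intro a ha y hy hya i hi1 hi2 hi0
  have har : a ∈ Ioo (-r) r := ⟨by linarith [ha.1, min_le_left r (δ ^ k * (s * p₀) / 2)],
    ha.2.trans_le (min_le_left _ _)⟩
  have hyr : y ∈ Ioo (-r) r := ⟨by linarith [hy.1, min_le_left r (δ ^ k * (s * p₀) / 2)],
    hy.2.trans_le (min_le_left _ _)⟩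
  have hss : s * s = 1 := by rcases hs with rfl | rfl <;> norm_num
  have hs0 : s ≠ 0 := by rcases hs with rfl | rfl <;> norm_num
  -- the point of the level curve `P = y - a` on the ray of slope `t`
  set X : ℝ → ℝ := fun t => ((y - a) / modelPoly k γ 1 t) ^ ((k : ℝ)⁻¹) with hX
  have hcP : Continuous fun t => modelPoly k γ 1 t := by unfold modelPoly; fun_prop
  have hpos₀ : 0 < (y - a) / p₀ := by
    have : (y - a) / p₀ = (s * (y - a)) / (s * p₀) := by field_simp
    rw [this]; positivity
  have hXpow : ∀ t, 0 < (y - a) / modelPoly k γ 1 t →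
      X t ^ k = (y - a) / modelPoly k γ 1 t := fun t ht =>
    Real.rpow_inv_natCast_pow ht.le hk
  have hcd : ContinuousAt (fun t => (y - a) / modelPoly k γ 1 t) t₀ :=
    continuousAt_const.div hcP.continuousAt ht₀
  have hcX : ContinuousAt X t₀ := hcd.rpow_const (Or.inl hpos₀.ne')
  have hX0 : 0 ≤ X t₀ := Real.rpow_nonneg hpos₀.le _
  have hXδ : X t₀ < δ := by
    refine lt_of_pow_lt_pow_left₀ k hδ0.le ?_
    rw [hXpow t₀ hpos₀]
    have h1 : (y - a) / p₀ = (s * (y - a)) / (s * p₀) := by field_simp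
    rw [← hp₀, h1, div_lt_iff₀ hsp]
    have h2 := min_le_right r (δ ^ k * (s * p₀) / 2)
    rcases hs with rfl | rfl
    · linarith [hy.2, ha.1]
    · linarith [hy.1, ha.2]
  have hm1 : ∀ᶠ t in 𝓝 t₀, X t ∈ Ioo (-r) r :=
    hcX.eventually_mem (isOpen_Ioo.mem_nhds ⟨by linarith, by linarith⟩)
  have hm2 : ∀ᶠ t in 𝓝 t₀, X t * t ∈ Ioo (-r) r := by
    refine (hcX.mul continuousAt_id).eventually_mem (isOpen_Ioo.mem_nhds ?_)
    rw [mem_Ioo, ← abs_lt, Pi.mul_apply, id_eq, abs_mul, abs_of_nonneg hX0, mul_comm]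
    exact (mul_le_mul_of_nonneg_left hXδ.le (abs_nonneg _)).trans_lt hδt
  have hm3 : ∀ᶠ t in 𝓝 t₀, 0 < (y - a) / modelPoly k γ 1 t := hcd.eventually (lt_mem_nhds hpos₀)
  have hcoef : ∀ᶠ t in 𝓝 t₀, ∑ i ∈ Finset.Icc 1 (k - 1),
      ((y - a) * (γ i * β a ^ i * α y ^ (k - i)) - (h y - h a) * γ i) * t ^ i = 0 := by
    filter_upwards [hm1, hm2, hm3] with t h1 h2 h3
    have hPt : modelPoly k γ 1 t ≠ 0 := fun h => by simp [h] at h3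
    have hone : ∑ i ∈ Finset.Icc 1 (k - 1), γ i * t ^ i = modelPoly k γ 1 t := by
      simp [modelPoly]
    have e1 : modelPoly k γ (X t) (X t * t) = y - a := by
      have := modelPoly_homogeneous (k := k) (γ := γ) (X t) t 1 1
      simp only [mul_one, one_pow] at this
      rw [this, hone, hXpow t h3]
      field_simp
    have e2 := hrel _ h1 _ h2 a har y hyr (by rw [e1]; ring)
    rw [modelPoly_homogeneous, hXpow t h3] at e2
    have e3 : ∀ i, ((y - a) * (γ i * β a ^ i * α y ^ (k - i)) - (h y - h a) * γ i) * t ^ i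
        = (y - a) * ((γ i * β a ^ i * α y ^ (k - i)) * t ^ i) - (h y - h a) * (γ i * t ^ i) :=
      fun i => by ring
    simp only [e3, Finset.sum_sub_distrib, ← Finset.mul_sum]
    rw [hone, e2]
    field_simp
    ring
  have := coeff_eq_zero_of_eventually hcoef hi1 hi2
  have h2 : γ i * ((y - a) * β a ^ i * α y ^ (k - i)) = γ i * (h y - h a) := by linarith
  exact (mul_left_cancel₀ hi0 h2).symm

/-- The functional equation `h(y) - h(a) = (y - a) f(a) g(y)`, for pairs on one side of the
diagonal, has only Möbius solutions. -/
theorem moebius_of_lt {f g h : ℝ → ℝ} {η : ℝ} (hη : 0 < η)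
    (hf : ∀ a ∈ Ioo (-η) η, f a ≠ 0) (hg : ∀ a ∈ Ioo (-η) η, g a ≠ 0)
    (H : ∀ a ∈ Ioo (-η) η, ∀ y ∈ Ioo (-η) η, a < y → h y - h a = (y - a) * f a * g y) :
    ∃ e, ∃ ζ > 0, ζ ≤ η ∧ ∀ a ∈ Ioo (-ζ) ζ, 0 < 1 - e * a ∧ f a = f 0 / (1 - e * a) ∧
      g a = g 0 / (1 - e * a) := by
  have three : ∀ a ∈ Ioo (-η) η, ∀ b ∈ Ioo (-η) η, ∀ c ∈ Ioo (-η) η, a < b → b < c →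
      (c - a) * (f b)⁻¹ * (g b)⁻¹
        = (c - b) * (f a)⁻¹ * (g b)⁻¹ + (b - a) * (f b)⁻¹ * (g c)⁻¹ := by
    intro a ha b hb c hc hab hbc
    have h1 := H a ha b hb hab
    have h2 := H b hb c hc hbc
    have h3 := H a ha c hc (hab.trans hbc)
    have := hf a ha
    have := hf b hb
    have := hg b hb
    have := hg c hc
    field_simp
    linarith
  have m0 : (0 : ℝ) ∈ Ioo (-η) η := ⟨by linarith, hη⟩
  have m1 : η / 3 ∈ Ioo (-η) η := ⟨by linarith, by linarith⟩
  have m2 : 2 * η / 3 ∈ Ioo (-η) η := ⟨by linarith, by linarith⟩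
  have m3 : -(η / 3) ∈ Ioo (-η) η := ⟨by linarith, by linarith⟩
  have m4 : -(2 * η / 3) ∈ Ioo (-η) η := ⟨by linarith, by linarith⟩
  have hsub : ∀ a ∈ Ioo (-(η / 3)) (η / 3), a ∈ Ioo (-η) η := fun a ha =>
    ⟨by linarith [ha.1], by linarith [ha.2]⟩
  -- with two of the three points fixed, `1 / f` and `1 / g` are affine
  obtain ⟨u, hu⟩ : ∃ u, ∀ a ∈ Ioo (-(η / 3)) (η / 3), (f a)⁻¹ = (f 0)⁻¹ + u * a := by
    have hgb := inv_ne_zero (hg _ m1)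
    refine ⟨-(3 / η) * ((f (η / 3))⁻¹ - (f (η / 3))⁻¹ * (g (2 * η / 3))⁻¹ * ((g (η / 3))⁻¹)⁻¹),
      fun a ha => ?_⟩
    have h1 := three a (hsub a ha) _ m1 _ m2 ha.2 (by linarith)
    have h2 := three 0 m0 _ m1 _ m2 (by linarith) (by linarith)
    generalize (f a)⁻¹ = fa, (f 0)⁻¹ = f0, (f (η / 3))⁻¹ = F, (g (η / 3))⁻¹ = G,
      (g (2 * η / 3))⁻¹ = C at *
    field_simp at h1 h2 ⊢
    linarith
  obtain ⟨v, hv⟩ : ∃ v, ∀ a ∈ Ioo (-(η / 3)) (η / 3), (g a)⁻¹ = (g 0)⁻¹ + v * a := by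
    have hfb := inv_ne_zero (hf _ m3)
    refine ⟨(3 / η) * ((g (-(η / 3)))⁻¹
      - (g (-(η / 3)))⁻¹ * (f (-(2 * η / 3)))⁻¹ * ((f (-(η / 3)))⁻¹)⁻¹), fun a ha => ?_⟩
    have h1 := three _ m4 _ m3 a (hsub a ha) (by linarith) ha.1
    have h2 := three _ m4 _ m3 0 m0 (by linarith) (by linarith)
    generalize (g a)⁻¹ = ga, (g 0)⁻¹ = g0, (g (-(η / 3)))⁻¹ = G, (f (-(η / 3)))⁻¹ = F,
      (f (-(2 * η / 3)))⁻¹ = C at *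
    field_simp at h1 h2 ⊢
    linarith
  have hf0 := hf 0 m0
  have hg0 := hg 0 m0
  -- the two affine functions have the same zero
  have huv : u * f 0 = v * g 0 := by
    have p1 : η / 9 ∈ Ioo (-(η / 3)) (η / 3) := ⟨by linarith, by linarith⟩
    have p2 : 2 * η / 9 ∈ Ioo (-(η / 3)) (η / 3) := ⟨by linarith, by linarith⟩
    have h3 := three 0 m0 _ (hsub _ p1) _ (hsub _ p2) (by linarith) (by linarith)
    rw [hu _ p1, hv _ p1, hv _ p2] at h3
    have hη0 := hη.ne'
    field_simp at h3
    have : η ^ 2 * (u * f 0 - v * g 0) = 0 := by linear_combination h3 / 9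
    linarith [(mul_eq_zero.1 this).resolve_left (pow_ne_zero 2 hη0)]
  set e := -(u * f 0) with he
  have hbd : ∀ᶠ ζ in 𝓝[>] (0 : ℝ), |e| * ζ < 1 ∧ ζ ≤ η / 3 ∧ 0 < ζ := by
    have c : ContinuousAt (fun ζ : ℝ => |e| * ζ) 0 := by fun_prop
    have e1 : ∀ᶠ ζ in 𝓝[>] (0 : ℝ), |e| * ζ < 1 :=
      nhdsWithin_le_nhds (c.eventually_lt continuousAt_const (by simp))
    have e2 : ∀ᶠ ζ in 𝓝[>] (0 : ℝ), ζ ≤ η / 3 :=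
      nhdsWithin_le_nhds (Iic_mem_nhds (by positivity))
    filter_upwards [e1, e2, self_mem_nhdsWithin] with ζ a b c using ⟨a, b, c⟩
  obtain ⟨ζ, h1, h2, h3⟩ := hbd.exists
  refine ⟨e, ζ, h3, by linarith, fun a ha => ?_⟩
  have ha' : a ∈ Ioo (-(η / 3)) (η / 3) := ⟨by linarith [ha.1], by linarith [ha.2]⟩
  have hpos : 0 < 1 - e * a := by
    have : e * a ≤ |e| * ζ := (le_abs_self _).trans
      (by rw [abs_mul]; exact mul_le_mul_of_nonneg_left (abs_lt.2 ha).le (abs_nonneg _))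
    linarith
  refine ⟨hpos, ?_, ?_⟩
  · rw [eq_div_iff hpos.ne', show 1 - e * a = f 0 * ((f 0)⁻¹ + u * a) by rw [he]; field_simp; ring,
      ← hu a ha', mul_comm (f 0), ← mul_assoc, mul_inv_cancel₀ (hf a (hsub a ha')), one_mul]
  · rw [eq_div_iff hpos.ne', show 1 - e * a = g 0 * ((g 0)⁻¹ + v * a) by
      rw [he, huv]; field_simp; ring,
      ← hv a ha', mul_comm (g 0), ← mul_assoc, mul_inv_cancel₀ (hg a (hsub a ha')), one_mul]

/-- The same solutions, for pairs on either side of the diagonal according to the sign `s`. -/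
theorem moebius_of_sign {f g h : ℝ → ℝ} {s η : ℝ} (hs : s = 1 ∨ s = -1) (hη : 0 < η)
    (hf : ∀ a ∈ Ioo (-η) η, f a ≠ 0) (hg : ∀ a ∈ Ioo (-η) η, g a ≠ 0)
    (H : ∀ a ∈ Ioo (-η) η, ∀ y ∈ Ioo (-η) η, 0 < s * (y - a) →
      h y - h a = (y - a) * f a * g y) :
    ∃ e, ∃ ζ > 0, ζ ≤ η ∧ ∀ a ∈ Ioo (-ζ) ζ, 0 < 1 - e * a ∧ f a = f 0 / (1 - e * a) ∧
      g a = g 0 / (1 - e * a) := by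
  rcases hs with rfl | rfl
  · exact moebius_of_lt hη hf hg fun a ha y hy hlt => H a ha y hy (by linarith)
  · obtain ⟨e, ζ, h1, h2, h3⟩ := moebius_of_lt (h := h) hη hg hf fun a ha y hy hlt => by
      have := H y hy a ha (by linarith)
      linarith
    exact ⟨e, ζ, h1, h2, fun a ha => ⟨(h3 a ha).1, (h3 a ha).2.2, (h3 a ha).2.1⟩⟩

end functional

end ParaCR

namespace ParaCR

section translations

/-- If `P = g b x ^ m` and `(A(x, y), B(b, a))` preserves the surface `y = a + P(x, b)` and the
plane `x = 0`, then `B(0, a)` is an affine function of the value `C(0, a)` of the third coordinate.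
The limit `x → 0` shows that `B(b, a) = B(0, a) + b β(a)`, and then the equation for `y = 0` and two
values of `x` gives two linear relations between `B(0, a) - B(0, 0)`, `C(0, a) - C(0, 0)` and
`a β(a)`. -/
theorem affine_of_pencil {A B C D : ℝ → ℝ → ℝ} {r g : ℝ} {m : ℕ} (hm : m ≠ 0) (hr : 0 < r)
    (hg : g ≠ 0) (hA : SmoothFamily A r) (hB : SmoothFamily B r)
    (hA0 : ∀ y ∈ Ioo (-r) r, A 0 y = 0)
    (hC : ∀ a ∈ Ioo (-r) r, DifferentiableAt ℝ (fun a => C 0 a) a)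
    (hrel : ∀ x ∈ Ioo (-r) r, ∀ b ∈ Ioo (-r) r, ∀ a ∈ Ioo (-r) r, ∀ y ∈ Ioo (-r) r,
      y = a + g * b * x ^ m → D x y = C b a + g * B b a * A x y ^ m) :
    ∃ κ, ∃ η > 0, ∀ a ∈ Ioo (-η) η, B 0 a = B 0 0 + κ * (C 0 a - C 0 0) := by
  have hr0 : (0 : ℝ) ∈ Ioo (-r) r := ⟨by linarith, hr⟩
  set h : ℝ → ℝ := fun a => C 0 a with hh
  set q : ℝ → ℝ := fun a => B 0 a with hq
  have hCb : ∀ b ∈ Ioo (-r) r, ∀ a ∈ Ioo (-r) r, C b a = h a := fun b hb a ha => by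
    have h1 := hrel 0 hr0 b hb a ha a ha (by simp [hm])
    have h2 := hrel 0 hr0 0 hr0 a ha a ha (by simp)
    simp only [hA0 a ha, zero_pow hm, mul_zero, add_zero] at h1 h2
    rw [← h1, h2]
  have hrel' : ∀ x ∈ Ioo (-r) r, ∀ b ∈ Ioo (-r) r, ∀ a ∈ Ioo (-r) r, ∀ y ∈ Ioo (-r) r,
      y = a + g * b * x ^ m → h y - h a = g * (B b a - q y) * A x y ^ m := by
    intro x hx b hb a ha y hy e
    have h1 := hrel x hx b hb a ha y hy e
    have h2 := hrel x hx 0 hr0 y hy y hy (by simp)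
    rw [hCb b hb a ha] at h1
    rw [h1] at h2
    simp only [hh, hq] at *
    linarith
  set α : ℝ → ℝ := fun y => deriv (fun x => A x y) 0 with hα
  have hα0 : ∀ y ∈ Ioo (-r) r, α y ^ m ≠ 0 := fun y hy => pow_ne_zero m (hA.deriv_ne 0 hr0 y hy)
  -- the limit `x → 0` with `b` and `y` fixed
  have hlin : ∀ b ∈ Ioo (-r) r, ∀ y ∈ Ioo (-r) r, deriv h y * b = (B b y - q y) * α y ^ m := by
    intro b hb y hy
    have hPc : ContinuousAt (fun x : ℝ => y - g * b * x ^ m) 0 := by fun_prop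
    have hP0 : y - g * b * (0 : ℝ) ^ m = y := by simp [hm]
    have c1 : ContinuousAt (fun x => b * dslope h y (y - g * b * x ^ m)) 0 :=
      continuousAt_const.mul
        (ContinuousAt.comp_of_eq (continuousAt_dslope_same.2 (hC y hy)) hPc hP0)
    have c2 : ContinuousAt (fun x => (B b (y - g * b * x ^ m) - q y)
        * dslope (fun x => A x y) 0 x ^ m) 0 := by
      refine ContinuousAt.mul (ContinuousAt.sub ?_ continuousAt_const)
        ((continuousAt_dslope_same.2 (hA.hasDerivAt hr0 hy).differentiableAt).pow m)
      exact ContinuousAt.comp_of_eq (hB.contDiffAt_right hb hy).continuousAt hPc hP0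
    have heq : (fun x => b * dslope h y (y - g * b * x ^ m)) =ᶠ[𝓝[≠] 0]
        (fun x => (B b (y - g * b * x ^ m) - q y) * dslope (fun x => A x y) 0 x ^ m) := by
      filter_upwards [self_mem_nhdsWithin, mem_nhdsWithin_of_mem_nhds (isOpen_Ioo.mem_nhds hr0),
        mem_nhdsWithin_of_mem_nhds (hPc.preimage_mem_nhds
          (isOpen_Ioo.mem_nhds (by rwa [hP0] : y - g * b * (0 : ℝ) ^ m ∈ Ioo (-r) r)))]
        with x hx hx' ha
      have hx : x ≠ 0 := hx
      have e1 := hrel' x hx' b hb _ ha y hy (by ring)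
      have e2 := sub_smul_dslope h y (y - g * b * x ^ m)
      have e3 := sub_smul_dslope (fun x => A x y) 0 x
      simp only [smul_eq_mul, hA0 y hy, sub_zero] at e2 e3
      rw [← e3, mul_pow] at e1
      refine mul_left_cancel₀ (mul_ne_zero hg (pow_ne_zero m hx)) ?_
      linear_combination e1 - e2
    have h0 := tendsto_nhds_unique_of_eventuallyEq (c1.tendsto.mono_left nhdsWithin_le_nhds)
      (c2.tendsto.mono_left nhdsWithin_le_nhds) heq
    simp only [hP0, dslope_same] at h0
    rw [mul_comm, h0]
  set β : ℝ → ℝ := fun y => (B (r / 2) y - q y) / (r / 2) with hβ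
  have hr2 : r / 2 ∈ Ioo (-r) r := ⟨by linarith, by linarith⟩
  have hr3 : r / 3 ∈ Ioo (-r) r := ⟨by linarith, by linarith⟩
  have hβα : ∀ y ∈ Ioo (-r) r, deriv h y = β y * α y ^ m := fun y hy => by
    have := hlin _ hr2 y hy
    simp only [hβ]
    field_simp
    linarith
  have hBβ : ∀ b ∈ Ioo (-r) r, ∀ y ∈ Ioo (-r) r, B b y = q y + b * β y := fun b hb y hy => by
    have h1 := hlin b hb y hy
    rw [hβα y hy] at h1
    have := mul_right_cancel₀ (hα0 y hy) (a := β y * b) (c := B b y - q y) (by linarith)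
    linarith
  have hqd : DifferentiableAt ℝ q 0 := (hB.contDiffAt_right hr0 hr0).differentiableAt (by simp)
  have hβc : ContinuousAt β 0 :=
    ((hB.contDiffAt_right hr2 hr0).continuousAt.sub hqd.continuousAt).div_const _
  have hβ0 : β 0 ≠ 0 := by
    intro h0
    refine hB.deriv_ne 0 hr0 0 hr0 ?_
    have : (fun b => B b 0) =ᶠ[𝓝 0] fun _ => q 0 := by
      filter_upwards [isOpen_Ioo.mem_nhds hr0] with b hb
      rw [hBβ b hb 0 hr0, h0, mul_zero, add_zero]
    rw [this.deriv_eq, deriv_const]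
  have hh0 : deriv h 0 ≠ 0 := by
    rw [hβα 0 hr0]; exact mul_ne_zero hβ0 (hα0 0 hr0)
  -- the leaf `x` of the pencil, for two values of `x`
  have two : ∀ x ∈ Ioo (-r) r, x ≠ 0 → ∃ ζ > 0, ∀ a ∈ Ioo (-ζ) ζ,
      (h a - h 0) * (β 0 - g * x ^ m * deriv q 0)
        = deriv h 0 * (a * β a - g * x ^ m * (q a - q 0)) := by
    intro x hx hx0
    set T := g * x ^ m with hT
    have hT0 : T ≠ 0 := mul_ne_zero hg (pow_ne_zero m hx0)
    set ρ := A x 0 ^ m / x ^ m with hρ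
    have e : ∀ᶠ a in 𝓝 (0 : ℝ), h a - h 0 = ρ * (a * β a - T * (q a - q 0)) := by
      have hc : ContinuousAt (fun a : ℝ => -a / T) 0 := by fun_prop
      filter_upwards [isOpen_Ioo.mem_nhds hr0,
        hc.eventually_mem (isOpen_Ioo.mem_nhds (by simpa using hr0 : -(0 : ℝ) / T ∈ Ioo (-r) r))]
        with a ha hb
      have h1 := hrel' x hx _ hb a ha 0 hr0 (by
        rw [mul_right_comm, ← hT]
        field_simp
        ring)
      rw [hBβ _ hb a ha] at h1
      have h2 : A x 0 ^ m = ρ * x ^ m := by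
        rw [hρ, div_mul_cancel₀ _ (pow_ne_zero m hx0)]
      rw [h2] at h1
      have h3 : h a - h 0 = -(T * ρ * (q a + -a / T * β a - q 0)) := by
        rw [hT] at h1 ⊢
        linear_combination -h1
      rw [h3]
      field_simp
      ring
    have hd : deriv h 0 = ρ * (β 0 - T * deriv q 0) := by
      have t1 := hasDerivAt_iff_tendsto_slope.1 (hC 0 hr0).hasDerivAt
      have t2 := hasDerivAt_iff_tendsto_slope.1 hqd.hasDerivAt
      have t3 : Tendsto (fun a => ρ * (β a - T * slope q 0 a)) (𝓝[≠] 0)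
          (𝓝 (ρ * (β 0 - T * deriv q 0))) :=
        (((hβc.tendsto.mono_left nhdsWithin_le_nhds)).sub (t2.const_mul T)).const_mul ρ
      refine tendsto_nhds_unique t1 (t3.congr' ?_)
      filter_upwards [self_mem_nhdsWithin, mem_nhdsWithin_of_mem_nhds e] with a ha e
      have ha : a ≠ 0 := ha
      rw [slope_def_field, slope_def_field, e, sub_zero]
      field_simp
    obtain ⟨ζ, hζ, hζ'⟩ := Metric.eventually_nhds_iff.1 e
    refine ⟨ζ, hζ, fun a ha => ?_⟩
    rw [hζ' (by rw [Real.dist_0_eq_abs]; exact abs_lt.2 ha), hd]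
    ring
  obtain ⟨ζ₁, h1, h1'⟩ := two _ hr2 (by positivity)
  obtain ⟨ζ₂, h2, h2'⟩ := two _ hr3 (by positivity)
  refine ⟨deriv q 0 / deriv h 0, min ζ₁ ζ₂, lt_min h1 h2, fun a ha => ?_⟩
  have e1 := h1' a (Ioo_subset_Ioo (neg_le_neg (min_le_left _ _)) (min_le_left _ _) ha)
  have e2 := h2' a (Ioo_subset_Ioo (neg_le_neg (min_le_right _ _)) (min_le_right _ _) ha)
  have hne : g * ((r / 2) ^ m - (r / 3) ^ m) ≠ 0 := by
    refine mul_ne_zero hg (sub_ne_zero.2 (ne_of_gt ?_))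
    exact pow_lt_pow_left₀ (by linarith) (by positivity) hm
  have e3 : g * ((r / 2) ^ m - (r / 3) ^ m)
      * (deriv h 0 * (q a - q 0) - (h a - h 0) * deriv q 0) = 0 := by
    linear_combination e1 - e2
  have e4 := (mul_eq_zero.1 e3).resolve_left hne
  change q a = q 0 + deriv q 0 / deriv h 0 * (h a - h 0)
  field_simp
  linarith

theorem deriv_eq_zero_of_eventually_pow {f : ℝ → ℝ} {y c : ℝ} {k : ℕ} (hk : k ≠ 0) (hc : c ≠ 0)
    (hf : DifferentiableAt ℝ f y) (h : ∀ᶠ s in 𝓝[>] (0 : ℝ), f (y + c * s ^ k) = f y) :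
    deriv f y = 0 := by
  have t1 := hasDerivAt_iff_tendsto_slope.1 hf.hasDerivAt
  have t2 : Tendsto (fun s : ℝ => y + c * s ^ k) (𝓝[>] 0) (𝓝[≠] y) := by
    refine tendsto_nhdsWithin_iff.2 ⟨?_, ?_⟩
    · have : ContinuousAt (fun s : ℝ => y + c * s ^ k) 0 := by fun_prop
      have h0 := this.tendsto
      simp only [ne_eq, hk, not_false_eq_true, zero_pow, mul_zero, add_zero] at h0
      exact h0.mono_left nhdsWithin_le_nhds
    · filter_upwards [self_mem_nhdsWithin] with s hs
      have hs : 0 < s := hs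
      simp [hc, hs.ne', hk]
  refine tendsto_nhds_unique (t1.comp t2) (tendsto_const_nhds.congr' ?_)
  filter_upwards [h] with s hs
  simp [slope, hs]

/-- If `(A, D)` preserves the relation `y - a = c (x - z) ^ k` between points `(x, y)` and `(z, a)`
of the plane, then `A(0, y)` is constant. -/
theorem const_of_translation_invariant {A D : ℝ → ℝ → ℝ} {r c : ℝ} {k : ℕ} (hk : 2 ≤ k)
    (hr : 0 < r) (hc : c ≠ 0) (hA : SmoothFamily A r)
    (hD : ContDiffOn ℝ ∞ (fun z : ℝ × ℝ => D z.1 z.2) (Ioo (-r) r ×ˢ Ioo (-r) r))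
    (hrel : ∀ x ∈ Ioo (-r) r, ∀ z ∈ Ioo (-r) r, ∀ a ∈ Ioo (-r) r, ∀ y ∈ Ioo (-r) r,
      y - a = c * (x - z) ^ k → D x y - D z a = c * (A x y - A z a) ^ k) :
    ∀ y ∈ Ioo (-r) r, A 0 y = A 0 0 := by
  have hk0 : k ≠ 0 := by omega
  have hr0 : (0 : ℝ) ∈ Ioo (-r) r := ⟨by linarith, hr⟩
  have hc0 : c * (0 : ℝ) ^ k = 0 := by simp [hk0]
  have hDat : ∀ x ∈ Ioo (-r) r, ∀ y ∈ Ioo (-r) r,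
      ContDiffAt ℝ ∞ (fun z : ℝ × ℝ => D z.1 z.2) (x, y) := fun x hx y hy =>
    hD.contDiffAt ((isOpen_Ioo.prod isOpen_Ioo).mem_nhds ⟨hx, hy⟩)
  -- the curve `s ↦ (x + s, y + c s ^ k)` of points related to `(x, y)`
  have hcurve : ∀ x y : ℝ, HasDerivAt (fun s : ℝ => ((x + s, y + c * s ^ k) : ℝ × ℝ)) (1, 0) 0 := by
    intro x y
    refine ((hasDerivAt_id (0 : ℝ)).const_add x).prodMk ?_
    refine ((((hasDerivAt_id (0 : ℝ)).fun_pow k).const_mul c).const_add y).congr_deriv ?_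
    simp [show k - 1 ≠ 0 by omega]
  have hmem : ∀ x ∈ Ioo (-r) r, ∀ y ∈ Ioo (-r) r, ∀ᶠ s in 𝓝 (0 : ℝ),
      x + s ∈ Ioo (-r) r ∧ y + c * s ^ k ∈ Ioo (-r) r := by
    intro x hx y hy
    have h1 : ContinuousAt (fun s : ℝ => x + s) 0 := by fun_prop
    have h2 : ContinuousAt (fun s : ℝ => y + c * s ^ k) 0 := by fun_prop
    exact (h1.eventually_mem (isOpen_Ioo.mem_nhds (by simpa using hx))).and
      (h2.eventually_mem (isOpen_Ioo.mem_nhds (by simpa [hk0] using hy)))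
  have hE : ∀ x ∈ Ioo (-r) r, ∀ y ∈ Ioo (-r) r, ∀ s, x + s ∈ Ioo (-r) r →
      y + c * s ^ k ∈ Ioo (-r) r →
      D (x + s) (y + c * s ^ k) - D x y = c * (A (x + s) (y + c * s ^ k) - A x y) ^ k :=
    fun x hx y hy s h1 h2 => hrel _ h1 x hx y hy _ h2 (by ring)
  have hψ : ∀ x ∈ Ioo (-r) r, ∀ y ∈ Ioo (-r) r,
      HasDerivAt (fun s => A (x + s) (y + c * s ^ k)) (deriv (fun x => A x y) x) 0 := by
    intro x hx y hy
    have hd : HasFDerivAt (fun z : ℝ × ℝ => A z.1 z.2) _ (x, y) :=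
      ((hA.contDiffAt hx hy).differentiableAt (by simp)).hasFDerivAt
    have h1 := HasFDerivAt.comp_hasDerivAt_of_eq (0 : ℝ) hd (hcurve x y) (by simp [hk0])
    have h2 : HasDerivAt (fun x => A x y) _ x :=
      HasFDerivAt.comp_hasDerivAt (f := fun x : ℝ => (x, y)) x hd
        ((hasDerivAt_id x).prodMk (hasDerivAt_const x y))
    rw [h2.deriv]
    exact h1
  have hDx : ∀ x ∈ Ioo (-r) r, ∀ y ∈ Ioo (-r) r, HasDerivAt (fun x => D x y) 0 x := by
    intro x hx y hy
    have hd : HasFDerivAt (fun z : ℝ × ℝ => D z.1 z.2) _ (x, y) :=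
      ((hDat x hx y hy).differentiableAt (by simp)).hasFDerivAt
    have h1 := HasFDerivAt.comp_hasDerivAt_of_eq (0 : ℝ) hd (hcurve x y) (by simp [hk0])
    have h2 : HasDerivAt (fun x => D x y) _ x :=
      HasFDerivAt.comp_hasDerivAt (f := fun x : ℝ => (x, y)) x hd
        ((hasDerivAt_id x).prodMk (hasDerivAt_const x y))
    have h3 : HasDerivAt (fun s => D x y + c * (A (x + s) (y + c * s ^ k) - A x y) ^ k) 0 0 := by
      refine (((((hψ x hx y hy).sub_const _).fun_pow k).const_mul c).const_add _).congr_deriv ?_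
      simp [hk0, show k - 1 ≠ 0 by omega]
    refine h2.congr_deriv (HasDerivAt.unique h1 (h3.congr_of_eventuallyEq ?_))
    filter_upwards [hmem x hx y hy] with s hs
    have := hE x hx y hy s hs.1 hs.2
    simp only [Function.comp_apply]
    linarith
  set h : ℝ → ℝ := fun y => D 0 y with hh
  have hDh : ∀ x ∈ Ioo (-r) r, ∀ y ∈ Ioo (-r) r, D x y = h y := fun x hx y hy =>
    isOpen_Ioo.is_const_of_deriv_eq_zero isPreconnected_Ioo
      (fun x hx => (hDx x hx y hy).differentiableAt.differentiableWithinAt)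
      (fun x hx => (hDx x hx y hy).deriv) hx hr0
  have hhs : ∀ y ∈ Ioo (-r) r, ContDiffAt ℝ ∞ h y := fun y hy =>
    (hDat 0 hr0 y hy).comp y (f := fun y : ℝ => ((0 : ℝ), y)) (by fun_prop)
  have hhd : ∀ y ∈ Ioo (-r) r, DifferentiableAt ℝ h y := fun y hy =>
    (hhs y hy).differentiableAt (by simp)
  have hpow : Tendsto (fun s : ℝ => c * s ^ k) (𝓝[>] 0) (𝓝[≠] 0) := by
    refine tendsto_nhdsWithin_iff.2 ⟨?_, ?_⟩
    · have : ContinuousAt (fun s : ℝ => c * s ^ k) 0 := by fun_prop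
      have h0 := this.tendsto
      rw [hc0] at h0
      exact h0.mono_left nhdsWithin_le_nhds
    · filter_upwards [self_mem_nhdsWithin] with s hs
      have hs : 0 < s := hs
      simp [hc, hs.ne']
  -- comparison of the terms of order `s ^ k`
  have hslope : ∀ x ∈ Ioo (-r) r, ∀ y ∈ Ioo (-r) r,
      Tendsto (fun s => s⁻¹ * (A (x + s) (y + c * s ^ k) - A x y)) (𝓝[>] 0)
        (𝓝 (deriv (fun x => A x y) x)) := by
    intro x hx y hy
    have h1 := (hasDerivAt_iff_tendsto_slope.1 (hψ x hx y hy)).mono_left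
      (nhdsWithin_mono 0 (fun s (hs : 0 < s) => hs.ne'))
    refine h1.congr fun s => ?_
    simp [slope, hk0]
  have hder : ∀ x ∈ Ioo (-r) r, ∀ y ∈ Ioo (-r) r, deriv (fun x => A x y) x ^ k = deriv h y := by
    intro x hx y hy
    have h1 := (hasDerivAt_iff_tendsto_slope_zero.1 (hhd y hy).hasDerivAt).comp hpow
    refine tendsto_nhds_unique ((hslope x hx y hy).pow k) (h1.congr' ?_)
    filter_upwards [self_mem_nhdsWithin, nhdsWithin_le_nhds (hmem x hx y hy)] with s hs hs'
    have hs : 0 < s := hs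
    have := hE x hx y hy s hs'.1 hs'.2
    rw [hDh x hx y hy, hDh _ hs'.1 _ hs'.2] at this
    simp only [Function.comp_apply, smul_eq_mul]
    rw [this, mul_pow, inv_pow]
    field_simp
  -- translating `x` along a pair of related points does not change the `k`-th power of `A - A'`
  have hstep : ∀ y ∈ Ioo (-r) r, ∀ s ∈ Ioo (-r) r, y + c * s ^ k ∈ Ioo (-r) r →
      deriv h (y + c * s ^ k) = deriv h y := by
    intro y hy s hs hy'
    set y' := y + c * s ^ k with hyy
    have hd1 : HasDerivAt (fun x => A (x + s) y') (deriv (fun x => A x y') s) 0 := by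
      exact HasDerivAt.comp_add_const (f := fun x => A x y') (0 : ℝ) s
        (by rw [zero_add]; exact hA.hasDerivAt hs hy')
    have hd := hd1.sub (hA.hasDerivAt hr0 hy)
    have hev : ∀ᶠ x in 𝓝 (0 : ℝ), (A (x + s) y' - A x y) ^ k = (h y' - h y) / c := by
      have hcs : ContinuousAt (fun x : ℝ => x + s) 0 := by fun_prop
      filter_upwards [isOpen_Ioo.mem_nhds hr0, hcs.eventually_mem
        (isOpen_Ioo.mem_nhds (by simpa using hs : (0 : ℝ) + s ∈ Ioo (-r) r))] with x hx hxs
      have := hE x hx y hy s hxs hy'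
      rw [← hyy, hDh x hx y hy, hDh _ hxs y' hy'] at this
      rw [this]
      field_simp
    have h0 : deriv (fun x => A x y') s - deriv (fun x => A x y) 0 = 0 := by
      by_cases hw : (h y' - h y) / c = 0
      · refine hd.unique ((hasDerivAt_const (0 : ℝ) (0 : ℝ)).congr_of_eventuallyEq ?_)
        filter_upwards [hev] with x hx
        rw [hw] at hx
        exact pow_eq_zero_iff hk0 |>.1 hx
      · have h1 := (hd.fun_pow k).unique ((hasDerivAt_const (0 : ℝ) _).congr_of_eventuallyEq hev)
        have h2 := hev.self_of_nhds
        simp only [Pi.sub_apply] at h1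
        rw [mul_eq_zero, mul_eq_zero] at h1
        rcases h1 with (h1 | h1) | h1
        · exact absurd (by exact_mod_cast h1) hk0
        · rw [pow_eq_zero_iff (by omega)] at h1
          rw [h1, zero_pow hk0] at h2
          exact absurd h2.symm hw
        · exact h1
    rw [← hder s hs y' hy', ← hder 0 hr0 y hy, sub_eq_zero.1 h0]
  have hconst : ∀ y ∈ Ioo (-r) r, deriv h y = deriv h 0 := fun y hy => by
    have hdd : ∀ y ∈ Ioo (-r) r, DifferentiableAt ℝ (deriv h) y := fun y hy =>
      (((hhs y hy).fderiv_right (m := ∞) (by simp)).clm_apply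
        contDiffAt_const).differentiableAt (by simp)
    refine isOpen_Ioo.is_const_of_deriv_eq_zero isPreconnected_Ioo
      (fun y hy => (hdd y hy).differentiableWithinAt) (fun y hy => ?_) hy hr0
    refine deriv_eq_zero_of_eventually_pow hk0 hc (hdd y hy) ?_
    filter_upwards [nhdsWithin_le_nhds (hmem 0 hr0 y hy)] with s hs
    exact hstep y hy s (by simpa using hs.1) hs.2
  -- hence `∂A/∂x` is constant
  set α := deriv (fun x => A x 0) 0 with hα
  have hα0 : α ≠ 0 := hA.deriv_ne 0 hr0 0 hr0
  have hAx : ∀ x ∈ Ioo (-r) r, ∀ y ∈ Ioo (-r) r, deriv (fun x => A x y) x = α := by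
    intro x hx y hy
    have e1 : deriv (fun x => A x y) x ^ k = α ^ k := by
      rw [hder x hx y hy, hder 0 hr0 0 hr0, hconst y hy]
    refine eq_of_pow_eq_of_mul_pos hk0 e1 ?_
    have hcont : ContinuousOn (fun z : ℝ × ℝ => deriv (fun x => A x z.2) z.1)
        (Ioo (-r) r ×ˢ Ioo (-r) r) := by
      have hf : ContinuousOn (fun z => fderiv ℝ (fun z : ℝ × ℝ => A z.1 z.2) z (1, 0))
          (Ioo (-r) r ×ˢ Ioo (-r) r) :=
        (hA.smooth.continuousOn_fderiv_of_isOpen (isOpen_Ioo.prod isOpen_Ioo)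
          (by simp)).clm_apply continuousOn_const
      refine hf.congr fun z hz => ?_
      exact (HasFDerivAt.comp_hasDerivAt (f := fun x : ℝ => (x, z.2)) z.1
        ((hA.contDiffAt hz.1 hz.2).differentiableAt (by simp)).hasFDerivAt
        ((hasDerivAt_id z.1).prodMk (hasDerivAt_const z.1 z.2))).deriv
    by_contra hneg
    have hlt := lt_of_le_of_ne (not_lt.1 hneg) (mul_ne_zero (hA.deriv_ne x hx y hy) hα0)
    have hpre : IsPreconnected (Ioo (-r) r ×ˢ Ioo (-r) r : Set (ℝ × ℝ)) :=
      isPreconnected_Ioo.prod isPreconnected_Ioo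
    have := hpre.intermediate_value (a := (x, y)) (b := (0, 0)) ⟨hx, hy⟩ ⟨hr0, hr0⟩
      (hcont.mul (continuousOn_const (c := α)))
    obtain ⟨z, hz, hz0⟩ := this ⟨hlt.le, (mul_self_pos.2 hα0).le⟩
    exact mul_ne_zero (hA.deriv_ne z.1 hz.1 z.2 hz.2) hα0 hz0
  have hlin : ∀ x ∈ Ioo (-r) r, ∀ y ∈ Ioo (-r) r, A x y = A 0 y + α * x := by
    intro x hx y hy
    have hd : ∀ x ∈ Ioo (-r) r, HasDerivAt (fun x => A x y - α * x) 0 x := fun x hx => by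
      refine ((hA.hasDerivAt hx hy).sub ((hasDerivAt_id x).const_mul α)).congr_deriv ?_
      rw [hAx x hx y hy]; ring
    have := isOpen_Ioo.is_const_of_deriv_eq_zero isPreconnected_Ioo
      (fun x hx => (hd x hx).differentiableAt.differentiableWithinAt)
      (fun x hx => (hd x hx).deriv) hx hr0
    simp only [mul_zero, sub_zero] at this
    linarith
  have hhlin : ∀ y ∈ Ioo (-r) r, ∀ y' ∈ Ioo (-r) r, h y' - h y = α ^ k * (y' - y) := by
    intro y hy y' hy'
    have hd : ∀ y ∈ Ioo (-r) r, HasDerivAt (fun y => h y - α ^ k * y) 0 y := fun y hy => by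
      refine ((hhd y hy).hasDerivAt.sub ((hasDerivAt_id y).const_mul (α ^ k))).congr_deriv ?_
      rw [hconst y hy, ← hder 0 hr0 0 hr0]; ring
    have := isOpen_Ioo.is_const_of_deriv_eq_zero isPreconnected_Ioo
      (fun x hx => (hd x hx).differentiableAt.differentiableWithinAt)
      (fun x hx => (hd x hx).deriv) hy hy'
    linarith
  have hAd : ∀ y ∈ Ioo (-r) r, DifferentiableAt ℝ (fun y => A 0 y) y := fun y hy =>
    (hA.contDiffAt_right hr0 hy).differentiableAt (by simp)
  intro y hy
  refine isOpen_Ioo.is_const_of_deriv_eq_zero isPreconnected_Ioo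
    (fun y hy => (hAd y hy).differentiableWithinAt) (fun y hy => ?_) hy hr0
  refine deriv_eq_zero_of_eventually_pow hk0 hc (hAd y hy) ?_
  have hsl := (hslope 0 hr0 y hy).mul_const α
  rw [hAx 0 hr0 y hy] at hsl
  filter_upwards [hsl.eventually (lt_mem_nhds (mul_self_pos.2 hα0)), self_mem_nhdsWithin,
    nhdsWithin_le_nhds (hmem 0 hr0 y hy)] with s hpos hs hs'
  have hs : 0 < s := hs
  have h1 := hE 0 hr0 y hy s hs'.1 hs'.2
  rw [hDh 0 hr0 y hy, hDh _ hs'.1 _ hs'.2, hhlin y hy _ hs'.2] at h1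
  have h2 : (A (0 + s) (y + c * s ^ k) - A 0 y) ^ k = (α * s) ^ k := by
    refine mul_left_cancel₀ hc ?_
    rw [← h1, mul_pow]; ring
  have h3 : 0 < (A (0 + s) (y + c * s ^ k) - A 0 y) * (α * s) := by
    have : (A (0 + s) (y + c * s ^ k) - A 0 y) * (α * s)
        = s ^ 2 * (s⁻¹ * (A (0 + s) (y + c * s ^ k) - A 0 y) * α) := by
      field_simp
    rw [this]
    positivity
  have h4 := eq_of_pow_eq_of_mul_pos hk0 h2 h3
  rw [hlin _ hs'.1 _ hs'.2] at h4
  simp only [zero_add] at h4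
  linarith

end translations

end ParaCR

namespace ParaCR

/-! ### The normal form of a multicontact automorphism -/

section normalForm

variable {k : ℕ} {γ : ℕ → ℝ} {F : OpenPartialHomeomorph Pt Pt}

theorem IsLocalAut.snd_eq_of_leafX (hF : IsLocalAut k γ F) {v : ℝ × ℝ} {I : Set ℝ} (hI : IsOpen I)
    (hI' : IsPreconnected I) (hv : ∀ x ∈ I, ((x, v) : Pt) ∈ F.source) {x x' : ℝ} (hx : x ∈ I)
    (hx' : x' ∈ I) : (F (x, v)).2 = (F (x', v)).2 := by
  have hd : ∀ x ∈ I, HasDerivAt (fun s : ℝ => (F (s, v)).2) 0 x := by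
    intro x hx
    obtain ⟨c, -, hc⟩ := hF.map_X _ (hv x hx)
    have h : HasDerivAt (fun s : ℝ => F (s, v)) (fderiv ℝ F (x, v) (fieldX (x, v))) x :=
      HasFDerivAt.comp_hasDerivAt x (hF.differentiableAt (hv x hx)).hasFDerivAt
        (hasDerivAt_leafX (x, v) x)
    rw [hc] at h
    have h2 : HasDerivAt (fun s : ℝ => (F (s, v)).2) (c • fieldX (F (x, v))).2 x := h.snd
    exact h2.congr_deriv (by simp [fieldX, Prod.ext_iff])
  exact hI.is_const_of_deriv_eq_zero hI'
    (fun x hx => (hd x hx).differentiableAt.differentiableWithinAt)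
    (fun x hx => (hd x hx).deriv) hx hx'

theorem IsLocalAut.eq_of_leafY (hF : IsLocalAut k γ F) {x y : ℝ} {I : Set ℝ} (hI : IsOpen I)
    (hI' : IsPreconnected I) (hv : ∀ s ∈ I, ((x, s, y - modelPoly k γ x s) : Pt) ∈ F.source)
    {b b' : ℝ} (hb : b ∈ I) (hb' : b' ∈ I) :
    (F (x, b, y - modelPoly k γ x b)).1 = (F (x, b', y - modelPoly k γ x b')).1 ∧
      ycoord k γ (F (x, b, y - modelPoly k γ x b))
        = ycoord k γ (F (x, b', y - modelPoly k γ x b')) := by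
  have hd : ∀ s ∈ I, HasDerivAt (fun s : ℝ => (F (x, s, y - modelPoly k γ x s)).1) 0 s ∧
      HasDerivAt (fun s : ℝ => ycoord k γ (F (x, s, y - modelPoly k γ x s))) 0 s := by
    intro s hs
    obtain ⟨c, -, hc⟩ := hF.map_Y _ (hv s hs)
    have h : HasDerivAt (fun s : ℝ => F (x, s, y - modelPoly k γ x s)) _ s :=
      HasFDerivAt.comp_hasDerivAt s (hF.differentiableAt (hv s hs)).hasFDerivAt
        (hasDerivAt_leafY x y s)
    rw [hc] at h
    have h1 : HasDerivAt (fun s : ℝ => (F (x, s, y - modelPoly k γ x s)).1)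
      (c • fieldY k γ (F (x, s, y - modelPoly k γ x s))).1 s := h.fst
    exact ⟨h1.congr_deriv (by simp [fieldY]),
      (hasDerivAt_ycoord h).congr_deriv (by simp [fieldY_eq]; ring)⟩
  exact ⟨hI.is_const_of_deriv_eq_zero hI'
    (fun x hx => (hd x hx).1.differentiableAt.differentiableWithinAt)
    (fun x hx => (hd x hx).1.deriv) hb hb', hI.is_const_of_deriv_eq_zero hI'
    (fun x hx => (hd x hx).2.differentiableAt.differentiableWithinAt)
    (fun x hx => (hd x hx).2.deriv) hb hb'⟩

/-- On a cube of half-width `r` around the origin, `F` maps leaves of `X` to leaves of `X` and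
leaves of `Y` to leaves of `Y`. Thus `F = (A(x, y), B(b, a), C(b, a))` with `A(x, y) = F₁(x, 0, y)`,
`B(b, a) = F₂(0, b, a)`, `C(b, a) = F₃(0, b, a)`. -/
structure LeafForm (k : ℕ) (γ : ℕ → ℝ) (F : OpenPartialHomeomorph Pt Pt) (r : ℝ) : Prop where
  pos : 0 < r
  mem : ∀ x ∈ Ioo (-r) r, ∀ b ∈ Ioo (-r) r, ∀ a ∈ Ioo (-r) r, ((x, b, a) : Pt) ∈ F.source
  leafX : ∀ x ∈ Ioo (-r) r, ∀ b ∈ Ioo (-r) r, ∀ a ∈ Ioo (-r) r,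
    (F (x, b, a)).2 = (F (0, b, a)).2
  leafY : ∀ x ∈ Ioo (-r) r, ∀ b ∈ Ioo (-r) r, ∀ a ∈ Ioo (-r) r, ∀ y ∈ Ioo (-r) r,
    y = a + modelPoly k γ x b →
    (F (x, b, a)).1 = (F (x, 0, y)).1 ∧ ycoord k γ (F (x, b, a)) = ycoord k γ (F (x, 0, y))
  smoothA : SmoothFamily (fun x y => (F (x, 0, y)).1) r
  smoothB : SmoothFamily (fun b a => (F (0, b, a)).2.1) r

theorem IsLocalAut.exists_leafForm (hF : IsLocalAut k γ F) (h0 : (0 : Pt) ∈ F.source) :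
    ∃ r, LeafForm k γ F r := by
  have hP : ContinuousAt
      (fun p : Pt => ((p.1, p.2.1, p.2.2 - modelPoly k γ p.1 p.2.1) : Pt)) 0 := by
    unfold modelPoly; fun_prop
  have hP0 : ((0 : Pt).1, (0 : Pt).2.1, (0 : Pt).2.2 - modelPoly k γ (0 : Pt).1 (0 : Pt).2.1)
      = (0 : Pt) := by
    simp [modelPoly_zero_left]
  have hev : ∀ᶠ p : Pt in 𝓝 0, p ∈ F.source ∧
      ((p.1, p.2.1, p.2.2 - modelPoly k γ p.1 p.2.1) : Pt) ∈ F.source :=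
    (F.open_source.eventually_mem h0).and
      (hP.eventually_mem (F.open_source.mem_nhds (by rw [hP0]; exact h0)))
  obtain ⟨r, hr, hball⟩ := Metric.eventually_nhds_iff.1 hev
  have hr0 : (0 : ℝ) ∈ Ioo (-r) r := ⟨by linarith, hr⟩
  have hbox : ∀ x ∈ Ioo (-r) r, ∀ b ∈ Ioo (-r) r, ∀ a ∈ Ioo (-r) r,
      dist ((x, b, a) : Pt) 0 < r := fun x hx b hb a ha => by
    simp only [Prod.dist_eq, Prod.fst_zero, Prod.snd_zero, Real.dist_0_eq_abs, max_lt_iff]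
    exact ⟨abs_lt.2 hx, abs_lt.2 hb, abs_lt.2 ha⟩
  have hmem : ∀ x ∈ Ioo (-r) r, ∀ b ∈ Ioo (-r) r, ∀ a ∈ Ioo (-r) r,
      ((x, b, a) : Pt) ∈ F.source := fun x hx b hb a ha => (hball (hbox x hx b hb a ha)).1
  refine ⟨r, hr, hmem, fun x hx b hb a ha => ?_, fun x hx b hb a ha y hy e => ?_, ⟨?_, ?_⟩,
    ⟨?_, ?_⟩⟩
  · exact hF.snd_eq_of_leafX isOpen_Ioo isPreconnected_Ioo (fun x hx => hmem x hx b hb a ha) hx hr0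
  · have := hF.eq_of_leafY (x := x) (y := y) isOpen_Ioo isPreconnected_Ioo
      (fun s hs => (hball (hbox x hx s hs y hy)).2) hb hr0
    rw [modelPoly_zero_left, sub_zero, e, add_sub_cancel_right] at this
    rwa [e]
  · have h1 : ContDiffOn ℝ ∞ (fun z : ℝ × ℝ => F (z.1, 0, z.2)) (Ioo (-r) r ×ˢ Ioo (-r) r) :=
      hF.smooth.comp (f := fun z : ℝ × ℝ => ((z.1, 0, z.2) : Pt)) (by fun_prop)
        fun z hz => hmem _ hz.1 _ hr0 _ hz.2
    exact h1.fst
  · intro x hx y hy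
    have hs := hmem x hx 0 hr0 y hy
    obtain ⟨c, hc0, hc⟩ := hF.map_X _ hs
    have h : HasDerivAt (fun s : ℝ => F (s, 0, y)) _ x :=
      HasFDerivAt.comp_hasDerivAt x (hF.differentiableAt hs).hasFDerivAt
        (hasDerivAt_leafX (x, 0, y) x)
    rw [hc] at h
    have h2 : HasDerivAt (fun s : ℝ => (F (s, 0, y)).1) (c • fieldX (F (x, 0, y))).1 x := h.fst
    rw [h2.deriv]
    simpa [fieldX] using hc0
  · have h1 : ContDiffOn ℝ ∞ (fun z : ℝ × ℝ => F (0, z.1, z.2)) (Ioo (-r) r ×ˢ Ioo (-r) r) :=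
      hF.smooth.comp (f := fun z : ℝ × ℝ => ((0, z.1, z.2) : Pt)) (by fun_prop)
        fun z hz => hmem _ hr0 _ hz.1 _ hz.2
    exact h1.snd.fst
  · intro b hb a ha
    have hs := hmem 0 hr0 b hb a ha
    obtain ⟨c, hc0, hc⟩ := hF.map_Y _ hs
    have h : HasDerivAt (fun s : ℝ => F (0, s, a))
        (fderiv ℝ F (0, b, a) (fieldY k γ (0, b, a))) b := by
      refine HasFDerivAt.comp_hasDerivAt (f := fun s : ℝ => ((0, s, a) : Pt)) b
        (hF.differentiableAt hs).hasFDerivAt ?_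
      rw [fieldY_eq]
      simp only [modelPolyDb_zero_right, neg_zero]
      exact (hasDerivAt_const b _).prodMk ((hasDerivAt_id b).prodMk (hasDerivAt_const b a))
    rw [hc] at h
    have h2 : HasDerivAt (fun s : ℝ => (F (0, s, a)).2.1) (c • fieldY k γ (F (0, b, a))).2.1 b :=
      h.snd.fst
    rw [h2.deriv]
    simpa [fieldY] using hc0

/-- The equation that says that the leaf of `X` over `(b, a)` is mapped to the leaf over
`(B(b, a), C(b, a))`. -/
theorem LeafForm.master {r : ℝ} (h : LeafForm k γ F r) {x b a y : ℝ} (hx : x ∈ Ioo (-r) r)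
    (hb : b ∈ Ioo (-r) r) (ha : a ∈ Ioo (-r) r) (hy : y ∈ Ioo (-r) r)
    (e : y = a + modelPoly k γ x b) :
    ycoord k γ (F (x, 0, y)) = (F (0, b, a)).2.2
      + modelPoly k γ (F (x, 0, y)).1 (F (0, b, a)).2.1 := by
  have h1 := h.leafY x hx b hb a ha y hy e
  rw [← h1.2, ycoord, h1.1, h.leafX x hx b hb a ha]

theorem LeafForm.contDiffOn_thd {r : ℝ} (hF : IsLocalAut k γ F) (h : LeafForm k γ F r) :
    ContDiffOn ℝ ∞ (fun z : ℝ × ℝ => (F (0, z.1, z.2)).2.2) (Ioo (-r) r ×ˢ Ioo (-r) r) := by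
  have h1 : ContDiffOn ℝ ∞ (fun z : ℝ × ℝ => F (0, z.1, z.2)) (Ioo (-r) r ×ˢ Ioo (-r) r) :=
    hF.smooth.comp (f := fun z : ℝ × ℝ => ((0, z.1, z.2) : Pt)) (by fun_prop)
      fun z hz => h.mem _ ⟨by linarith [h.pos], h.pos⟩ _ hz.1 _ hz.2
  exact h1.snd.snd

theorem LeafForm.differentiableAt_thd {r : ℝ} (hF : IsLocalAut k γ F) (h : LeafForm k γ F r)
    {a : ℝ} (ha : a ∈ Ioo (-r) r) : DifferentiableAt ℝ (fun a => (F (0, 0, a)).2.2) a := by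
  have h0 : (0 : ℝ) ∈ Ioo (-r) r := ⟨by linarith [h.pos], h.pos⟩
  have h1 := ((h.contDiffOn_thd hF).contDiffAt
    ((isOpen_Ioo.prod isOpen_Ioo).mem_nhds ⟨h0, ha⟩ : _ ∈ 𝓝 ((0, a) : ℝ × ℝ)))
  exact (h1.comp a (f := fun a : ℝ => ((0 : ℝ), a)) (by fun_prop)).differentiableAt (by simp)

/-! ### The singular locus -/

/-- `F` preserves the function `∂²P/∂x∂b` up to a factor. -/
theorem IsLocalAut.modelPolyDxb_comp (hF : IsLocalAut k γ F) {p : Pt} (hp : p ∈ F.source) :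
    modelPolyDxb k γ (F p).1 (F p).2.1
        * ((fderiv ℝ F p (fieldX p)).1 * (fderiv ℝ F p (fieldY k γ p)).2.1)
      = modelPolyDxb k γ p.1 p.2.1 * ((fderiv ℝ F p (0, 0, 1)).2.2
        + modelPolyDb k γ (F p).1 (F p).2.1 * (fderiv ℝ F p (0, 0, 1)).2.1) := by
  obtain ⟨ε, hε, hball⟩ := Metric.isOpen_iff.1 F.open_source p hp
  have hball' : ∀ (x : ℝ) (v : ℝ × ℝ), x ∈ Metric.ball p.1 ε → v ∈ Metric.ball p.2 ε →
      ((x, v) : Pt) ∈ F.source := fun x v hx hv => hball (by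
    rw [Metric.mem_ball, Prod.dist_eq]; exact max_lt hx hv)
  have hc1 : p.1 ∈ Metric.ball p.1 ε := Metric.mem_ball_self hε
  have hc2 : p.2 ∈ Metric.ball p.2 ε := Metric.mem_ball_self hε
  -- the derivative of `(F₂, F₃)` in the directions `b`, `a` does not depend on `x`
  have hL : ∀ x ∈ Metric.ball p.1 ε, ∀ w : ℝ × ℝ,
      (fderiv ℝ F (x, p.2) (0, w)).2 = (fderiv ℝ F p (0, w)).2 := by
    intro x hx w
    have hl : ∀ x : ℝ, HasDerivAt (fun s : ℝ => ((x, p.2 + s • w) : Pt)) (0, w) 0 := fun x => by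
      refine (hasDerivAt_const (0 : ℝ) x).prodMk ?_
      simpa using ((hasDerivAt_id (0 : ℝ)).smul_const w).const_add p.2
    have hd : ∀ x ∈ Metric.ball p.1 ε, HasDerivAt (fun s : ℝ => (F (x, p.2 + s • w)).2)
        (fderiv ℝ F (x, p.2) (0, w)).2 0 := fun x hx =>
      (HasFDerivAt.comp_hasDerivAt_of_eq (f := fun s : ℝ => ((x, p.2 + s • w) : Pt)) (0 : ℝ)
        (hF.differentiableAt (hball' x p.2 hx hc2)).hasFDerivAt (hl x) (by simp)).snd
    refine (hd x hx).unique ((hd p.1 hc1).congr_of_eventuallyEq ?_)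
    have hcs : ContinuousAt (fun s : ℝ => p.2 + s • w) 0 := by fun_prop
    filter_upwards [hcs.eventually_mem (Metric.isOpen_ball.mem_nhds (by simpa using hε :
      p.2 + (0 : ℝ) • w ∈ Metric.ball p.2 ε))] with s hs
    exact hF.snd_eq_of_leafX Metric.isOpen_ball (convex_ball p.1 ε).isPreconnected
      (fun x hx => hball' x _ hx hs) hx hc1
  set e₁ := (fderiv ℝ F p (0, 1, 0)).2 with he₁
  set e₂ := (fderiv ℝ F p (0, 0, 1)).2 with he₂
  have hsplit : ∀ x ∈ Metric.ball p.1 ε,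
      (fderiv ℝ F (x, p.2) (fieldY k γ (x, p.2))).2 = e₁ - modelPolyDb k γ x p.2.1 • e₂ := by
    intro x hx
    have h1 : fieldY k γ (x, p.2)
        = ((0, 1, 0) : Pt) - modelPolyDb k γ x p.2.1 • ((0, 0, 1) : Pt) := by
      simp [fieldY_eq]
    rw [h1, map_sub, map_smul, Prod.snd_sub, Prod.smul_snd, hL x hx, hL x hx]
  -- the third component of the condition that `F` preserves `Y`
  have hY : ∀ x ∈ Metric.ball p.1 ε, e₁.2 - modelPolyDb k γ x p.2.1 * e₂.2
      = -modelPolyDb k γ (F (x, p.2)).1 (F p).2.1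
        * (e₁.1 - modelPolyDb k γ x p.2.1 * e₂.1) := by
    intro x hx
    obtain ⟨d, -, hd⟩ := hF.map_Y _ (hball' x p.2 hx hc2)
    have h1 := hsplit x hx
    rw [hd] at h1
    have h2 : (F (x, p.2)).2 = (F p).2 := hF.snd_eq_of_leafX Metric.isOpen_ball
      (convex_ball p.1 ε).isPreconnected (fun x hx => hball' x _ hx hc2) hx hc1
    have h3 := congrArg Prod.fst h1
    have h4 := congrArg Prod.snd h1
    simp only [fieldY_eq, Prod.smul_snd, Prod.smul_fst, smul_eq_mul, mul_one, Prod.fst_sub,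
      Prod.snd_sub] at h3 h4
    rw [← h3, ← h4, h2]
    ring
  have hF1 : HasDerivAt (fun x => (F (x, p.2)).1) (fderiv ℝ F p (fieldX p)).1 p.1 :=
    (HasFDerivAt.comp_hasDerivAt (f := fun s : ℝ => ((s, p.2) : Pt)) p.1
      (hF.differentiableAt hp).hasFDerivAt (hasDerivAt_leafX p p.1)).fst
  have hDb := hasDerivAt_modelPolyDb (k := k) (γ := γ) p.2.1 (hasDerivAt_id p.1)
  have hDbF := hasDerivAt_modelPolyDb (k := k) (γ := γ) (F p).2.1 hF1
  have h1 := (hDb.mul_const e₂.2).const_sub e₁.2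
  have h2 := hDbF.neg.mul ((hDb.mul_const e₂.1).const_sub e₁.1)
  have h3 := h1.unique (h2.congr_of_eventuallyEq
    (eventually_of_mem (Metric.ball_mem_nhds p.1 hε) hY))
  have hsp := congrArg Prod.fst (hsplit p.1 hc1)
  simp only [id, mul_one, Pi.neg_apply, Prod.fst_sub, Prod.smul_fst, smul_eq_mul] at h3 hsp
  have hpp : ((p.1, p.2) : Pt) = p := rfl
  rw [hpp] at h3 hsp
  rw [hsp]
  linear_combination h3

theorem IsLocalAut.fieldX_ne (hF : IsLocalAut k γ F) {p : Pt} (hp : p ∈ F.source) :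
    (fderiv ℝ F p (fieldX p)).1 ≠ 0 := by
  obtain ⟨c, hc, h⟩ := hF.map_X p hp
  rw [h]; simpa [fieldX] using hc

theorem IsLocalAut.fieldY_ne (hF : IsLocalAut k γ F) {p : Pt} (hp : p ∈ F.source) :
    (fderiv ℝ F p (fieldY k γ p)).2.1 ≠ 0 := by
  obtain ⟨c, hc, h⟩ := hF.map_Y p hp
  rw [h]; simpa [fieldY] using hc

theorem IsLocalAut.modelPolyDxb_eq_zero (hF : IsLocalAut k γ F) {p : Pt} (hp : p ∈ F.source)
    (h0 : modelPolyDxb k γ p.1 p.2.1 = 0) : modelPolyDxb k γ (F p).1 (F p).2.1 = 0 := by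
  have h := hF.modelPolyDxb_comp hp
  rw [h0, zero_mul] at h
  exact (mul_eq_zero.1 h).resolve_right (mul_ne_zero (hF.fieldX_ne hp) (hF.fieldY_ne hp))

theorem modelPolyDxb_smul (c x b : ℝ) :
    modelPolyDxb k γ (c * x) (c * b) = c ^ (k - 2) * modelPolyDxb k γ x b := by
  rw [modelPolyDxb, modelPolyDxb, Finset.mul_sum]
  refine Finset.sum_congr rfl fun i hi => ?_
  have := Finset.mem_Icc.1 hi
  rw [show c ^ (k - 2) = c ^ (i - 1) * c ^ (k - i - 1) by rw [← pow_add]; congr 1; omega]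
  ring

theorem abs_modelPolyDxb_le : ∃ K, ∀ x b M : ℝ, |x| ≤ M → |b| ≤ M →
    |modelPolyDxb k γ x b| ≤ K * M ^ (k - 2) := by
  refine ⟨∑ i ∈ Finset.Icc 1 (k - 1), |(i : ℝ) * ((k - i : ℕ) : ℝ) * γ i|, fun x b M hx hb => ?_⟩
  rw [modelPolyDxb, Finset.sum_mul]
  refine (Finset.abs_sum_le_sum_abs _ _).trans (Finset.sum_le_sum fun i hi => ?_)
  have := Finset.mem_Icc.1 hi
  have hM : 0 ≤ M := (abs_nonneg x).trans hx
  rw [show M ^ (k - 2) = M ^ (i - 1) * M ^ (k - i - 1) by rw [← pow_add]; congr 1; omega,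
    abs_mul, abs_mul _ (b ^ (i - 1)), abs_pow, abs_pow, mul_assoc]
  gcongr

theorem IsLocalAut.modelPolyDxb_comp_isBigO (hF : IsLocalAut k γ F) {p₀ : Pt}
    (hp₀ : p₀ ∈ F.source) :
    (fun p : Pt => modelPolyDxb k γ (F p).1 (F p).2.1) =O[𝓝 p₀]
      (fun p : Pt => modelPolyDxb k γ p.1 p.2.1) := by
  have hfd : ContinuousAt (fderiv ℝ F) p₀ :=
    (hF.smooth.contDiffAt (F.open_source.mem_nhds hp₀)).continuousAt_fderiv (by simp)
  have hFc : ContinuousAt F p₀ := F.continuousAt hp₀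
  have hXc : ContinuousAt fieldX p₀ := continuousAt_const
  have hYc : ContinuousAt (fieldY k γ) p₀ := by unfold fieldY; fun_prop
  have hDbc : ContinuousAt (fun p => modelPolyDb k γ (F p).1 (F p).2.1) p₀ :=
    ContinuousAt.comp (f := fun p => ((F p).1, (F p).2.1)) continuous_modelPolyDb.continuousAt
      (hFc.fst.prodMk hFc.snd.fst)
  have hac : ContinuousAt (fun p => fderiv ℝ F p (0, 0, 1)) p₀ :=
    hfd.clm_apply continuousAt_const
  obtain ⟨u, hu⟩ : ∃ u : Pt → ℝ, u = fun p =>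
    (fderiv ℝ F p (fieldX p)).1 * (fderiv ℝ F p (fieldY k γ p)).2.1 := ⟨_, rfl⟩
  obtain ⟨m, hm⟩ : ∃ m : Pt → ℝ, m = fun p => (fderiv ℝ F p (0, 0, 1)).2.2
    + modelPolyDb k γ (F p).1 (F p).2.1 * (fderiv ℝ F p (0, 0, 1)).2.1 := ⟨_, rfl⟩
  have huc : ContinuousAt u p₀ := by
    rw [hu]; exact (hfd.clm_apply hXc).fst.mul (hfd.clm_apply hYc).snd.fst
  have hmc : ContinuousAt m p₀ := by
    rw [hm]; exact hac.snd.snd.add (hDbc.mul hac.snd.fst)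
  have hu0 : ∀ p ∈ F.source, u p ≠ 0 := fun p hp => by
    rw [hu]; exact mul_ne_zero (hF.fieldX_ne hp) (hF.fieldY_ne hp)
  have hb : (fun p => m p / u p) =O[𝓝 p₀] (fun _ => (1 : ℝ)) :=
    (ContinuousAt.div hmc huc (hu0 p₀ hp₀)).tendsto.isBigO_one ℝ
  have h1 := hb.mul (Asymptotics.isBigO_refl (fun p : Pt => modelPolyDxb k γ p.1 p.2.1) (𝓝 p₀))
  simp only [one_mul] at h1
  refine h1.congr' ?_ EventuallyEq.rfl
  filter_upwards [F.open_source.mem_nhds hp₀] with p hp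
  have hup := hu0 p hp
  have h2 : modelPolyDxb k γ (F p).1 (F p).2.1 * u p = modelPolyDxb k γ p.1 p.2.1 * m p := by
    rw [hu, hm]; exact hF.modelPolyDxb_comp hp
  field_simp
  linarith

theorem modelPolyDxb_isBigO_axis (a : ℝ) :
    (fun p : Pt => modelPolyDxb k γ p.1 p.2.1) =O[𝓝 (0, 0, a)]
      (fun p => ‖p - (0, 0, a)‖ ^ (k - 2)) := by
  obtain ⟨K, hK⟩ := abs_modelPolyDxb_le (k := k) (γ := γ)
  refine Asymptotics.isBigO_of_le' (c := K) _ fun p => ?_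
  rw [norm_pow, norm_norm, Real.norm_eq_abs]
  have h1 := norm_fst_le (p - (0, 0, a))
  have h2 := (norm_fst_le (p - (0, 0, a)).2).trans (norm_snd_le (p - (0, 0, a)))
  simp only [Prod.fst_sub, Prod.snd_sub, sub_zero, Real.norm_eq_abs] at h1 h2
  exact hK _ _ _ h1 h2

/-- `∂²P/∂x∂b` vanishes to order `k - 2` on the `a`-axis, hence also on its image under `F`. -/
theorem IsLocalAut.modelPolyDxb_isBigO (hF : IsLocalAut k γ F) {a : ℝ}
    (ha : ((0, 0, a) : Pt) ∈ F.source) :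
    (fun z : Pt => modelPolyDxb k γ z.1 z.2.1) =O[𝓝 (F (0, 0, a))]
      (fun z => ‖z - F (0, 0, a)‖ ^ (k - 2)) := by
  have hqt : F (0, 0, a) ∈ F.target := F.map_source ha
  have hinv : F.symm (F (0, 0, a)) = (0, 0, a) := F.left_inv ha
  have ht : Tendsto F.symm (𝓝 (F (0, 0, a))) (𝓝 (0, 0, a)) := by
    simpa only [hinv] using (F.symm.continuousAt hqt).tendsto
  have h1 : (fun z => ‖F.symm z - (0, 0, a)‖ ^ (k - 2)) =O[𝓝 (F (0, 0, a))]
      (fun z => ‖z - F (0, 0, a)‖ ^ (k - 2)) := by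
    have := (hF.symm.differentiableAt hqt).isBigO_sub
    rw [hinv] at this
    exact this.norm_norm.pow (k - 2)
  have h2 := (hF.modelPolyDxb_comp_isBigO ha).trans (modelPolyDxb_isBigO_axis a)
  refine ((h2.comp_tendsto ht).trans h1).congr' ?_ EventuallyEq.rfl
  filter_upwards [F.open_target.mem_nhds hqt] with z hz
  simp [F.right_inv hz]

/-- A homogeneous polynomial that vanishes to an order equal to its degree at a point is invariant
under translations in the direction of that point. -/
theorem modelPolyDxb_translate_of_isBigO {q : Pt}
    (o3 : (fun z : Pt => modelPolyDxb k γ z.1 z.2.1) =O[𝓝 q] (fun z => ‖z - q‖ ^ (k - 2)))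
    (s t c : ℝ) :
    modelPolyDxb k γ (s + c * q.1) (t + c * q.2.1) = modelPolyDxb k γ s t := by
  set n := k - 2 with hn
  -- rescaling by `c⁻¹ → 0` turns the order of vanishing into boundedness in `c`
  set w : Pt := (s, t, 0) with hw
  have ht : Tendsto (fun c : ℝ => q + c⁻¹ • w) atTop (𝓝 q) := by
    have : Tendsto (fun c : ℝ => q + c⁻¹ • w) atTop (𝓝 (q + (0 : ℝ) • w)) :=
      (tendsto_inv_atTop_zero.smul_const w).const_add q
    simpa using this
  have o4 : (fun c : ℝ => modelPolyDxb k γ (s + c * q.1) (t + c * q.2.1)) =O[atTop]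
      (fun _ => (1 : ℝ)) := by
    have h1 := (Asymptotics.isBigO_refl (fun c : ℝ => c ^ n) atTop).mul (o3.comp_tendsto ht)
    refine (h1.congr' ?_ ?_).trans (Asymptotics.isBigO_const_const (‖w‖ ^ n) one_ne_zero atTop)
    · filter_upwards [eventually_gt_atTop 0] with c hc
      simp only [Function.comp_apply]
      rw [← modelPolyDxb_smul]
      simp only [hw, Prod.fst_add, Prod.snd_add, Prod.smul_fst, Prod.smul_snd, smul_eq_mul]
      congr 1 <;> field_simp <;> ring
    · filter_upwards [eventually_gt_atTop 0] with c hc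
      simp only [Function.comp_apply, add_sub_cancel_left, norm_smul, norm_inv, Real.norm_eq_abs,
        abs_of_pos hc]
      rw [← mul_pow]
      congr 1
      field_simp
  set p : Polynomial ℝ := ∑ i ∈ Finset.Icc 1 (k - 1),
    Polynomial.C ((i : ℝ) * ((k - i : ℕ) : ℝ) * γ i)
      * (Polynomial.C t + Polynomial.X * Polynomial.C q.2.1) ^ (i - 1)
      * (Polynomial.C s + Polynomial.X * Polynomial.C q.1) ^ (k - i - 1) with hp
  have hpe : ∀ c, p.eval c = modelPolyDxb k γ (s + c * q.1) (t + c * q.2.1) := fun c => by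
    simp [hp, modelPolyDxb, Polynomial.eval_finsetSum, mul_comm c]
  have hdeg : p.degree ≤ 0 := by
    rw [← Polynomial.isBoundedUnder_abs_atTop_iff]
    simp only [hpe]
    exact (Asymptotics.isBigO_one_iff ℝ).1 o4
  rw [← hpe c]
  have h0 := hpe 0
  rw [zero_mul, zero_mul, add_zero, add_zero] at h0
  rw [← h0, Polynomial.eq_C_of_degree_le_zero hdeg, Polynomial.eval_C, Polynomial.eval_C]

theorem IsLocalAut.modelPolyDxb_translate (hF : IsLocalAut k γ F) {a : ℝ}
    (ha : ((0, 0, a) : Pt) ∈ F.source) (s t c : ℝ) :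
    modelPolyDxb k γ (s + c * (F (0, 0, a)).1) (t + c * (F (0, 0, a)).2.1)
      = modelPolyDxb k γ s t :=
  modelPolyDxb_translate_of_isBigO (hF.modelPolyDxb_isBigO ha) s t c

end normalForm

end ParaCR

namespace ParaCR

/-! ### Automorphisms that preserve the `a`-axis -/

section decomposition

variable {k : ℕ} {γ : ℕ → ℝ}

/-- The map `(s₁ x, s₂ b, s₃ a)`. -/
def diag (s₁ s₂ s₃ : ℝ) (p : Pt) : Pt := (s₁ * p.1, s₂ * p.2.1, s₃ * p.2.2)

theorem diag_zero (s₁ s₂ s₃ : ℝ) : diag s₁ s₂ s₃ 0 = 0 := by simp [diag, Prod.ext_iff]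

/-- The signs `s₁, s₂, s₃` satisfy `P(s₁ x, s₂ b) = s₃ P(x, b)`, monomial by monomial. -/
structure AdmissibleSigns (k : ℕ) (γ : ℕ → ℝ) (s₁ s₂ s₃ : ℝ) : Prop where
  sq₁ : s₁ * s₁ = 1
  sq₂ : s₂ * s₂ = 1
  sq₃ : s₃ * s₃ = 1
  pow : ∀ i, 1 ≤ i → i ≤ k - 1 → γ i ≠ 0 → s₁ ^ (k - i) * s₂ ^ i = s₃

theorem AdmissibleSigns.ycoord_diag {s₁ s₂ s₃ : ℝ} (h : AdmissibleSigns k γ s₁ s₂ s₃) (p : Pt) :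
    ycoord k γ (diag s₁ s₂ s₃ p) = s₃ * ycoord k γ p := by
  rw [ycoord, diag, modelPoly_diag h.pow, ycoord, mul_add]

/-- Near the origin, the map is a finite composition of exponential images after a linear map
that only changes signs of coordinates. -/
def IsDecomposable (k : ℕ) (γ : ℕ → ℝ) (F : Pt → Pt) : Prop :=
  ∃ f s₁ s₂ s₃, IsExpComp k γ 0 f ∧ AdmissibleSigns k γ s₁ s₂ s₃ ∧
    F =ᶠ[𝓝 0] fun p => f (diag s₁ s₂ s₃ p)

theorem AdmissibleSigns.isDecomposable {s₁ s₂ s₃ : ℝ} (h : AdmissibleSigns k γ s₁ s₂ s₃) :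
    IsDecomposable k γ (diag s₁ s₂ s₃) :=
  ⟨_, s₁, s₂, s₃, IsExpComp.id, h, EventuallyEq.rfl⟩

theorem IsDecomposable.congr {F G : Pt → Pt} (hG : IsDecomposable k γ G) (h : F =ᶠ[𝓝 0] G) :
    IsDecomposable k γ F := by
  obtain ⟨f, s₁, s₂, s₃, hf, hs, he⟩ := hG
  exact ⟨f, s₁, s₂, s₃, hf, hs, h.trans he⟩

theorem IsDecomposable.flow {G : Pt → Pt} (hG : IsDecomposable k γ G) {Θ : ℝ → Pt → Pt}
    {O : Set (ℝ × Pt)} (h : LeafFlow k γ Θ O) (h1 : (-1, G 0) ∈ O) (h2 : (2, G 0) ∈ O) :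
    IsDecomposable k γ (fun p => Θ 1 (G p)) := by
  obtain ⟨f, s₁, s₂, s₃, hf, hs, he⟩ := hG
  have h0 : G 0 = f 0 := by simpa only [diag_zero] using he.self_of_nhds
  rw [h0] at h1 h2
  exact ⟨_, s₁, s₂, s₃, hf.comp (h.isExpAt h1 h2), hs, he.mono fun p hp => by simp only [hp]⟩

theorem LeafForm.mono {F : OpenPartialHomeomorph Pt Pt} {r s : ℝ} (h : LeafForm k γ F r)
    (hs : 0 < s) (hsr : s ≤ r) : LeafForm k γ F s := by
  have hI : Ioo (-s) s ⊆ Ioo (-r) r := Ioo_subset_Ioo (by linarith) hsr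
  exact ⟨hs, fun x hx b hb a ha => h.mem x (hI hx) b (hI hb) a (hI ha),
    fun x hx b hb a ha => h.leafX x (hI hx) b (hI hb) a (hI ha),
    fun x hx b hb a ha y hy => h.leafY x (hI hx) b (hI hb) a (hI ha) y (hI hy),
    h.smoothA.mono hsr, h.smoothB.mono hsr⟩

theorem exists_pos_forall_Ioo {p : ℝ → Prop} (h : ∀ᶠ a in 𝓝 (0 : ℝ), p a) {r : ℝ} (hr : 0 < r) :
    ∃ s > 0, s ≤ r ∧ ∀ a ∈ Ioo (-s) s, p a := by
  obtain ⟨ε, hε, hε'⟩ := Metric.eventually_nhds_iff.1 h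
  refine ⟨min ε r, lt_min hε hr, min_le_right _ _, fun a ha => hε' ?_⟩
  rw [Real.dist_0_eq_abs]
  exact abs_lt.2 ⟨by linarith [ha.1, min_le_left ε r], ha.2.trans_le (min_le_left _ _)⟩

theorem eventually_box {q : ℝ} (hq : 0 < q) : ∀ᶠ p : Pt in 𝓝 0,
    p.1 ∈ Ioo (-q) q ∧ p.2.1 ∈ Ioo (-q) q ∧ p.2.2 ∈ Ioo (-q) q ∧ ycoord k γ p ∈ Ioo (-q) q := by
  have h0 : Ioo (-q) q ∈ 𝓝 (0 : ℝ) := isOpen_Ioo.mem_nhds ⟨by linarith, hq⟩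
  have c1 : ContinuousAt (fun p : Pt => p.1) 0 := by fun_prop
  have c2 : ContinuousAt (fun p : Pt => p.2.1) 0 := by fun_prop
  have c3 : ContinuousAt (fun p : Pt => p.2.2) 0 := by fun_prop
  have c4 : ContinuousAt (ycoord k γ) 0 := contDiff_ycoord.continuous.continuousAt
  exact (c1.eventually_mem h0).and ((c2.eventually_mem h0).and ((c3.eventually_mem h0).and
    (c4.eventually_mem (by simpa [ycoord, modelPoly_zero_left] using h0))))

/-- In coordinates, an automorphism that preserves the `a`-axis is linear in `x` and in `b`. -/
theorem IsLocalAut.exists_linear_form {F : OpenPartialHomeomorph Pt Pt} (hF : IsLocalAut k γ F)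
    (h0 : (0 : Pt) ∈ F.source) (hγ : ∃ i, 1 ≤ i ∧ i ≤ k - 1 ∧ γ i ≠ 0)
    (haxis : ∀ᶠ a in 𝓝 (0 : ℝ), (F (0, 0, a)).1 = 0 ∧ (F (0, 0, a)).2.1 = 0) :
    ∃ (α β h : ℝ → ℝ) (r : ℝ), 0 < r ∧ (∀ y ∈ Ioo (-r) r, α y ≠ 0 ∧ ContinuousAt α y) ∧
      (∀ a ∈ Ioo (-r) r, β a ≠ 0 ∧ ContinuousAt β a) ∧
      (∀ x ∈ Ioo (-r) r, ∀ b ∈ Ioo (-r) r, ∀ a ∈ Ioo (-r) r, ∀ y ∈ Ioo (-r) r,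
        y = a + modelPoly k γ x b → F (x, b, a) = (x * α y, b * β a, h a) ∧
          h y - h a = modelPoly k γ (x * α y) (b * β a)) := by
  obtain ⟨r₀, hL₀⟩ := hF.exists_leafForm h0
  obtain ⟨r, hr, hrr, hax⟩ := exists_pos_forall_Ioo haxis hL₀.pos
  have hL := hL₀.mono hr hrr
  have hr0 : (0 : ℝ) ∈ Ioo (-r) r := ⟨by linarith, hr⟩
  have hC : ∀ b ∈ Ioo (-r) r, ∀ a ∈ Ioo (-r) r, (F (0, b, a)).2.2 = (F (0, 0, a)).2.2 := by
    intro b hb a ha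
    have h1 := hL.master hr0 hb ha ha (by simp [modelPoly_zero_right])
    rw [ycoord, (hax a ha).1, modelPoly_zero_right, modelPoly_zero_right] at h1
    linarith
  have hrel : ∀ x ∈ Ioo (-r) r, ∀ b ∈ Ioo (-r) r, ∀ a ∈ Ioo (-r) r, ∀ y ∈ Ioo (-r) r,
      y = a + modelPoly k γ x b → (F (0, 0, y)).2.2 - (F (0, 0, a)).2.2
        = modelPoly k γ (F (x, 0, y)).1 (F (0, b, a)).2.1 := by
    intro x hx b hb a ha y hy e
    have h1 := hL.master hx hb ha hy e
    have h2 := hL.master hx hr0 hy hy (by simp [modelPoly_zero_left])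
    rw [(hax y hy).2, modelPoly_zero_left] at h2
    rw [hC b hb a ha] at h1
    linarith
  have hA := fun (x : ℝ) (hx : x ∈ Ioo (-r) r) (y : ℝ) (hy : y ∈ Ioo (-r) r) =>
    linear_of_axis (h := fun a => (F (0, 0, a)).2.2) hγ hL.smoothA hL.smoothB
      (fun y hy => (hax y hy).1) (fun a ha => (hax a ha).2)
      (fun a ha => hL.differentiableAt_thd hF ha) hrel hx hy
  have hγ' : ∃ i, 1 ≤ i ∧ i ≤ k - 1 ∧ -γ (k - i) ≠ 0 := by
    obtain ⟨i, h1, h2, h3⟩ := hγ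
    exact ⟨k - i, by omega, by omega, by
      rw [show k - (k - i) = i by omega]; exact neg_ne_zero.2 h3⟩
  have hB := fun (b : ℝ) (hb : b ∈ Ioo (-r) r) (a : ℝ) (ha : a ∈ Ioo (-r) r) =>
    linear_of_axis (h := fun a => (F (0, 0, a)).2.2) (γ := fun i => -γ (k - i)) hγ'
      hL.smoothB hL.smoothA (fun a ha => (hax a ha).2) (fun y hy => (hax y hy).1)
      (fun a ha => hL.differentiableAt_thd hF ha)
      (fun b hb x hx y hy a ha e => by
        rw [modelPoly_dual] at e ⊢
        have := hrel x hx b hb a ha y hy (by linarith)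
        linarith) hb ha
  have hr2 : r / 2 ∈ Ioo (-r) r := ⟨by linarith, by linarith⟩
  -- `α` and `β` are continuous because `α(y) = A(r / 2, y) / (r / 2)`
  have hcont : ∀ A : ℝ → ℝ → ℝ, SmoothFamily A r →
      (∀ x ∈ Ioo (-r) r, ∀ y ∈ Ioo (-r) r, A x y = x * deriv (fun x => A x y) 0) →
      ∀ y ∈ Ioo (-r) r, ContinuousAt (fun y => deriv (fun x => A x y) 0) y := by
    intro A hA hlin y hy
    have h1 : ContinuousAt (fun y => A (r / 2) y / (r / 2)) y :=
      (hA.contDiffAt_right hr2 hy).continuousAt.div_const _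
    refine h1.congr ?_
    filter_upwards [isOpen_Ioo.mem_nhds hy] with y hy
    rw [hlin _ hr2 y hy]
    field_simp
  refine ⟨fun y => deriv (fun x => (F (x, 0, y)).1) 0,
    fun a => deriv (fun b => (F (0, b, a)).2.1) 0,
    fun a => (F (0, 0, a)).2.2, r, hr,
    fun y hy => ⟨hL.smoothA.deriv_ne 0 hr0 y hy, hcont _ hL.smoothA hA y hy⟩,
    fun a ha => ⟨hL.smoothB.deriv_ne 0 hr0 a ha, hcont _ hL.smoothB hB a ha⟩,
    fun x hx b hb a ha y hy e => ⟨?_, ?_⟩⟩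
  · refine Prod.ext ?_ (Prod.ext ?_ ?_)
    · rw [(hL.leafY x hx b hb a ha y hy e).1]; exact hA x hx y hy
    · rw [hL.leafX x hx b hb a ha]; exact hB b hb a ha
    · rw [hL.leafX x hx b hb a ha]; exact hC b hb a ha
  · have := hrel x hx b hb a ha y hy e
    rw [hA x hx y hy, hB b hb a ha] at this
    exact this

theorem exists_sign {u : ℝ} (hu : u ≠ 0) : ∃ s : ℝ, s * s = 1 ∧ |u| * s = u ∧ s = u / |u| := by
  have := abs_pos.2 hu
  refine ⟨u / |u|, ?_, by field_simp, rfl⟩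
  rw [div_mul_div_comm, abs_mul_abs_self, div_self (mul_ne_zero hu hu)]

/-- The weighted dilations and the translations along the `a`-axis account for all maps
`(α₀ x, β₀ b, h₀ + κ₀ a)`, up to signs. -/
theorem isDecomposable_affine {α₀ β₀ κ₀ : ℝ} (h₀ : ℝ) (hα : α₀ ≠ 0) (hβ : β₀ ≠ 0) (hκ : κ₀ ≠ 0)
    (hpow : ∀ i, 1 ≤ i → i ≤ k - 1 → γ i ≠ 0 → κ₀ = β₀ ^ i * α₀ ^ (k - i)) :
    ∃ s₁ s₂ s₃ : ℝ, AdmissibleSigns k γ s₁ s₂ s₃ ∧ ∀ G : Pt → Pt, IsDecomposable k γ G →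
      IsDecomposable k γ (fun p => (α₀ * (s₁ * (G p).1), β₀ * (s₂ * (G p).2.1),
        h₀ + κ₀ * (s₃ * (G p).2.2))) := by
  obtain ⟨s₁, hs₁, he₁, hd₁⟩ := exists_sign hα
  obtain ⟨s₂, hs₂, he₂, hd₂⟩ := exists_sign hβ
  obtain ⟨s₃, hs₃, he₃, hd₃⟩ := exists_sign hκ
  refine ⟨s₁, s₂, s₃, ⟨hs₁, hs₂, hs₃, fun i h1 h2 h3 => ?_⟩, fun G hG => ?_⟩
  · rw [hd₁, hd₂, hd₃, hpow i h1 h2 h3, abs_mul, abs_pow, abs_pow, div_pow, div_pow,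
      div_mul_div_comm]
    ring
  · have hd : ∀ i, 1 ≤ i → i ≤ k - 1 → γ i ≠ 0 →
        ((k - i : ℕ) : ℝ) * Real.log α₀ + i * Real.log β₀ = Real.log κ₀ := fun i h1 h2 h3 => by
      rw [hpow i h1 h2 h3, Real.log_mul (pow_ne_zero _ hβ) (pow_ne_zero _ hα), Real.log_pow,
        Real.log_pow, add_comm]
    have h1 := (hG.flow (leafFlow_dilation hd) (mem_univ _) (mem_univ _)).flow
      (leafFlow_translation (k := k) (γ := γ) h₀) (mem_univ _) (mem_univ _)
    refine h1.congr (Eventually.of_forall fun p => ?_)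
    have e : ∀ {u s : ℝ}, u ≠ 0 → s * s = 1 → |u| * s = u → ∀ z, u * (s * z)
        = Real.exp (1 * Real.log u) * z := by
      intro u s hu hs hus z
      rw [one_mul, Real.exp_log_eq_abs hu]
      nth_rewrite 1 [← hus]
      rw [← mul_assoc, mul_assoc |u|, hs, mul_one]
    simp only [e hα hs₁ he₁, e hβ hs₂ he₂, e hκ hs₃ he₃, one_mul]
    rw [add_comm]

theorem eq_mul_invRoot {f : ℝ → ℝ} {e : ℝ} {j : ℕ} (hj : j ≠ 0) {a : ℝ} (hpos : 0 < 1 - e * a)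
    (hsign : 0 < f a * f 0) (h : f a ^ j = f 0 ^ j / (1 - e * a)) :
    f a = f 0 * invRoot j (1 - e * a) := by
  refine eq_of_pow_eq_of_mul_pos hj ?_ ?_
  · rw [h, mul_pow, invRoot_pow hj hpos, mul_one_div]
  · rw [← mul_assoc]; exact mul_pos hsign (invRoot_pos _ _)

theorem eventually_mul_pos {f : ℝ → ℝ} (hf : ContinuousAt f 0) (h0 : f 0 ≠ 0) :
    ∀ᶠ a in 𝓝 (0 : ℝ), 0 < f a * f 0 := by
  have h1 : ContinuousAt (fun a => f a * f 0) 0 := hf.mul_const _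
  exact h1.eventually (lt_mem_nhds (mul_self_pos.2 h0))

/-- If `P` is a monomial, the automorphism is a flow of the form `a ↦ a / (1 - t e a)` followed by a
dilation and a translation. Otherwise it is affine. -/
theorem IsLocalAut.isDecomposable_of_axis {F : OpenPartialHomeomorph Pt Pt}
    (hF : IsLocalAut k γ F) (h0 : (0 : Pt) ∈ F.source)
    (hγ : ∃ i, 1 ≤ i ∧ i ≤ k - 1 ∧ γ i ≠ 0)
    (haxis : ∀ᶠ a in 𝓝 (0 : ℝ), (F (0, 0, a)).1 = 0 ∧ (F (0, 0, a)).2.1 = 0) :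
    IsDecomposable k γ F := by
  obtain ⟨α, β, h, r, hr, hα, hβ, hform⟩ := hF.exists_linear_form h0 hγ haxis
  obtain ⟨s, hs, η₀, hη₀, hmono⟩ := monomial_of_linear hr hγ
    fun x hx b hb a ha y hy e => (hform x hx b hb a ha y hy e).2
  have hr0 : (0 : ℝ) ∈ Ioo (-r) r := ⟨by linarith, hr⟩
  obtain ⟨hα0, hαc⟩ := hα 0 hr0
  obtain ⟨hβ0, hβc⟩ := hβ 0 hr0
  obtain ⟨η, hη, hηr, hη'⟩ := exists_pos_forall_Ioo
    ((eventually_mul_pos hαc hα0).and (eventually_mul_pos hβc hβ0)) (lt_min hr hη₀)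
  have hIr : Ioo (-η) η ⊆ Ioo (-r) r :=
    Ioo_subset_Ioo (neg_le_neg (hηr.trans (min_le_left _ _))) (hηr.trans (min_le_left _ _))
  have hIη : Ioo (-η) η ⊆ Ioo (-η₀) η₀ :=
    Ioo_subset_Ioo (neg_le_neg (hηr.trans (min_le_right _ _))) (hηr.trans (min_le_right _ _))
  have hη0 : (0 : ℝ) ∈ Ioo (-η) η := ⟨by linarith, hη⟩
  have hmon : ∀ a ∈ Ioo (-η) η, ∀ y ∈ Ioo (-η) η, 0 < s * (y - a) →
      ∀ i, 1 ≤ i → i ≤ k - 1 → γ i ≠ 0 → h y - h a = (y - a) * β a ^ i * α y ^ (k - i) :=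
    fun a ha y hy => hmono a (hIη ha) y (hIη hy)
  -- the values of `h` follow from those of `α` and `β`
  have hh : ∀ {e : ℝ} {i : ℕ}, 1 ≤ i → i ≤ k - 1 → γ i ≠ 0 → ∀ {a : ℝ}, a ∈ Ioo (-η) η →
      0 < 1 - e * a → β a ^ i = β 0 ^ i / (1 - e * a) →
      α a ^ (k - i) = α 0 ^ (k - i) / (1 - e * a) →
      h a = h 0 + β 0 ^ i * α 0 ^ (k - i) * (a / (1 - e * a)) := by
    intro e i h1 h2 h3 a ha hpos hb hc
    rcases lt_trichotomy (s * a) 0 with hlt | heq | hgt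
    · have := hmon a ha 0 hη0 (by linarith) i h1 h2 h3
      rw [hb] at this
      have e1 : (0 - a) * (β 0 ^ i / (1 - e * a)) * α 0 ^ (k - i)
        = -(β 0 ^ i * α 0 ^ (k - i) * (a / (1 - e * a))) := by ring
      linarith
    · have ha0 : a = 0 := by rcases hs with rfl | rfl <;> linarith
      simp [ha0]
    · have := hmon 0 hη0 a ha (by linarith) i h1 h2 h3
      rw [hc] at this
      have e1 : (a - 0) * β 0 ^ i * (α 0 ^ (k - i) / (1 - e * a))
        = β 0 ^ i * α 0 ^ (k - i) * (a / (1 - e * a)) := by ring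
      linarith
  obtain ⟨i, hi1, hi2, hi0⟩ := hγ
  by_cases hmo : ∀ j, 1 ≤ j → j ≤ k - 1 → j ≠ i → γ j = 0
  · -- `P` is a monomial
    obtain ⟨e, ζ, hζ, hζη, hm⟩ := moebius_of_sign (f := fun a => β a ^ i)
      (g := fun y => α y ^ (k - i)) (h := h) hs hη
      (fun a ha => pow_ne_zero _ (hβ a (hIr ha)).1) (fun y hy => pow_ne_zero _ (hα y (hIr hy)).1)
      (fun a ha y hy hlt => hmon a ha y hy hlt i hi1 hi2 hi0)
    have hIζ : Ioo (-ζ) ζ ⊆ Ioo (-η) η := Ioo_subset_Ioo (neg_le_neg hζη) hζη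
    obtain ⟨s₁, s₂, s₃, hsg, hdec⟩ := isDecomposable_affine (k := k) (γ := γ)
      (κ₀ := β 0 ^ i * α 0 ^ (k - i)) (h 0) hα0 hβ0
      (mul_ne_zero (pow_ne_zero _ hβ0) (pow_ne_zero _ hα0)) (fun j h1 h2 h3 => by
        rw [show j = i from by_contra fun hne => h3 (hmo j h1 h2 hne)])
    have hmob := hsg.isDecomposable.flow (leafFlow_moebius hi1 hi2 hmo (s₃ * e))
      (by simp [diag, ycoord, modelPoly_zero_left]) (by simp [diag, ycoord, modelPoly_zero_left])
    refine (hdec _ hmob).congr ?_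
    filter_upwards [eventually_box (k := k) (γ := γ) hζ] with p hp
    have hp1 := hIr (hIζ hp.1)
    have hp2 := hIr (hIζ hp.2.1)
    obtain ⟨ma1, ma2, ma3⟩ := hm _ hp.2.2.1
    obtain ⟨my1, my2, my3⟩ := hm _ hp.2.2.2
    have hpe : F p = (p.1 * α (ycoord k γ p), p.2.1 * β p.2.2, h p.2.2) :=
      (hform p.1 hp1 p.2.1 hp2 p.2.2 (hIr (hIζ hp.2.2.1)) _ (hIr (hIζ hp.2.2.2)) rfl).1
    rw [hpe, hsg.ycoord_diag, hh hi1 hi2 hi0 (hIζ hp.2.2.1) ma1 ma2 ma3,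
      eq_mul_invRoot (by omega) my1 (hη' _ (hIζ hp.2.2.2)).1 my3,
      eq_mul_invRoot (by omega) ma1 (hη' _ (hIζ hp.2.2.1)).2 ma2]
    have e1 : ∀ y, 1 - 1 * (s₃ * e) * (s₃ * y) = 1 - e * y := fun y => by
      linear_combination (-(e * y)) * hsg.sq₃
    simp only [diag, e1]
    refine Prod.ext ?_ (Prod.ext ?_ ?_)
    · simp only
      linear_combination (-(p.1 * α 0 * invRoot (k - i) (1 - e * ycoord k γ p))) * hsg.sq₁
    · simp only
      linear_combination (-(p.2.1 * β 0 * invRoot i (1 - e * p.2.2))) * hsg.sq₂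
    · simp only
      rw [mul_div_assoc, ← mul_assoc s₃, hsg.sq₃, one_mul]
  · -- `P` has two different monomials, so that `|α| = |β|` is constant
    push Not at hmo
    obtain ⟨j, hj1, hj2, hji, hj0⟩ := hmo
    have habs : ∀ a ∈ Ioo (-η) η, ∀ y ∈ Ioo (-η) η, 0 < s * (y - a) → |β a| = |α y| := by
      intro a ha y hy hlt
      have hya : y - a ≠ 0 := by rintro h; rw [h, mul_zero] at hlt; exact lt_irrefl _ hlt
      have hβa := (hβ a (hIr ha)).1
      have hαy := (hα y (hIr hy)).1
      have main : ∀ i j : ℕ, i < j → j ≤ k - 1 →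
          (y - a) * β a ^ i * α y ^ (k - i) = (y - a) * β a ^ j * α y ^ (k - j) →
          |β a| = |α y| := by
        intro i j hij hj h
        rw [mul_assoc, mul_assoc] at h
        have h := mul_left_cancel₀ hya h
        rw [show k - i = (k - j) + (j - i) by omega, show β a ^ j = β a ^ i * β a ^ (j - i) by
          rw [← pow_add]; congr 1; omega, pow_add] at h
        have h2 : β a ^ i * α y ^ (k - j) * α y ^ (j - i)
            = β a ^ i * α y ^ (k - j) * β a ^ (j - i) := by linear_combination h
        have h3 := mul_left_cancel₀
          (mul_ne_zero (pow_ne_zero _ hβa) (pow_ne_zero _ hαy)) h2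
        have h4 := congrArg abs h3
        rw [abs_pow, abs_pow] at h4
        exact ((pow_left_inj₀ (abs_nonneg _) (abs_nonneg _) (by omega)).1 h4).symm
      have e1 := hmon a ha y hy hlt i hi1 hi2 hi0
      have e2 := hmon a ha y hy hlt j hj1 hj2 hj0
      rcases lt_or_gt_of_ne hji with hlt' | hgt
      · exact main j i hlt' hi2 (e2.symm.trans e1)
      · exact main i j hgt hj2 (e1.symm.trans e2)
    have hs1 : s * s = 1 := by rcases hs with rfl | rfl <;> norm_num
    have hη2 : Ioo (-(η / 2)) (η / 2) ⊆ Ioo (-η) η :=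
      Ioo_subset_Ioo (by linarith) (by linarith)
    have hsm : ∀ c ∈ Ioo (-(3 / 4) : ℝ) (3 / 4), s * (c * η) ∈ Ioo (-η) η := by
      intro c hc
      have h1 : -η < c * η := by nlinarith [hc.1]
      have h2 : c * η < η := by nlinarith [hc.2]
      rcases hs with rfl | rfl
      · exact ⟨by linarith, by linarith⟩
      · exact ⟨by linarith, by linarith⟩
    have hpos : ∀ a ∈ Ioo (-(η / 2)) (η / 2), 0 < s * (s * (5 / 8 * η) - a) ∧
        0 < s * (a - s * (-(5 / 8) * η)) := by
      intro a ha
      have h1 : s * (s * (5 / 8 * η)) = 5 / 8 * η := by rw [← mul_assoc, hs1, one_mul]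
      have h2 : s * (s * (-(5 / 8) * η)) = -(5 / 8) * η := by rw [← mul_assoc, hs1, one_mul]
      rw [mul_sub, mul_sub, h1, h2]
      rcases hs with rfl | rfl
      · exact ⟨by linarith [ha.2], by linarith [ha.1]⟩
      · exact ⟨by linarith [ha.1], by linarith [ha.2]⟩
    have m1 := hsm (5 / 8) ⟨by norm_num, by norm_num⟩
    have m2 := hsm (-(5 / 8)) ⟨by norm_num, by norm_num⟩
    have hz : (0 : ℝ) ∈ Ioo (-(η / 2)) (η / 2) := ⟨by linarith, by linarith⟩
    have hβconst : ∀ a ∈ Ioo (-(η / 2)) (η / 2), β a = β 0 := fun a ha => by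
      refine eq_of_pow_eq_of_mul_pos two_ne_zero ?_ (hη' a (hη2 ha)).2
      rw [← sq_abs, habs a (hη2 ha) _ m1 (hpos a ha).1, ← habs 0 hη0 _ m1 (hpos 0 hz).1, sq_abs]
    have hαconst : ∀ a ∈ Ioo (-(η / 2)) (η / 2), α a = α 0 := fun a ha => by
      refine eq_of_pow_eq_of_mul_pos two_ne_zero ?_ (hη' a (hη2 ha)).1
      rw [← sq_abs, ← habs _ m2 a (hη2 ha) (hpos a ha).2, habs _ m2 0 hη0 (hpos 0 hz).2, sq_abs]
    have hpow : ∀ m, 1 ≤ m → m ≤ k - 1 → γ m ≠ 0 →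
        β 0 ^ i * α 0 ^ (k - i) = β 0 ^ m * α 0 ^ (k - m) := by
      intro m h1 h2 h3
      have hy : s * (1 / 4 * η) ∈ Ioo (-(η / 2)) (η / 2) := by
        rcases hs with rfl | rfl
        · exact ⟨by linarith, by linarith⟩
        · exact ⟨by linarith, by linarith⟩
      have hlt : 0 < s * (s * (1 / 4 * η) - 0) := by
        rw [sub_zero, ← mul_assoc, hs1]; linarith
      have hne : s * (1 / 4 * η) - 0 ≠ 0 := fun h => by
        rw [h, mul_zero] at hlt; exact lt_irrefl _ hlt
      have e1 := hmon 0 hη0 _ (hη2 hy) hlt i hi1 hi2 hi0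
      have e2 := hmon 0 hη0 _ (hη2 hy) hlt m h1 h2 h3
      rw [e1, hαconst _ hy, mul_assoc, mul_assoc] at e2
      exact mul_left_cancel₀ hne e2
    obtain ⟨s₁, s₂, s₃, hsg, hdec⟩ := isDecomposable_affine (k := k) (γ := γ) (h 0) hα0 hβ0
      (mul_ne_zero (pow_ne_zero i hβ0) (pow_ne_zero (k - i) hα0)) hpow
    refine (hdec _ hsg.isDecomposable).congr ?_
    filter_upwards [eventually_box (k := k) (γ := γ) (half_pos hη)] with p hp
    have hpe : F p = (p.1 * α (ycoord k γ p), p.2.1 * β p.2.2, h p.2.2) :=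
      (hform p.1 (hIr (hη2 hp.1)) p.2.1 (hIr (hη2 hp.2.1)) p.2.2 (hIr (hη2 hp.2.2.1)) _
        (hIr (hη2 hp.2.2.2)) rfl).1
    rw [hpe, hαconst _ hp.2.2.2, hβconst _ hp.2.2.1,
      hh (e := 0) hi1 hi2 hi0 (hη2 hp.2.2.1) (by simp)
        (by rw [hβconst _ hp.2.2.1]; simp) (by rw [hαconst _ hp.2.2.1]; simp)]
    simp only [diag]
    refine Prod.ext ?_ (Prod.ext ?_ ?_)
    · simp only
      linear_combination (-(p.1 * α 0)) * hsg.sq₁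
    · simp only
      linear_combination (-(p.2.1 * β 0)) * hsg.sq₂
    · simp only [zero_mul, sub_zero, div_one]
      linear_combination (-(β 0 ^ i * α 0 ^ (k - i) * p.2.2)) * hsg.sq₃

end decomposition

end ParaCR

namespace ParaCR

/-! ### Automorphisms that move the `a`-axis -/

section cases

variable {k : ℕ} {γ : ℕ → ℝ} {F : OpenPartialHomeomorph Pt Pt}

/-- An automorphism is decomposable if a flow moves the image of the `a`-axis back to the
`a`-axis. -/
theorem IsLocalAut.isDecomposable_of_flow (hF : IsLocalAut k γ F) (h0 : (0 : Pt) ∈ F.source)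
    (hγ : ∃ i, 1 ≤ i ∧ i ≤ k - 1 ∧ γ i ≠ 0) {Θ : ℝ → Pt → Pt} {O : Set (ℝ × Pt)}
    (h : LeafFlow k γ Θ O) (hO : (-1, F 0) ∈ O) (haO : ∀ t a, (t, ((0, 0, a) : Pt)) ∈ O)
    (haxis : ∀ᶠ a in 𝓝 (0 : ℝ),
      (Θ (-1) (F (0, 0, a))).1 = 0 ∧ (Θ (-1) (F (0, 0, a))).2.1 = 0) :
    IsDecomposable k γ F := by
  have hG : IsDecomposable k γ (fun p => Θ (-1) (F p)) := by
    refine (hF.trans (h.isLocalAut_toHomeo (-1))).isDecomposable_of_axis ?_ hγ haxis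
    rw [OpenPartialHomeomorph.trans_source]
    exact ⟨h0, hO⟩
  have ha : Θ (-1) (F 0) = (0, 0, (Θ (-1) (F 0)).2.2) := by
    have := haxis.self_of_nhds
    exact Prod.ext this.1 (Prod.ext this.2 rfl)
  have hm : ∀ t, (t, Θ (-1) (F 0)) ∈ O := fun t => by rw [ha]; exact haO t _
  refine (hG.flow h (hm _) (hm _)).congr ?_
  filter_upwards [(F.continuousAt h0).eventually_mem ((h.isOpen_time (-1)).mem_nhds hO)] with p hp
  have := (h.neg_mem hp).2
  rw [neg_neg] at this
  exact this.symm

theorem modelPolyDxb_monomial {i : ℕ} (h1 : 1 ≤ i) (h2 : i ≤ k - 1)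
    (h : ∀ j, 1 ≤ j → j ≤ k - 1 → j ≠ i → γ j = 0) (x b : ℝ) :
    modelPolyDxb k γ x b = (i : ℝ) * ((k - i : ℕ) : ℝ) * γ i * b ^ (i - 1) * x ^ (k - i - 1) := by
  refine Finset.sum_eq_single_of_mem i (Finset.mem_Icc.2 ⟨h1, h2⟩) fun j hj hji => ?_
  rw [h j (Finset.mem_Icc.1 hj).1 (Finset.mem_Icc.1 hj).2 hji]
  ring

/-- The case `P = γ₁ b x ^ (k - 1)`, in which the plane `x = 0` is preserved. -/
theorem IsLocalAut.isDecomposable_of_first (hF : IsLocalAut k γ F) (h0 : (0 : Pt) ∈ F.source)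
    (hk : 2 < k) (hg : γ 1 ≠ 0) (h : ∀ j, 1 ≤ j → j ≤ k - 1 → j ≠ 1 → γ j = 0) :
    IsDecomposable k γ F := by
  obtain ⟨r, hL⟩ := hF.exists_leafForm h0
  have hr0 : (0 : ℝ) ∈ Ioo (-r) r := ⟨by linarith [hL.pos], hL.pos⟩
  have hP := modelPoly_monomial le_rfl (by omega) h
  have hQ := modelPolyDxb_monomial le_rfl (by omega) h
  have hk1 : (1 : ℝ) * ((k - 1 : ℕ) : ℝ) * γ 1 ≠ 0 :=
    mul_ne_zero (mul_ne_zero one_ne_zero (Nat.cast_ne_zero.2 (by omega))) hg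
  have hA0 : ∀ y ∈ Ioo (-r) r, (F (0, 0, y)).1 = 0 := fun y hy => by
    have := hF.modelPolyDxb_eq_zero (hL.mem 0 hr0 0 hr0 y hy)
      (by rw [hQ]; simp [show k - 1 - 1 ≠ 0 by omega])
    rw [hQ] at this
    simpa [hk1, hg, show k - 1 ≠ 0 by omega, show k - 1 - 1 ≠ 0 by omega,
      show ((k - 1 : ℕ) : ℝ) ≠ 0 from Nat.cast_ne_zero.2 (by omega)] using this
  obtain ⟨κ, η, hη, hκ⟩ := affine_of_pencil (A := fun x y => (F (x, 0, y)).1)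
    (B := fun b a => (F (0, b, a)).2.1) (C := fun b a => (F (0, b, a)).2.2)
    (D := fun x y => ycoord k γ (F (x, 0, y))) (m := k - 1) (g := γ 1) (by omega) hL.pos hg
    hL.smoothA hL.smoothB hA0 (fun a ha => hL.differentiableAt_thd hF ha)
    (fun x hx b hb a ha y hy e => by
      rw [hL.master hx hb ha hy (by rw [e, hP, pow_one]), hP, pow_one])
  have h00 : (F 0).1 = 0 := hA0 0 hr0
  refine hF.isDecomposable_of_flow h0 ⟨1, le_rfl, by omega, hg⟩ (leafFlow_slope hk h
    ((F (0, 0, 0)).2.1 - κ * (F (0, 0, 0)).2.2) κ) ?_ ?_ ?_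
  · simp [h00, show k - 1 ≠ 0 by omega]
  · intro t a
    simp [show k - 1 ≠ 0 by omega]
  · filter_upwards [isOpen_Ioo.mem_nhds hr0,
      isOpen_Ioo.mem_nhds (⟨by linarith, hη⟩ : (0 : ℝ) ∈ Ioo (-η) η)] with a ha ha'
    refine ⟨by simp [hA0 a ha], ?_⟩
    simp only [hκ a ha']
    ring

/-- The case `P = γ_(k-1) b ^ (k - 1) x`, in which the plane `b = 0` is preserved. -/
theorem IsLocalAut.isDecomposable_of_last (hF : IsLocalAut k γ F) (h0 : (0 : Pt) ∈ F.source)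
    (hk : 2 < k) (hg : γ (k - 1) ≠ 0) (h : ∀ j, 1 ≤ j → j ≤ k - 1 → j ≠ k - 1 → γ j = 0) :
    IsDecomposable k γ F := by
  obtain ⟨r, hL⟩ := hF.exists_leafForm h0
  have hr0 : (0 : ℝ) ∈ Ioo (-r) r := ⟨by linarith [hL.pos], hL.pos⟩
  have hP := modelPoly_monomial (by omega) le_rfl h
  have hQ := modelPolyDxb_monomial (by omega) le_rfl h
  have hk1 : k - (k - 1) = 1 := by omega
  simp only [hk1, pow_one] at hP
  have hB0 : ∀ a ∈ Ioo (-r) r, (F (0, 0, a)).2.1 = 0 := fun a ha => by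
    have := hF.modelPolyDxb_eq_zero (hL.mem 0 hr0 0 hr0 a ha)
      (by rw [hQ]; simp [show k - 1 - 1 ≠ 0 by omega])
    rw [hQ] at this
    simpa [hg, hk1, show k - 1 - 1 ≠ 0 by omega,
      show ((k - 1 : ℕ) : ℝ) ≠ 0 from Nat.cast_ne_zero.2 (by omega)] using this
  obtain ⟨κ, η, hη, hκ⟩ := affine_of_pencil (A := fun b a => (F (0, b, a)).2.1)
    (B := fun x y => (F (x, 0, y)).1) (C := fun x y => ycoord k γ (F (x, 0, y)))
    (D := fun b a => (F (0, b, a)).2.2) (m := k - 1) (g := -γ (k - 1)) (by omega) hL.pos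
    (neg_ne_zero.2 hg) hL.smoothB hL.smoothA hB0
    (fun y hy => DifferentiableAt.comp y (f := fun y : ℝ => F (0, 0, y)) (g := ycoord k γ)
      (contDiff_ycoord.contDiffAt.differentiableAt (by simp))
      (DifferentiableAt.comp y (f := fun y : ℝ => ((0, 0, y) : Pt))
        (hF.differentiableAt (hL.mem 0 hr0 0 hr0 y hy)) (by fun_prop)))
    (fun b hb x hx y hy a ha e => by
      rw [hL.master hx hb ha hy (by rw [e, hP]; ring), hP]
      ring)
  have h00 : (F 0).2.1 = 0 := hB0 0 hr0
  refine hF.isDecomposable_of_flow h0 ⟨k - 1, by omega, le_rfl, hg⟩ (leafFlow_slope_dual hk h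
    ((F (0, 0, 0)).1 - κ * ycoord k γ (F (0, 0, 0))) κ) ?_ ?_ ?_
  · simp [h00, show k - 1 ≠ 0 by omega]
  · intro t a
    simp [show k - 1 ≠ 0 by omega]
  · filter_upwards [isOpen_Ioo.mem_nhds hr0,
      isOpen_Ioo.mem_nhds (⟨by linarith, hη⟩ : (0 : ℝ) ∈ Ioo (-η) η)] with a ha ha'
    refine ⟨?_, by simp [hB0 a ha]⟩
    simp only [hκ a ha']
    ring

theorem SmoothFamily.exists_of_deriv_ne {A : ℝ → ℝ → ℝ} {r : ℝ} (hr : 0 < r)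
    (hA : ContDiffOn ℝ ∞ (fun z : ℝ × ℝ => A z.1 z.2) (Ioo (-r) r ×ˢ Ioo (-r) r))
    (h0 : deriv (fun x => A x 0) 0 ≠ 0) : ∃ s > 0, s ≤ r ∧ SmoothFamily A s := by
  have hr0 : (0 : ℝ) ∈ Ioo (-r) r := ⟨by linarith, hr⟩
  have hd : ∀ x ∈ Ioo (-r) r, ∀ y ∈ Ioo (-r) r,
      deriv (fun x => A x y) x = fderiv ℝ (fun z : ℝ × ℝ => A z.1 z.2) (x, y) (1, 0) := by
    intro x hx y hy
    have hm : Ioo (-r) r ×ˢ Ioo (-r) r ∈ 𝓝 (x, y) :=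
      (isOpen_Ioo.prod isOpen_Ioo).mem_nhds ⟨hx, hy⟩
    have h1 := (hA.contDiffAt hm).differentiableAt (by simp)
    exact (HasFDerivAt.comp_hasDerivAt (f := fun x : ℝ => (x, y)) x h1.hasFDerivAt
      ((hasDerivAt_id x).prodMk (hasDerivAt_const x y))).deriv
  have hm : Ioo (-r) r ×ˢ Ioo (-r) r ∈ 𝓝 (0 : ℝ × ℝ) :=
    (isOpen_Ioo.prod isOpen_Ioo).mem_nhds ⟨hr0, hr0⟩
  have hc : ContinuousAt (fun z : ℝ × ℝ => fderiv ℝ (fun z : ℝ × ℝ => A z.1 z.2) z (1, 0)) 0 :=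
    ((hA.contDiffAt hm).continuousAt_fderiv (by simp)).clm_apply continuousAt_const
  have h1 := hc.eventually_ne (by rw [hd 0 hr0 0 hr0] at h0; exact h0)
  obtain ⟨ε, hε, hball⟩ := Metric.eventually_nhds_iff.1 h1
  refine ⟨min ε r, lt_min hε hr, min_le_right _ _, ?_, fun x hx y hy => ?_⟩
  · have : Ioo (-min ε r) (min ε r) ⊆ Ioo (-r) r :=
      Ioo_subset_Ioo (neg_le_neg (min_le_right _ _)) (min_le_right _ _)
    exact hA.mono (prod_mono this this)
  · have hI : ∀ z ∈ Ioo (-min ε r) (min ε r), z ∈ Ioo (-r) r ∧ |z| < ε := fun z hz =>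
      ⟨Ioo_subset_Ioo (neg_le_neg (min_le_right _ _)) (min_le_right _ _) hz,
        (abs_lt.2 hz).trans_le (min_le_left _ _)⟩
    rw [hd x (hI x hx).1 y (hI y hy).1]
    refine hball ?_
    simp only [Prod.dist_eq, Prod.fst_zero, Prod.snd_zero, Real.dist_0_eq_abs, max_lt_iff]
    exact ⟨(hI x hx).2, (hI y hy).2⟩

/-- The case `P = c ((x - ρ b) ^ k - x ^ k - (-ρ b) ^ k)`. In the coordinates `z = ρ b`,
`ỹ = y + c x ^ k` and `ã = a - c (-z) ^ k` the surface becomes translation invariant, since its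
equation is `ỹ - ã = c (x - z) ^ k`. -/
theorem IsLocalAut.isDecomposable_of_power (hF : IsLocalAut k γ F) (h0 : (0 : Pt) ∈ F.source)
    (hk : 2 < k) (hγ : ∃ i, 1 ≤ i ∧ i ≤ k - 1 ∧ γ i ≠ 0) {c c₀ ρ : ℝ} (hc : c ≠ 0) (hc₀ : c₀ ≠ 0)
    (hρ : ρ ≠ 0) (hP : ∀ x b, modelPoly k γ x b = c * ((x - ρ * b) ^ k - x ^ k - (-(ρ * b)) ^ k))
    (hQ : ∀ x b, modelPolyDxb k γ x b = c₀ * (x - ρ * b) ^ (k - 2)) :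
    IsDecomposable k γ F := by
  obtain ⟨r, hL⟩ := hF.exists_leafForm h0
  have hr := hL.pos
  have hr0 : (0 : ℝ) ∈ Ioo (-r) r := ⟨by linarith, hr⟩
  have hk0 : k ≠ 0 := by omega
  -- the plane `x = ρ b` is preserved
  have hplane : ∀ b a, ((ρ * b, b, a) : Pt) ∈ F.source →
      (F (ρ * b, b, a)).1 = ρ * (F (ρ * b, b, a)).2.1 := fun b a hs => by
    have := hF.modelPolyDxb_eq_zero hs (by simp [hQ, show k - 2 ≠ 0 by omega])
    rw [hQ] at this
    exact sub_eq_zero.1 (pow_eq_zero_iff (by omega) |>.1 ((mul_eq_zero.1 this).resolve_left hc₀))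
  have hev : ∀ᶠ z : ℝ × ℝ in 𝓝 0, z.1 ∈ Ioo (-r) r ∧ z.1 / ρ ∈ Ioo (-r) r ∧
      z.2 - c * z.1 ^ k ∈ Ioo (-r) r ∧ z.2 + c * (-z.1) ^ k ∈ Ioo (-r) r := by
    have hm : Ioo (-r) r ∈ 𝓝 (0 : ℝ) := isOpen_Ioo.mem_nhds hr0
    have c1 : ContinuousAt (fun z : ℝ × ℝ => z.1) 0 := by fun_prop
    have c2 : ContinuousAt (fun z : ℝ × ℝ => z.1 / ρ) 0 := c1.div_const _
    have c3 : ContinuousAt (fun z : ℝ × ℝ => z.2 - c * z.1 ^ k) 0 := by fun_prop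
    have c4 : ContinuousAt (fun z : ℝ × ℝ => z.2 + c * (-z.1) ^ k) 0 := by fun_prop
    exact (c1.eventually_mem (by simpa using hm)).and ((c2.eventually_mem (by simpa using hm)).and
      ((c3.eventually_mem (by simpa [hk0] using hm)).and
      (c4.eventually_mem (by simpa [hk0] using hm))))
  obtain ⟨q, hq, hball⟩ := Metric.eventually_nhds_iff.1 hev
  have hbox : ∀ x ∈ Ioo (-q) q, ∀ w ∈ Ioo (-q) q, x ∈ Ioo (-r) r ∧ x / ρ ∈ Ioo (-r) r ∧
      w - c * x ^ k ∈ Ioo (-r) r ∧ w + c * (-x) ^ k ∈ Ioo (-r) r := fun x hx w hw => by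
    refine hball (y := (x, w)) ?_
    simp only [Prod.dist_eq, Prod.fst_zero, Prod.snd_zero, Real.dist_0_eq_abs, max_lt_iff]
    exact ⟨abs_lt.2 hx, abs_lt.2 hw⟩
  have hq0 : (0 : ℝ) ∈ Ioo (-q) q := ⟨by linarith, hq⟩
  have hFs : ContDiffOn ℝ ∞ (fun z : ℝ × ℝ => F (z.1, 0, z.2 - c * z.1 ^ k))
      (Ioo (-q) q ×ˢ Ioo (-q) q) :=
    hF.smooth.comp (f := fun z : ℝ × ℝ => ((z.1, 0, z.2 - c * z.1 ^ k) : Pt)) (by fun_prop)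
      fun z hz => hL.mem _ (hbox _ hz.1 _ hz.2).1 _ hr0 _ (hbox _ hz.1 _ hz.2).2.2.1
  -- the exponent `k` is at least two, so the change of coordinates does not affect `∂A/∂x` at `0`
  have hderiv : deriv (fun x => (F (x, 0, 0 - c * x ^ k)).1) 0 ≠ 0 := by
    have h1 := ((hL.smoothA.contDiffAt hr0 hr0).differentiableAt (by simp)).hasFDerivAt
    have h2 : HasDerivAt (fun x : ℝ => (x, 0 - c * x ^ k)) ((1 : ℝ), (0 : ℝ)) 0 := by
      refine (hasDerivAt_id (0 : ℝ)).prodMk ((((hasDerivAt_pow k (0 : ℝ)).const_mul c).const_sub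
        0).congr_deriv ?_)
      simp [show k - 1 ≠ 0 by omega]
    have h3 : HasDerivAt (fun x : ℝ => (x, (0 : ℝ))) ((1 : ℝ), (0 : ℝ)) 0 :=
      (hasDerivAt_id (0 : ℝ)).prodMk (hasDerivAt_const _ _)
    have e1 := HasFDerivAt.comp_hasDerivAt_of_eq (0 : ℝ) h1 h2 (by simp [hk0])
    have e2 := HasFDerivAt.comp_hasDerivAt_of_eq (0 : ℝ) h1 h3 rfl
    have h4 := hL.smoothA.deriv_ne 0 hr0 0 hr0
    exact fun h => h4 (e2.deriv.trans (e1.deriv.symm.trans h))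
  obtain ⟨s, hs, hsq, hsm⟩ := SmoothFamily.exists_of_deriv_ne
    (A := fun x w => (F (x, 0, w - c * x ^ k)).1) hq hFs.fst hderiv
  have hI : Ioo (-s) s ⊆ Ioo (-q) q := Ioo_subset_Ioo (by linarith) hsq
  have hD : ContDiffOn ℝ ∞ (fun z : ℝ × ℝ => ycoord k γ (F (z.1, 0, z.2 - c * z.1 ^ k))
      + c * (F (z.1, 0, z.2 - c * z.1 ^ k)).1 ^ k) (Ioo (-s) s ×ˢ Ioo (-s) s) :=
    ((contDiff_ycoord.comp_contDiffOn hFs).add (contDiffOn_const.mul (hFs.fst.pow k))).mono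
      (prod_mono hI hI)
  have hconst := const_of_translation_invariant (k := k) (by omega) hs hc hsm
    (D := fun x w => ycoord k γ (F (x, 0, w - c * x ^ k)) + c * (F (x, 0, w - c * x ^ k)).1 ^ k)
    hD (fun x hx z hz v hv w hw e => by
      obtain ⟨hx1, -, hx3, -⟩ := hbox x (hI hx) w (hI hw)
      obtain ⟨hz1, hz2, hz3, hz4⟩ := hbox z (hI hz) v (hI hv)
      have hzρ : ρ * (z / ρ) = z := by field_simp
      have m1 := hL.master (x := x) (b := z / ρ) (a := v + c * (-z) ^ k) (y := w - c * x ^ k)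
        hx1 hz2 hz4 hx3 (by rw [hP, hzρ]; linarith)
      have ez : v - c * z ^ k = v + c * (-z) ^ k + modelPoly k γ z (z / ρ) := by
        rw [hP, hzρ, sub_self, zero_pow hk0]; ring
      have m2 := hL.master hz1 hz2 hz4 hz3 ez
      have m3 := (hL.leafY z hz1 _ hz2 _ hz4 _ hz3 ez).1
      have m4 := hplane (z / ρ) (v + c * (-z) ^ k) (by
        rw [hzρ]; exact hL.mem _ hz1 _ hz2 _ hz4)
      rw [hzρ, m3, hL.leafX z hz1 _ hz2 _ hz4] at m4
      rw [m1, m2, hP, hP, ← m4, sub_self, zero_pow hk0]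
      ring)
  have hA : ∀ a ∈ Ioo (-s) s, (F (0, 0, a)).1 = (F (0, 0, 0)).1 := fun a ha => by
    simpa [hk0] using hconst a ha
  refine hF.isDecomposable_of_flow h0 hγ (leafFlow_shear ((F (0, 0, 0)).1 / ρ) hP) (mem_univ _)
    (fun _ _ => mem_univ _) ?_
  filter_upwards [isOpen_Ioo.mem_nhds (⟨by linarith, hs⟩ : (0 : ℝ) ∈ Ioo (-s) s)] with a ha
  have h1 := hplane 0 a (by
    rw [mul_zero]; exact hL.mem _ hr0 _ hr0 _ (by
      simpa [hk0] using (hbox 0 hq0 a (hI ha)).2.2.1))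
  rw [mul_zero, hA a ha] at h1
  simp only [hA a ha]
  refine ⟨by field_simp; ring, ?_⟩
  rw [h1]; field_simp; ring

theorem sum_Icc_one_eq_sum_range (f : ℕ → ℝ) (n : ℕ) :
    ∑ i ∈ Finset.Icc 1 n, f i = ∑ i ∈ Finset.range n, f (i + 1) := by
  induction n with
  | zero => simp
  | succ n ih => rw [Finset.sum_Icc_succ_top (by omega), ih, Finset.sum_range_succ]

theorem mul_modelPolyDxb_one (t : ℝ) : t * modelPolyDxb k γ 1 t
    = ∑ i ∈ Finset.Icc 1 (k - 1), ((i : ℝ) * ((k - i : ℕ) : ℝ) * γ i) * t ^ i := by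
  rw [modelPolyDxb, Finset.mul_sum]
  refine Finset.sum_congr rfl fun i hi => ?_
  obtain ⟨j, rfl⟩ : ∃ j, i = j + 1 := ⟨i - 1, by have := Finset.mem_Icc.1 hi; omega⟩
  rw [one_pow, Nat.add_sub_cancel, pow_succ]
  ring

/-- The coefficients of `∂²P/∂x∂b` if it is a power of a linear form. -/
theorem coeff_of_modelPolyDxb_eq_pow {c₀ ρ : ℝ}
    (hQ : ∀ x b, modelPolyDxb k γ x b = c₀ * (x - ρ * b) ^ (k - 2)) {i : ℕ} (h1 : 1 ≤ i)
    (h2 : i ≤ k - 1) : (i : ℝ) * ((k - i : ℕ) : ℝ) * γ i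
      = c₀ * ((k - 2).choose (i - 1) * (-ρ) ^ (i - 1)) := by
  refine sub_eq_zero.1 (coeff_eq_zero_of_eventually (n := k - 1) (t₀ := 0)
    (e := fun i => (i : ℝ) * ((k - i : ℕ) : ℝ) * γ i
      - c₀ * ((k - 2).choose (i - 1) * (-ρ) ^ (i - 1))) (Eventually.of_forall fun t => ?_) h1 h2)
  simp only [sub_mul]
  rw [Finset.sum_sub_distrib, ← mul_modelPolyDxb_one, hQ, sum_Icc_one_eq_sum_range,
    sub_eq_zero, show (1 : ℝ) - ρ * t = -ρ * t + 1 by ring, add_pow, Finset.mul_sum,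
    Finset.mul_sum, show k - 2 + 1 = k - 1 by omega]
  refine Finset.sum_congr rfl fun m _ => ?_
  rw [Nat.add_sub_cancel, one_pow, mul_pow, pow_succ]
  ring

theorem choose_identity {k i : ℕ} (h1 : 1 ≤ i) (h2 : i ≤ k - 1) :
    k * (k - 1) * (k - 2).choose (i - 1) = i * (k - i) * k.choose i := by
  obtain ⟨m, rfl⟩ : ∃ m, i = m + 1 := ⟨i - 1, by omega⟩
  obtain ⟨n, rfl⟩ : ∃ n, k = n + 2 := ⟨k - 2, by omega⟩
  have e1 := Nat.add_one_mul_choose_eq (n + 1) m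
  have e2 := Nat.choose_mul_succ_eq n m
  simp only [Nat.add_sub_cancel, show n + 2 - 1 = n + 1 by omega,
    show n + 2 - (m + 1) = n + 1 - m by omega]
  calc (n + 2) * (n + 1) * n.choose m = (n + 2) * (n.choose m * (n + 1)) := by ring
    _ = (n + 1 + 1) * (n + 1).choose m * (n + 1 - m) := by rw [e2]; ring
    _ = (m + 1) * (n + 1 - m) * (n + 2).choose (m + 1) := by rw [e1]; ring

theorem modelPoly_eq_pow (hk : 2 < k) {c₀ ρ : ℝ} (hρ : ρ ≠ 0)
    (hQ : ∀ x b, modelPolyDxb k γ x b = c₀ * (x - ρ * b) ^ (k - 2)) (x b : ℝ) :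
    modelPoly k γ x b = c₀ / (k * (k - 1 : ℕ) * (-ρ))
      * ((x - ρ * b) ^ k - x ^ k - (-(ρ * b)) ^ k) := by
  set c := c₀ / (k * (k - 1 : ℕ) * (-ρ)) with hc
  have hk0 : (k : ℝ) ≠ 0 := Nat.cast_ne_zero.2 (by omega)
  have hk1 : ((k - 1 : ℕ) : ℝ) ≠ 0 := Nat.cast_ne_zero.2 (by omega)
  have hcc : c₀ = c * (k * (k - 1 : ℕ) * (-ρ)) := by
    rw [hc, div_mul_cancel₀]
    exact mul_ne_zero (mul_ne_zero hk0 hk1) (neg_ne_zero.2 hρ)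
  have hγ : ∀ i, 1 ≤ i → i ≤ k - 1 → γ i = c * (k.choose i * (-ρ) ^ i) := by
    intro i h1 h2
    have h3 := coeff_of_modelPolyDxb_eq_pow hQ h1 h2
    have h4 : (k : ℝ) * (k - 1 : ℕ) * (k - 2).choose (i - 1) = i * (k - i : ℕ) * k.choose i := by
      exact_mod_cast choose_identity h1 h2
    have h5 : (i : ℝ) * ((k - i : ℕ) : ℝ) ≠ 0 :=
      mul_ne_zero (Nat.cast_ne_zero.2 (by omega)) (Nat.cast_ne_zero.2 (by omega))
    refine mul_left_cancel₀ h5 ?_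
    have h6 : (-ρ) ^ i = (-ρ) ^ (i - 1) * (-ρ) := by rw [← pow_succ]; congr 1; omega
    rw [h3, hcc, h6]
    linear_combination (c * (-ρ) ^ (i - 1) * (-ρ)) * h4
  obtain ⟨n, rfl⟩ : ∃ n, k = n + 1 := ⟨k - 1, by omega⟩
  rw [show x - ρ * b = -(ρ * b) + x by ring, add_pow, Finset.sum_range_succ, Finset.sum_range_succ',
    modelPoly, sum_Icc_one_eq_sum_range, Nat.add_sub_cancel]
  simp only [pow_zero, Nat.sub_zero, Nat.choose_zero_right, Nat.cast_one, mul_one, one_mul,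
    Nat.sub_self, Nat.choose_self]
  rw [show ∀ S u v : ℝ, S + u + v - u - v = S by intros; ring, Finset.mul_sum]
  refine Finset.sum_congr rfl fun i hi => ?_
  rw [hγ (i + 1) (by omega) (by have := Finset.mem_range.1 hi; omega),
    show -(ρ * b) = -ρ * b by ring, mul_pow]
  ring

theorem eq_monomial_last_of_translate (hk : 2 < k)
    (hQ : ∀ t, modelPolyDxb k γ 1 t = modelPolyDxb k γ 0 t) {i : ℕ} (h1 : 1 ≤ i) (h2 : i ≤ k - 1)
    (h3 : i ≠ k - 1) : γ i = 0 := by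
  have h := coeff_eq_zero_of_eventually (n := k - 1) (t₀ := 0)
    (e := fun i => (i : ℝ) * ((k - i : ℕ) : ℝ) * γ i * (1 - 0 ^ (k - i - 1)))
    (Eventually.of_forall fun t => ?_) h1 h2
  · have h5 : (i : ℝ) * ((k - i : ℕ) : ℝ) ≠ 0 :=
      mul_ne_zero (Nat.cast_ne_zero.2 (by omega)) (Nat.cast_ne_zero.2 (by omega))
    rw [zero_pow (by omega), sub_zero, mul_one] at h
    exact (mul_eq_zero.1 h).resolve_left h5
  · refine Eq.trans ?_ (sub_eq_zero.2 (congrArg (t * ·) (hQ t)))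
    rw [modelPolyDxb, modelPolyDxb, Finset.mul_sum, Finset.mul_sum, ← Finset.sum_sub_distrib]
    refine Finset.sum_congr rfl fun i hi => ?_
    obtain ⟨j, rfl⟩ : ∃ j, i = j + 1 := ⟨i - 1, by have := Finset.mem_Icc.1 hi; omega⟩
    rw [one_pow, Nat.add_sub_cancel, pow_succ]
    generalize (0 : ℝ) ^ (k - (j + 1) - 1) = z
    ring

/-- Every automorphism defined near the origin is a finite composition of exponential images after
a change of signs of the coordinates. -/
theorem IsLocalAut.isDecomposable (hF : IsLocalAut k γ F) (h0 : (0 : Pt) ∈ F.source) (hk : 2 < k)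
    (hγ : ∃ i, 1 ≤ i ∧ i ≤ k - 1 ∧ γ i ≠ 0) : IsDecomposable k γ F := by
  have hne : ∀ i, 1 ≤ i → (∀ j, 1 ≤ j → j ≤ k - 1 → j ≠ i → γ j = 0) → γ i ≠ 0 := by
    intro i _ h hi
    obtain ⟨j, h1, h2, h3⟩ := hγ
    by_cases hj : j = i
    · exact h3 (hj ▸ hi)
    · exact h3 (h j h1 h2 hj)
  by_cases haxis : ∀ᶠ a in 𝓝 (0 : ℝ), (F (0, 0, a)).1 = 0 ∧ (F (0, 0, a)).2.1 = 0
  · exact hF.isDecomposable_of_axis h0 hγ haxis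
  obtain ⟨r, hL⟩ := hF.exists_leafForm h0
  have hr0 : (0 : ℝ) ∈ Ioo (-r) r := ⟨by linarith [hL.pos], hL.pos⟩
  obtain ⟨a, ha, hnot⟩ : ∃ a ∈ Ioo (-r) r, ¬((F (0, 0, a)).1 = 0 ∧ (F (0, 0, a)).2.1 = 0) := by
    by_contra! hall
    exact haxis (eventually_of_mem (isOpen_Ioo.mem_nhds hr0) fun a ha =>
      ⟨(hall a ha).1, (hall a ha).2⟩)
  have htr := hF.modelPolyDxb_translate (hL.mem 0 hr0 0 hr0 a ha)
  set x₁ := (F (0, 0, a)).1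
  set b₁ := (F (0, 0, a)).2.1
  -- `∂²P/∂x∂b` is invariant under translations in the direction of `(x₁, b₁) ≠ 0`
  by_cases hb : b₁ = 0
  · have hx : x₁ ≠ 0 := fun h => hnot ⟨h, hb⟩
    have h := fun i => eq_monomial_last_of_translate (γ := γ) (i := i) hk (fun t => by
      have := htr 0 t (1 / x₁)
      rwa [hb, mul_zero, add_zero, zero_add, one_div_mul_cancel hx] at this)
    exact hF.isDecomposable_of_last h0 hk (hne _ (by omega) h) h
  · set ρ := x₁ / b₁ with hρ
    have hQ : ∀ x b, modelPolyDxb k γ x b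
        = modelPolyDxb k γ 1 0 * (x - ρ * b) ^ (k - 2) := fun x b => by
      have h1 := htr x b (-(b / b₁))
      rw [show b + -(b / b₁) * b₁ = 0 by field_simp; ring,
        show x + -(b / b₁) * x₁ = (x - ρ * b) * 1 by rw [hρ]; field_simp; ring] at h1
      rw [← h1, mul_comm (modelPolyDxb k γ 1 0), ← modelPolyDxb_smul, mul_zero]
    set c₀ := modelPolyDxb k γ 1 0
    have hcoef := fun i (h1 : 1 ≤ i) (h2 : i ≤ k - 1) => coeff_of_modelPolyDxb_eq_pow hQ h1 h2
    have hi0 : ∀ i, 1 ≤ i → i ≤ k - 1 → (i : ℝ) * ((k - i : ℕ) : ℝ) ≠ 0 := fun i h1 h2 =>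
      mul_ne_zero (Nat.cast_ne_zero.2 (by omega)) (Nat.cast_ne_zero.2 (by omega))
    have hc₀ : c₀ ≠ 0 := by
      intro h
      obtain ⟨i, h1, h2, h3⟩ := hγ
      have := hcoef i h1 h2
      rw [h, zero_mul] at this
      exact h3 ((mul_eq_zero.1 this).resolve_left (hi0 i h1 h2))
    by_cases hρ0 : ρ = 0
    · have h : ∀ j, 1 ≤ j → j ≤ k - 1 → j ≠ 1 → γ j = 0 := fun j h1 h2 h3 => by
        have := hcoef j h1 h2
        rw [hρ0, neg_zero, zero_pow (by omega), mul_zero, mul_zero] at this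
        exact (mul_eq_zero.1 this).resolve_left (hi0 j h1 h2)
      exact hF.isDecomposable_of_first h0 hk (hne 1 le_rfl h) h
    · refine hF.isDecomposable_of_power h0 hk hγ (div_ne_zero hc₀ ?_) hc₀ hρ0
        (modelPoly_eq_pow hk hρ0 hQ) hQ
      exact mul_ne_zero (mul_ne_zero (Nat.cast_ne_zero.2 (by omega))
        (Nat.cast_ne_zero.2 (by omega))) (neg_ne_zero.2 hρ0)

end cases

end ParaCR

namespace ParaCR

/-! ### Orientation of the two direction fields -/

section orientation

variable {k : ℕ} {γ : ℕ → ℝ}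

/-- The differential of `f` at `p` maps `X` and `Y` to positive multiples of `X` and `Y`. -/
def IsPositiveAt (k : ℕ) (γ : ℕ → ℝ) (p : Pt) (f : Pt → Pt) : Prop :=
  ∃ (L : Pt →L[ℝ] Pt) (c d : ℝ), HasFDerivAt f L p ∧ 0 < c ∧ 0 < d ∧
    L (fieldX p) = c • fieldX (f p) ∧ L (fieldY k γ p) = d • fieldY k γ (f p)

theorem IsPositiveAt.comp {p : Pt} {f g : Pt → Pt} (hg : IsPositiveAt k γ (f p) g)
    (hf : IsPositiveAt k γ p f) : IsPositiveAt k γ p (fun q => g (f q)) := by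
  obtain ⟨L, c, d, hL, hc, hd, hX, hY⟩ := hf
  obtain ⟨L', c', d', hL', hc', hd', hX', hY'⟩ := hg
  refine ⟨L'.comp L, c * c', d * d', hL'.comp p hL, mul_pos hc hc', mul_pos hd hd', ?_, ?_⟩
  · simp only [ContinuousLinearMap.comp_apply, hX, map_smul, hX', smul_smul]
  · simp only [ContinuousLinearMap.comp_apply, hY, map_smul, hY', smul_smul]

theorem pos_of_isPreconnected {J : Set ℝ} (hJ : IsPreconnected J) {c : ℝ → ℝ}
    (hc : ContinuousOn c J) (hne : ∀ t ∈ J, c t ≠ 0) {s t : ℝ} (hs : s ∈ J) (ht : t ∈ J)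
    (hpos : 0 < c s) : 0 < c t := by
  by_contra hle
  obtain ⟨u, hu, hu0⟩ := hJ.intermediate_value ht hs hc ⟨not_lt.1 hle, hpos.le⟩
  exact hne u hu hu0

/-- Along a flow the multiples of `X` and `Y` depend continuously on time, never vanish, and are
equal to `1` at time `0`. -/
theorem IsExpAt.isPositiveAt {p : Pt} {g : Pt → Pt} (h : IsExpAt k γ p g) :
    IsPositiveAt k γ p g := by
  obtain ⟨V, W, U, J, Θ, hΘ, hp, h1, hg⟩ := h
  have hUn : U ∈ 𝓝 p := hΘ.isOpen_U.mem_nhds hp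
  have hJU : ∀ t ∈ J, J ×ˢ U ∈ 𝓝 (t, p) := fun t ht =>
    (hΘ.isOpen_J.prod hΘ.isOpen_U).mem_nhds ⟨ht, hp⟩
  set D : ℝ → Pt → Pt := fun t v => fderiv ℝ (fun z : ℝ × Pt => Θ z.1 z.2) (t, p) (0, v) with hD
  have hfd : ∀ t ∈ J, ∀ v, fderiv ℝ (Θ t) p v = D t v := fun t ht v => by
    have h2 := ((hΘ.smooth.contDiffAt (hJU t ht)).differentiableAt (by simp)).hasFDerivAt
    have h3 : HasFDerivAt (fun q : Pt => (t, q)) (ContinuousLinearMap.inr ℝ ℝ Pt) p :=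
      hasFDerivAt_prodMk_right t p
    have h4 : HasFDerivAt (Θ t) _ p := HasFDerivAt.comp p (f := fun q : Pt => (t, q)) h2 h3
    rw [h4.fderiv]
    simp [hD]
  have hcont : ∀ v, ContinuousOn (fun t => D t v) J := fun v t ht => by
    have h2 := (hΘ.smooth.contDiffAt (hJU t ht)).continuousAt_fderiv (by simp)
    have h3 : ContinuousAt (fun t : ℝ => (t, p)) t := by fun_prop
    exact ((ContinuousAt.comp (f := fun t : ℝ => (t, p)) h2 h3).clm_apply
      continuousAt_const).continuousWithinAt
  have haut : ∀ t ∈ J, DifferentiableAt ℝ (Θ t) p ∧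
      (∃ c : ℝ, c ≠ 0 ∧ D t (fieldX p) = c • fieldX (Θ t p)) ∧
      ∃ d : ℝ, d ≠ 0 ∧ D t (fieldY k γ p) = d • fieldY k γ (Θ t p) := fun t ht => by
    obtain ⟨F, hF, hs, he⟩ := hΘ.isLocalAut t ht
    have he' : F =ᶠ[𝓝 p] Θ t := eventually_of_mem hUn he
    have hps : p ∈ F.source := hs ▸ hp
    have hX := hF.map_X p hps
    have hY := hF.map_Y p hps
    rw [he'.fderiv_eq, hfd t ht, he hp] at hX hY
    exact ⟨he'.differentiableAt_iff.1 (hF.differentiableAt hps), hX, hY⟩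
  have hD0 : ∀ v, D 0 v = v := fun v => by
    have h2 : Θ 0 =ᶠ[𝓝 p] id := eventually_of_mem hUn hΘ.initial
    rw [← hfd 0 hΘ.zero_mem, h2.fderiv_eq, fderiv_id]
    rfl
  have hJ := hΘ.ordConnected_J.isPreconnected
  obtain ⟨hd, ⟨c, hc, hX⟩, ⟨d, hd', hY⟩⟩ := haut 1 h1
  have hc0 : 0 < (D 1 (fieldX p)).1 := by
    refine pos_of_isPreconnected (c := fun t => (D t (fieldX p)).1) hJ (hcont _).fst
      (fun t ht => ?_) hΘ.zero_mem h1 ?_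
    · obtain ⟨-, ⟨c, hc, hX⟩, -⟩ := haut t ht
      simp only [hX]
      simpa [fieldX] using hc
    · simp [hD0, fieldX]
  have hd0 : 0 < (D 1 (fieldY k γ p)).2.1 := by
    refine pos_of_isPreconnected (c := fun t => (D t (fieldY k γ p)).2.1) hJ (hcont _).snd.fst
      (fun t ht => ?_) hΘ.zero_mem h1 ?_
    · obtain ⟨-, -, ⟨d, hd, hY⟩⟩ := haut t ht
      simp only [hY]
      simpa [fieldY] using hd
    · simp [hD0, fieldY]
  rw [hX] at hc0
  rw [hY] at hd0
  refine ⟨fderiv ℝ (Θ 1) p, c, d, hd.hasFDerivAt.congr_of_eventuallyEq hg,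
    by simpa [fieldX] using hc0, by simpa [fieldY] using hd0, ?_, ?_⟩
  · rw [hfd 1 h1, hX, hg.self_of_nhds]
  · rw [hfd 1 h1, hY, hg.self_of_nhds]

theorem IsExpComp.isPositiveAt {p : Pt} {f : Pt → Pt} (h : IsExpComp k γ p f) :
    IsPositiveAt k γ p f := by
  induction h with
  | id => exact ⟨_, 1, 1, hasFDerivAt_id p, one_pos, one_pos, by simp, by simp⟩
  | comp _ hg ih => exact hg.isPositiveAt.comp ih

theorem fieldY_zero : fieldY k γ 0 = (0, 1, 0) := by
  simp [fieldY_eq, modelPolyDb_zero_right]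

/-- The factor by which a germ multiplies `X` at the origin. -/
noncomputable def multX : AutGerm k γ →* ℝ where
  toFun := Quotient.lift (fun F : PtAut k γ => (fderiv ℝ F.1 0 (fieldX 0)).1)
    fun _ _ h => by
      change _ =ᶠ[𝓝 (0 : Pt)] _ at h
      simp only [h.fderiv_eq]
  map_one' := by
    change (fderiv ℝ (fun p : Pt => p) 0 (fieldX 0)).1 = 1
    simp [fieldX]
  map_mul' := by
    rintro ⟨F⟩ ⟨G⟩
    change (fderiv ℝ (F.1 ∘ G.1) 0 (fieldX 0)).1
      = (fderiv ℝ F.1 0 (fieldX 0)).1 * (fderiv ℝ G.1 0 (fieldX 0)).1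
    obtain ⟨c, -, hc⟩ := G.2.1.map_X 0 G.2.2.1
    rw [fderiv_comp 0 (by rw [G.2.2.2]; exact F.2.1.differentiableAt F.2.2.1)
      (G.2.1.differentiableAt G.2.2.1), ContinuousLinearMap.comp_apply, hc, G.2.2.2, map_smul]
    simp [fieldX, mul_comm]

/-- The factor by which a germ multiplies `Y` at the origin. -/
noncomputable def multY : AutGerm k γ →* ℝ where
  toFun := Quotient.lift (fun F : PtAut k γ => (fderiv ℝ F.1 0 (fieldY k γ 0)).2.1)
    fun _ _ h => by
      change _ =ᶠ[𝓝 (0 : Pt)] _ at h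
      simp only [h.fderiv_eq]
  map_one' := by
    change (fderiv ℝ (fun p : Pt => p) 0 (fieldY k γ 0)).2.1 = 1
    simp [fieldY]
  map_mul' := by
    rintro ⟨F⟩ ⟨G⟩
    change (fderiv ℝ (F.1 ∘ G.1) 0 (fieldY k γ 0)).2.1
      = (fderiv ℝ F.1 0 (fieldY k γ 0)).2.1 * (fderiv ℝ G.1 0 (fieldY k γ 0)).2.1
    obtain ⟨c, -, hc⟩ := G.2.1.map_Y 0 G.2.2.1
    rw [fderiv_comp 0 (by rw [G.2.2.2]; exact F.2.1.differentiableAt F.2.2.1)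
      (G.2.1.differentiableAt G.2.2.1), ContinuousLinearMap.comp_apply, hc, G.2.2.2, map_smul]
    simp [fieldY_zero, mul_comm]

theorem multX_ne (g : AutGerm k γ) : multX g ≠ 0 := fun h => by
  have := map_mul multX g g⁻¹
  rw [mul_inv_cancel, map_one, h, zero_mul] at this
  exact one_ne_zero this

theorem multY_ne (g : AutGerm k γ) : multY g ≠ 0 := fun h => by
  have := map_mul multY g g⁻¹
  rw [mul_inv_cancel, map_one, h, zero_mul] at this
  exact one_ne_zero this

/-! ### Sign changes -/

theorem hasFDerivAt_diag (s₁ s₂ s₃ : ℝ) (p : Pt) :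
    ∃ L : Pt →L[ℝ] Pt, HasFDerivAt (diag s₁ s₂ s₃) L p ∧ ∀ v, L v = diag s₁ s₂ s₃ v := by
  obtain ⟨L, hL⟩ : ∃ L : Pt →L[ℝ] Pt, ⇑L = diag s₁ s₂ s₃ :=
    ⟨(s₁ • ContinuousLinearMap.fst ℝ ℝ (ℝ × ℝ)).prod
      (((s₂ • ContinuousLinearMap.fst ℝ ℝ ℝ).comp (ContinuousLinearMap.snd ℝ ℝ (ℝ × ℝ))).prod
      ((s₃ • ContinuousLinearMap.snd ℝ ℝ ℝ).comp (ContinuousLinearMap.snd ℝ ℝ (ℝ × ℝ)))), rfl⟩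
  exact ⟨L, hL ▸ L.hasFDerivAt, fun v => congrFun hL v⟩

theorem AdmissibleSigns.diag_diag {s₁ s₂ s₃ : ℝ} (h : AdmissibleSigns k γ s₁ s₂ s₃) (p : Pt) :
    diag s₁ s₂ s₃ (diag s₁ s₂ s₃ p) = p := by
  simp only [diag, ← mul_assoc, h.sq₁, h.sq₂, h.sq₃, one_mul]

/-- An admissible change of signs, as an automorphism that fixes the origin. -/
def AdmissibleSigns.toPtAut {s₁ s₂ s₃ : ℝ} (h : AdmissibleSigns k γ s₁ s₂ s₃) : PtAut k γ :=
  ⟨{ toFun := diag s₁ s₂ s₃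
     invFun := diag s₁ s₂ s₃
     source := univ
     target := univ
     map_source' := fun _ _ => mem_univ _
     map_target' := fun _ _ => mem_univ _
     left_inv' := fun p _ => h.diag_diag p
     right_inv' := fun p _ => h.diag_diag p
     open_source := isOpen_univ
     open_target := isOpen_univ
     continuousOn_toFun := by unfold diag; fun_prop
     continuousOn_invFun := by unfold diag; fun_prop },
    isLocalAut_of_leaves (by change ContDiffOn ℝ ∞ (diag s₁ s₂ s₃) univ; unfold diag; fun_prop)
      (by change ContDiffOn ℝ ∞ (diag s₁ s₂ s₃) univ; unfold diag; fun_prop)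
      (fun p _ q _ e => by
        change (diag s₁ s₂ s₃ p).2 = (diag s₁ s₂ s₃ q).2
        simp [diag, e])
      (fun p _ q _ e e' => by
        change (diag s₁ s₂ s₃ p).1 = (diag s₁ s₂ s₃ q).1 ∧
          ycoord k γ (diag s₁ s₂ s₃ p) = ycoord k γ (diag s₁ s₂ s₃ q)
        rw [h.ycoord_diag, h.ycoord_diag, e']
        simp [diag, e]),
    mem_univ _, diag_zero s₁ s₂ s₃⟩

/-- The germ of an admissible change of signs. -/
def AdmissibleSigns.germ {s₁ s₂ s₃ : ℝ} (h : AdmissibleSigns k γ s₁ s₂ s₃) : AutGerm k γ :=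
  Quotient.mk _ h.toPtAut

theorem AdmissibleSigns.multX_germ {s₁ s₂ s₃ : ℝ} (h : AdmissibleSigns k γ s₁ s₂ s₃) :
    multX h.germ = s₁ := by
  change (fderiv ℝ (diag s₁ s₂ s₃) 0 (fieldX 0)).1 = s₁
  obtain ⟨L, hL, hv⟩ := hasFDerivAt_diag s₁ s₂ s₃ 0
  rw [hL.fderiv, hv]
  simp [diag, fieldX]

theorem AdmissibleSigns.multY_germ {s₁ s₂ s₃ : ℝ} (h : AdmissibleSigns k γ s₁ s₂ s₃) :
    multY h.germ = s₂ := by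
  change (fderiv ℝ (diag s₁ s₂ s₃) 0 (fieldY k γ 0)).2.1 = s₂
  obtain ⟨L, hL, hv⟩ := hasFDerivAt_diag s₁ s₂ s₃ 0
  rw [hL.fderiv, hv]
  simp [diag, fieldY]

theorem AdmissibleSigns.inducedBy_germ {s₁ s₂ s₃ : ℝ} (h : AdmissibleSigns k γ s₁ s₂ s₃)
    {T : Amb → Amb} (hT : ∀ x b a y, T (x, b, a, y) = (s₁ * x, s₂ * b, s₃ * a, s₃ * y)) :
    InducedBy k γ h.germ T :=
  ⟨h.toPtAut, rfl, Eventually.of_forall fun p => by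
    rw [show param k γ p = (p.1, p.2.1, p.2.2, ycoord k γ p) from rfl, hT, ← h.ycoord_diag]
    rfl⟩

theorem eq_one_of_pos {s : ℝ} (h : s * s = 1) (hpos : 0 < s) : s = 1 := by
  rcases mul_self_eq_one_iff.1 h with h | h
  · exact h
  · linarith

/-- A germ differs from an admissible change of signs by a composition of exponential images, and
the signs are those of the factors by which the germ multiplies `X` and `Y`. -/
theorem PtAut.exists_signs (hk : 2 < k) (hγ : ∃ i, 1 ≤ i ∧ i ≤ k - 1 ∧ γ i ≠ 0)
    (F : PtAut k γ) : ∃ f s₁ s₂ s₃, IsExpComp k γ 0 f ∧ AdmissibleSigns k γ s₁ s₂ s₃ ∧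
      F.1 =ᶠ[𝓝 0] (fun p => f (diag s₁ s₂ s₃ p)) ∧
      0 < multX (k := k) (γ := γ) (Quotient.mk _ F) * s₁ ∧
      0 < multY (k := k) (γ := γ) (Quotient.mk _ F) * s₂ := by
  obtain ⟨f, s₁, s₂, s₃, hf, hs, he⟩ := F.2.1.isDecomposable F.2.2.1 hk hγ
  refine ⟨f, s₁, s₂, s₃, hf, hs, he, ?_⟩
  obtain ⟨L, c, d, hL, hc, hd, hX, hY⟩ := hf.isPositiveAt
  obtain ⟨D, hD, hDv⟩ := hasFDerivAt_diag s₁ s₂ s₃ 0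
  have hf0 : f 0 = 0 := by
    have : F.1 0 = f (diag s₁ s₂ s₃ 0) := he.self_of_nhds
    rw [diag_zero, F.2.2.2] at this
    exact this.symm
  rw [hf0] at hX hY
  have hcomp : HasFDerivAt F.1 (L.comp D) 0 :=
    (HasFDerivAt.comp (0 : Pt) (by rwa [diag_zero]) hD).congr_of_eventuallyEq he
  have e1 : diag s₁ s₂ s₃ (fieldX 0) = s₁ • fieldX 0 := by simp [diag, fieldX]
  have e2 : diag s₁ s₂ s₃ (fieldY k γ 0) = s₂ • fieldY k γ 0 := by simp [diag, fieldY_zero]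
  have hX' : multX (k := k) (γ := γ) (Quotient.mk _ F) = s₁ * c := by
    change (fderiv ℝ F.1 0 (fieldX 0)).1 = s₁ * c
    rw [hcomp.fderiv, ContinuousLinearMap.comp_apply, hDv, e1, map_smul, hX]
    simp [fieldX]
  have hY' : multY (k := k) (γ := γ) (Quotient.mk _ F) = s₂ * d := by
    change (fderiv ℝ F.1 0 (fieldY k γ 0)).2.1 = s₂ * d
    rw [hcomp.fderiv, ContinuousLinearMap.comp_apply, hDv, e2, map_smul, hY]
    simp [fieldY]
  rw [hX', hY', mul_right_comm, mul_right_comm s₂, hs.sq₁, hs.sq₂, one_mul, one_mul]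
  exact ⟨hc, hd⟩

/-- The exponential images are the germs that preserve the orientations of `X` and `Y`. -/
theorem mem_expSubgroup_iff (hk : 2 < k) (hγ : ∃ i, 1 ≤ i ∧ i ≤ k - 1 ∧ γ i ≠ 0)
    (g : AutGerm k γ) : g ∈ expSubgroup k γ ↔ 0 < multX g ∧ 0 < multY g := by
  constructor
  · intro hg
    refine Subgroup.closure_induction (p := fun g _ => 0 < multX g ∧ 0 < multY g) ?_ ?_ ?_ ?_ hg
    · rintro _ ⟨F, f, rfl, hf, he⟩
      obtain ⟨L, c, d, hL, hc, hd, hX, hY⟩ := hf.isPositiveAt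
      have hL' : HasFDerivAt F.1 L 0 := hL.congr_of_eventuallyEq he
      change 0 < (fderiv ℝ F.1 0 (fieldX 0)).1 ∧ 0 < (fderiv ℝ F.1 0 (fieldY k γ 0)).2.1
      rw [hL'.fderiv, hX, hY]
      simpa [fieldX, fieldY] using ⟨hc, hd⟩
    · simp
    · rintro x y - - ⟨h1, h2⟩ ⟨h3, h4⟩
      rw [map_mul, map_mul]
      exact ⟨mul_pos h1 h3, mul_pos h2 h4⟩
    · rintro x - ⟨h1, h2⟩
      have e1 := map_mul multX x x⁻¹
      have e2 := map_mul multY x x⁻¹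
      rw [mul_inv_cancel, map_one] at e1 e2
      exact ⟨(mul_pos_iff_of_pos_left h1).1 (e1 ▸ one_pos),
        (mul_pos_iff_of_pos_left h2).1 (e2 ▸ one_pos)⟩
  · rintro ⟨h1, h2⟩
    obtain ⟨F, rfl⟩ := Quotient.exists_rep g
    obtain ⟨f, s₁, s₂, s₃, hf, hs, he, hX, hY⟩ := PtAut.exists_signs hk hγ F
    have e1 := eq_one_of_pos hs.sq₁ ((mul_pos_iff_of_pos_left h1).1 hX)
    have e2 := eq_one_of_pos hs.sq₂ ((mul_pos_iff_of_pos_left h2).1 hY)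
    have e3 : s₃ = 1 := by
      obtain ⟨i, hi1, hi2, hi3⟩ := hγ
      rw [← hs.pow i hi1 hi2 hi3, e1, e2, one_pow, one_pow, one_mul]
    refine Subgroup.subset_closure ⟨F, f, rfl, hf, ?_⟩
    simpa [diag, e1, e2, e3] using he

theorem expSubgroup_normal (hk : 2 < k) (hγ : ∃ i, 1 ≤ i ∧ i ≤ k - 1 ∧ γ i ≠ 0) :
    (expSubgroup k γ).Normal := by
  have key : ∀ (φ : AutGerm k γ →* ℝ) (n g : AutGerm k γ), φ (g * n * g⁻¹) = φ n := by
    intro φ n g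
    have := map_mul φ g g⁻¹
    rw [mul_inv_cancel, map_one] at this
    rw [map_mul, map_mul, mul_right_comm, ← this, one_mul]
  refine ⟨fun n hn g => ?_⟩
  rw [mem_expSubgroup_iff hk hγ] at hn ⊢
  rwa [key, key]

/-! ### The group of discrete automorphisms -/

/-- `0` for positive and `1` for negative numbers. -/
noncomputable def signBit (c : ℝ) : ZMod 2 := if 0 < c then 0 else 1

theorem signBit_eq_zero {c : ℝ} : signBit c = 0 ↔ 0 < c := by
  unfold signBit
  split_ifs with h <;> simp [h]

theorem signBit_mul {c d : ℝ} (hc : c ≠ 0) (hd : d ≠ 0) :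
    signBit (c * d) = signBit c + signBit d := by
  have h2 : (1 : ZMod 2) + 1 = 0 := by decide
  rcases hc.lt_or_gt with h | h <;> rcases hd.lt_or_gt with h' | h'
  · simp [signBit, mul_pos_of_neg_of_neg h h', h.not_gt, h'.not_gt, h2]
  · simp [signBit, (mul_neg_of_neg_of_pos h h').not_gt, h.not_gt, h']
  · simp [signBit, (mul_neg_of_pos_of_neg h h').not_gt, h, h'.not_gt]
  · simp [signBit, mul_pos h h', h, h']

/-- Whether a germ reverses `X`. -/
noncomputable def bitX : AutGerm k γ →* Multiplicative (ZMod 2) :=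
  MonoidHom.mk' (fun g => Multiplicative.ofAdd (signBit (multX g))) fun g h => by
    rw [map_mul, signBit_mul (multX_ne g) (multX_ne h), ofAdd_add]

/-- Whether a germ reverses `X`, and whether it reverses exactly one of `X` and `Y`. -/
noncomputable def bitXY : AutGerm k γ →* Multiplicative (ZMod 2 × ZMod 2) :=
  MonoidHom.mk' (fun g => Multiplicative.ofAdd
    (signBit (multX g), signBit (multX g) + signBit (multY g))) fun g h => by
    rw [map_mul, map_mul, signBit_mul (multX_ne g) (multX_ne h),
      signBit_mul (multY_ne g) (multY_ne h), ← ofAdd_add, Prod.mk_add_mk, add_add_add_comm]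

theorem admissibleSigns_neg : AdmissibleSigns k γ (-1) (-1) ((-1) ^ k) := by
  refine ⟨by norm_num, by norm_num, ?_, fun i h1 h2 _ => ?_⟩
  · rw [← mul_pow]; norm_num
  · rw [← pow_add]; congr 1; omega

theorem admissibleSigns_neg_right {j : ℕ}
    (h : ∀ i, 1 ≤ i → i ≤ k - 1 → γ i ≠ 0 → i % 2 = j % 2) :
    AdmissibleSigns k γ 1 (-1) ((-1) ^ j) := by
  refine ⟨by norm_num, by norm_num, ?_, fun i h1 h2 h3 => ?_⟩
  · rw [← mul_pow]; norm_num
  · rw [one_pow, one_mul, neg_one_pow_eq_pow_mod_two, h i h1 h2 h3, ← neg_one_pow_eq_pow_mod_two]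

theorem mod_two_eq_of_neg_one_pow_eq {m n : ℕ} (h : (-1 : ℝ) ^ m = (-1) ^ n) : m % 2 = n % 2 := by
  rw [neg_one_pow_eq_pow_mod_two, neg_one_pow_eq_pow_mod_two (n := n)] at h
  rcases Nat.mod_two_eq_zero_or_one m with h1 | h1 <;>
  rcases Nat.mod_two_eq_zero_or_one n with h2 | h2 <;> rw [h1, h2] at h ⊢ <;> norm_num at h

theorem AdmissibleSigns.eq_of_mixed {s₁ s₂ s₃ : ℝ} (h : AdmissibleSigns k γ s₁ s₂ s₃) {i j : ℕ}
    (hi1 : 1 ≤ i) (hi2 : i ≤ k - 1) (hi : γ i ≠ 0) (hj1 : 1 ≤ j) (hj2 : j ≤ k - 1) (hj : γ j ≠ 0)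
    (hij : i % 2 ≠ j % 2) : s₁ = s₂ := by
  have e := (h.pow i hi1 hi2 hi).trans (h.pow j hj1 hj2 hj).symm
  rcases mul_self_eq_one_iff.1 h.sq₁ with rfl | rfl <;>
  rcases mul_self_eq_one_iff.1 h.sq₂ with rfl | rfl
  · rfl
  · rw [one_pow, one_pow, one_mul, one_mul] at e
    exact absurd (mod_two_eq_of_neg_one_pow_eq e) hij
  · rw [one_pow, one_pow, mul_one, mul_one] at e
    have := mod_two_eq_of_neg_one_pow_eq e
    omega
  · rfl

theorem signBit_one : signBit 1 = 0 := signBit_eq_zero.2 one_pos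

theorem signBit_neg_one : signBit (-1) = 1 := by simp [signBit]

/-- If the parities of the exponents are mixed, then `X` and `Y` are reversed simultaneously. -/
theorem expSubgroup_eq_ker_bitX (hk : 2 < k) {i j : ℕ} (hi1 : 1 ≤ i) (hi2 : i ≤ k - 1)
    (hi : γ i ≠ 0) (hj1 : 1 ≤ j) (hj2 : j ≤ k - 1) (hj : γ j ≠ 0) (hij : i % 2 ≠ j % 2) :
    expSubgroup k γ = bitX.ker := by
  ext g
  have hγ : ∃ i, 1 ≤ i ∧ i ≤ k - 1 ∧ γ i ≠ 0 := ⟨i, hi1, hi2, hi⟩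
  rw [mem_expSubgroup_iff hk hγ, MonoidHom.mem_ker]
  change _ ↔ signBit (multX g) = 0
  rw [signBit_eq_zero]
  refine ⟨fun h => h.1, fun h => ⟨h, ?_⟩⟩
  obtain ⟨F, rfl⟩ := Quotient.exists_rep g
  obtain ⟨f, s₁, s₂, s₃, hf, hs, he, hX, hY⟩ := PtAut.exists_signs hk hγ F
  have e1 := eq_one_of_pos hs.sq₁ ((mul_pos_iff_of_pos_left h).1 hX)
  rw [← hs.eq_of_mixed hi1 hi2 hi hj1 hj2 hj hij, e1, mul_one] at hY
  exact hY

theorem expSubgroup_eq_ker_bitXY (hk : 2 < k) (hγ : ∃ i, 1 ≤ i ∧ i ≤ k - 1 ∧ γ i ≠ 0) :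
    expSubgroup k γ = bitXY.ker := by
  ext g
  rw [mem_expSubgroup_iff hk hγ, MonoidHom.mem_ker]
  change _ ↔ (signBit (multX g), signBit (multX g) + signBit (multY g)) = (0, 0)
  rw [Prod.mk.injEq, ← signBit_eq_zero, ← signBit_eq_zero]
  refine and_congr_right fun h => ?_
  rw [h, zero_add]

end orientation

end ParaCR

theorem mainTheorem8 (k : ℕ) (hk : 2 < k) (γ : ℕ → ℝ)
    (hγ : ∃ i, 1 ≤ i ∧ i ≤ k - 1 ∧ γ i ≠ 0) :
    (∀ F : OpenPartialHomeomorph ParaCR.Pt ParaCR.Pt, ParaCR.IsLocalAut k γ F →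
      (0 : ParaCR.Pt) ∈ F.source →
      ∃ (G : ParaCR.PtAut k γ) (f : ParaCR.Pt → ParaCR.Pt), ParaCR.IsExpComp k γ 0 f ∧
        ∀ᶠ p in 𝓝 (0 : ParaCR.Pt), F p = f (G.1 p)) ∧
    ∃ _ : (ParaCR.expSubgroup k γ).Normal,
      ∃ σ₁ : ParaCR.AutGerm k γ,
        ParaCR.InducedBy k γ σ₁
          (fun (x, b, a, y) => (-x, -b, (-1) ^ k * a, (-1) ^ k * y)) ∧
        ((¬ ∃ r : ℕ, ∀ i, 1 ≤ i → i ≤ k - 1 → γ i ≠ 0 → i % 2 = r) →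
          ∃ e : ParaCR.DiscreteAut k γ ≃* Multiplicative (ZMod 2),
            e (σ₁ : ParaCR.DiscreteAut k γ) = Multiplicative.ofAdd 1) ∧
        (∀ j, 1 ≤ j → j ≤ k - 1 → γ j ≠ 0 →
          (∀ i, 1 ≤ i → i ≤ k - 1 → γ i ≠ 0 → i % 2 = j % 2) →
          ∃ σ₂ : ParaCR.AutGerm k γ,
            ParaCR.InducedBy k γ σ₂
              (fun (x, b, a, y) => (x, -b, (-1) ^ j * a, (-1) ^ j * y)) ∧
            ∃ e : ParaCR.DiscreteAut k γ ≃* Multiplicative (ZMod 2 × ZMod 2),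
              e (σ₁ : ParaCR.DiscreteAut k γ) = Multiplicative.ofAdd (1, 0) ∧
              e (σ₂ : ParaCR.DiscreteAut k γ) = Multiplicative.ofAdd (0, 1)) := by
  have h₁ : ParaCR.AdmissibleSigns k γ (-1) (-1) ((-1) ^ k) := ParaCR.admissibleSigns_neg
  refine ⟨fun F hF h0 => ?_, ParaCR.expSubgroup_normal hk hγ, h₁.germ, ?_, fun hmix => ?_,
    fun j hj1 hj2 hj hpar => ?_⟩
  · obtain ⟨f, s₁, s₂, s₃, hf, hs, he⟩ := hF.isDecomposable h0 hk hγ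
    exact ⟨hs.toPtAut, f, hf, he⟩
  · exact h₁.inducedBy_germ fun x b a y => by rw [neg_one_mul, neg_one_mul]
  · obtain ⟨i, hi1, hi2, hi⟩ := hγ
    obtain ⟨j, hj1, hj2, hj, hij⟩ : ∃ j, 1 ≤ j ∧ j ≤ k - 1 ∧ γ j ≠ 0 ∧ i % 2 ≠ j % 2 := by
      by_contra! hall
      exact hmix ⟨i % 2, fun j h1 h2 h3 => (hall j h1 h2 h3).symm⟩
    have := ParaCR.expSubgroup_normal hk ⟨i, hi1, hi2, hi⟩
    have hσ : ParaCR.bitX h₁.germ = Multiplicative.ofAdd 1 := by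
      change Multiplicative.ofAdd (ParaCR.signBit (ParaCR.multX h₁.germ)) = _
      rw [h₁.multX_germ, ParaCR.signBit_neg_one]
    have hsurj : Function.Surjective (ParaCR.bitX (k := k) (γ := γ)) := by
      intro z
      have hz : ∀ z : Multiplicative (ZMod 2), z = 1 ∨ z = Multiplicative.ofAdd 1 := by decide
      rcases hz z with rfl | rfl
      · exact ⟨1, map_one _⟩
      · exact ⟨_, hσ⟩
    exact ⟨QuotientGroup.liftEquiv (N := ParaCR.expSubgroup k γ) hsurj
      (ParaCR.expSubgroup_eq_ker_bitX hk hi1 hi2 hi hj1 hj2 hj hij), hσ⟩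
  · have h₂ : ParaCR.AdmissibleSigns k γ 1 (-1) ((-1) ^ j) := ParaCR.admissibleSigns_neg_right hpar
    have := ParaCR.expSubgroup_normal hk hγ
    have hσ₁ : ParaCR.bitXY h₁.germ = Multiplicative.ofAdd (1, 0) := by
      change Multiplicative.ofAdd (ParaCR.signBit (ParaCR.multX h₁.germ),
        ParaCR.signBit (ParaCR.multX h₁.germ) + ParaCR.signBit (ParaCR.multY h₁.germ)) = _
      rw [h₁.multX_germ, h₁.multY_germ, ParaCR.signBit_neg_one]
      rfl
    have hσ₂ : ParaCR.bitXY h₂.germ = Multiplicative.ofAdd (0, 1) := by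
      change Multiplicative.ofAdd (ParaCR.signBit (ParaCR.multX h₂.germ),
        ParaCR.signBit (ParaCR.multX h₂.germ) + ParaCR.signBit (ParaCR.multY h₂.germ)) = _
      rw [h₂.multX_germ, h₂.multY_germ, ParaCR.signBit_one, ParaCR.signBit_neg_one]
      rfl
    have hsurj : Function.Surjective (ParaCR.bitXY (k := k) (γ := γ)) := by
      intro z
      have hz : ∀ z : Multiplicative (ZMod 2 × ZMod 2), z = 1 ∨ z = Multiplicative.ofAdd (1, 0) ∨
          z = Multiplicative.ofAdd (0, 1) ∨
          z = Multiplicative.ofAdd (1, 0) * Multiplicative.ofAdd (0, 1) := by decide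
      rcases hz z with rfl | rfl | rfl | rfl
      · exact ⟨1, map_one _⟩
      · exact ⟨_, hσ₁⟩
      · exact ⟨_, hσ₂⟩
      · exact ⟨h₁.germ * h₂.germ, by rw [map_mul, hσ₁, hσ₂]⟩
    refine ⟨h₂.germ, ?_, QuotientGroup.liftEquiv (N := ParaCR.expSubgroup k γ) hsurj
      (ParaCR.expSubgroup_eq_ker_bitXY hk hγ), hσ₁, hσ₂⟩
    exact h₂.inducedBy_germ fun x b a y => by rw [neg_one_mul, one_mul]
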